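/- **Setting.** Let $\mathbb T=\mathbb R/\mathbb Z$ and $0<\alpha<1$. Let $f:\mathbb T\to\mathbb T$ be an orientation preserving covering map of class $\mathcal E_\alpha$. This means that there are a finite set $P\subset\mathbb T$ and an integer $N\ge 0$ such that: * $P_0:=f^N(P)$ consists of fixed points of $f$, and $f$ is $C^{1+\alpha}$ on each component of $\mathbb T\setminus P$ (that is, $Df$ is $\alpha$-Hölder on each component); * $Df(p^-)\ge Df(p^+)\ge 1$ for $p\in P_0$, and $Df(x^-)\ge Df(x^+)>1$ for $x\notin P_0$; * for $p\in P_0$, if $Df(p^+)=1$ (resp. $Df(p^-)=1$), then $(Df(x)-1)/d(x,p)^\alpha$ has a limit in $(0,\infty)$ as $x\downarrow p$ (resp. $x\uparrow p$). For $s\in\mathbb R$ put $f_s(x)=f(x)+s$. For $\mathbf t=(t_0,t_1,\dots)\in\Omega_\varepsilon^{\mathbb N}=[-\varepsilon,\varepsilon]^{\mathbb N}$ put $f^n_{\mathbf t}=f_{t_{n-1}}\circ\dots\circ f_{t_0}$. Let $\sigma$ be the shift on $\Omega_\varepsilon^{\mathbb N}$, and let $\mathbb P_\varepsilon=\mathrm{Leb}\times\theta_\varepsilon^{\mathbb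 N}$ on $\mathbb T\times\Omega_\varepsilon^{\mathbb N}$, where $\theta_\varepsilon$ is normalized Lebesgue measure on $[-\varepsilon,\varepsilon]$. For $\mathbf V\subset\mathbb T\times\Omega_\varepsilon^{\mathbb N}$ write $\mathbf V^{\mathbf t}=\{x:(x,\mathbf t)\in\mathbf V\}$. Let $I$ be a neighbourhood of $P_0$, each component of which contains a unique fixed point of $f$, this point lying in $P_0$. Assume that for $g=f_s$ with $|s|$ small the following hold: (i) $g(I)$ compactly contains $I$; (ii) $g|_I$ is injective; (iii) if $x\in I$ and $g(x)\notin I$ then $g^2(x)\notin I$; (iv) if $x,g(x)\in I$ then they lie in the same component of $I$. Let $\tau_*\in(0,1/2)$ be smaller than the distance from $f^{-1}(I)\cap I$ to $\mathbb T\setminus I$, and let $\lambda_*=\inf\{Df(x^+):x\notin f^{-3}(I)\cap I\}$. Let $U^{(n)}(x,\mathbf t)$ be the component of $(f^n_{\mathbf t})^{-1}(B_{\tau_*}(f^n_{\mathbf t}(x)))$ containing $x$, and let $$\Lambda^{(n)}(x,\mathbf t)=\inf_{y\in U^{(n)}(x,\mathbf t)}Df^n_{\mathbf t}(y^+),\qquad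 \mathcal L^{(n)}(x,\mathbf t)=\sup_{y\in U^{(n)}(x,\mathbf t)}\ \sum_{j=0}^{n-1}\left(\frac{1}{Df^{\,n-j}_{\sigma^j\mathbf t}\big(f^j_{\mathbf t}(y)^+\big)}\right)^{\alpha}.$$ A *nice set for $\varepsilon$-perturbations* is a measurable set $\mathbf V\subset\mathbb T\times\Omega_\varepsilon^{\mathbb N}$ such that for every $\mathbf t\in\Omega_\varepsilon^{\mathbb N}$: * $\mathbf V^{\mathbf t}$ is open and contains $P_0$, and each of its components meets $P_0$ in exactly one point; * $f^n_{\mathbf t}(x)\notin\mathbf V^{\sigma^n\mathbf t}$ for all $x\in\partial\mathbf V^{\mathbf t}$ and $n\ge 1$. **Theorem 6.1.** Fix $\tilde\alpha\in(\alpha,1)$. There is $\delta_0>0$ such that for each $\delta\in(0,\delta_0)$ there are constants $K,C,\varepsilon_0>0$ such that for each $\varepsilon\in(0,\varepsilon_0)$ there are a nice set $\mathbf V$ for $\varepsilon$-perturbations and a measurable function $m_{\mathbf V}$ with values in $\mathbb N\cup\{\infty\}$ with the following properties. 1. For every $\mathbf t\in\Omega_\varepsilon^{\mathbb N}$ and $p_0\in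 P_0$, the component $\mathbf V^{\mathbf t}(p_0)$ of $\mathbf V^{\mathbf t}$ containing $p_0$ satisfies $B_\delta(p_0)\subset\mathbf V^{\mathbf t}(p_0)\subset B_{2\delta}(p_0)$. In particular $B_\delta(P_0)\subset\mathbf V^{\mathbf t}\subset B_{2\delta}(P_0)$. 2. For $\mathbb P_\varepsilon$-almost every $(x,\mathbf t)\in\mathbf V$, $m=m_{\mathbf V}(x,\mathbf t)$ is a (finite) positive integer and $$f^m_{\mathbf t}(x)\in\mathbf V^{\sigma^m\mathbf t},\qquad \mathcal L^{(m)}(x,\mathbf t)\le K,\qquad \Lambda^{(m)}(x,\mathbf t)\ge\lambda_*.$$ 3. For every integer $m\ge 1$, $\ \mathbb P_\varepsilon\big(\{(x,\mathbf t)\in\mathbf V: m_{\mathbf V}(x,\mathbf t)>m\}\big)\le C\,m^{-1/\tilde\alpha}$. -/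

import Mathlib

open Set Filter Topology MeasureTheory ProbabilityTheory
open scoped ENNReal

noncomputable section

namespace Intermittent

/-- The circle `ℝ / ℤ` with its quotient metric; `volume` is its Haar probability measure. -/
abbrev Circ : Type := UnitAddCircle

/-! ### One-sided derivatives of circle maps -/

/-- The signed displacement `g (x + h) - g x`, represented by a real number in `(-1/2, 1/2]`.
For a continuous `g` and small `h` it is `G (u + h) - G u`, where `G` is a lift of `g` to the
real line and `u` is a real representative of `x`. -/
def disp (g : Circ → Circ) (x : Circ) (h : ℝ) : ℝ :=
  (AddCircle.equivIoc (1 : ℝ) (-1 / 2) (g (x + (h : Circ)) - g x) : ℝ)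

/-- The derivative from the right, `Dg(x⁺)`. -/
def rightDeriv (g : Circ → Circ) (x : Circ) : ℝ := derivWithin (disp g x) (Ioi 0) 0

/-- The derivative from the left, `Dg(x⁻)`. -/
def leftDeriv (g : Circ → Circ) (x : Circ) : ℝ := derivWithin (disp g x) (Iio 0) 0

/-! ### The class of maps -/

/-- Orientation preserving covering maps of the circle: coverings with a continuous strictly
increasing lift to the real line. -/
def IsOrientationPreservingCovering (f : Circ → Circ) : Prop :=
  IsCoveringMap f ∧
    ∃ F : ℝ → ℝ, Continuous F ∧ StrictMono F ∧ ∀ u : ℝ, ((F u : ℝ) : Circ) = f (u : Circ)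

/-- `f` is of class `C^{1+α}` on each component of the complement of `P`: it is differentiable
there, and on each component its derivative is `α`-Hölder (with respect to arc length in that
component; the points `u`, `v` below lie in one component, joined by the arc that is the image of
`[u, v]`). -/
def IsPiecewiseC1Holder (α : ℝ) (f : Circ → Circ) (P : Set Circ) : Prop :=
  (∀ x ∉ P, DifferentiableAt ℝ (disp f x) 0) ∧
    ∃ H : ℝ, ∀ u v : ℝ, (∀ w ∈ uIcc u v, (w : Circ) ∉ P) →
      |rightDeriv f (u : Circ) - rightDeriv f (v : Circ)| ≤ H * |u - v| ^ α

/-- The set `P₀ = f^N(P)`. -/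
def fixedSet (f : Circ → Circ) (P : Set Circ) (N : ℕ) : Set Circ := f^[N] '' P

/-- `f` belongs to the class `𝓔_α`, as witnessed by the set `P` and the integer `N`. -/
structure IsClassE (α : ℝ) (f : Circ → Circ) (P : Set Circ) (N : ℕ) : Prop where
  covering : IsOrientationPreservingCovering f
  finite : P.Finite
  fixed : ∀ p ∈ fixedSet f P N, f p = p
  smooth : IsPiecewiseC1Holder α f P
  deriv_fixed : ∀ p ∈ fixedSet f P N, rightDeriv f p ≤ leftDeriv f p ∧ 1 ≤ rightDeriv f p
  deriv_other : ∀ x ∉ fixedSet f P N, rightDeriv f x ≤ leftDeriv f x ∧ 1 < rightDeriv f x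
  neutral_right : ∀ p ∈ fixedSet f P N, rightDeriv f p = 1 → ∃ A : ℝ, 0 < A ∧
    Tendsto (fun h : ℝ => (rightDeriv f (p + (h : Circ)) - 1) / dist (p + (h : Circ)) p ^ α)
      (𝓝[>] 0) (𝓝 A)
  neutral_left : ∀ p ∈ fixedSet f P N, leftDeriv f p = 1 → ∃ A : ℝ, 0 < A ∧
    Tendsto (fun h : ℝ => (rightDeriv f (p + (h : Circ)) - 1) / dist (p + (h : Circ)) p ^ α)
      (𝓝[<] 0) (𝓝 A)

/-! ### Random perturbations -/

/-- The perturbed map `f_s (x) = f x + s`. -/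
def perturb (f : Circ → Circ) (s : ℝ) (x : Circ) : Circ := f x + (s : Circ)

/-- The random orbit `f_𝐭^n = f_{t_{n-1}} ∘ ⋯ ∘ f_{t_0}`. -/
def randIter (f : Circ → Circ) (t : ℕ → ℝ) : ℕ → Circ → Circ
  | 0 => id
  | n + 1 => fun x => perturb f (t n) (randIter f t n x)

/-- The iterated shift `σ^k`. -/
def shift (k : ℕ) (t : ℕ → ℝ) : ℕ → ℝ := fun i => t (i + k)

/-- The noise space `[-ε, ε]^ℕ`. -/
def noiseSpace (ε : ℝ) : Set (ℕ → ℝ) := {t | ∀ i, t i ∈ Icc (-ε) ε}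

/-- Normalized Lebesgue measure on `[-ε, ε]`. -/
def noiseLaw (ε : ℝ) : Measure ℝ := cond volume (Icc (-ε) ε)

/-- The measure `ℙ_ε = Leb × θ_ε^ℕ`, carried by `𝕋 × [-ε, ε]^ℕ`. -/
def jointLaw (ε : ℝ) : Measure (Circ × (ℕ → ℝ)) :=
  (volume : Measure Circ).prod (Measure.infinitePi fun _ : ℕ => noiseLaw ε)

/-! ### Expansion and distortion at scale `τ` -/

/-- The component `U_τ^{(n)}(x, 𝐭)` of `(f_𝐭^n)⁻¹ (B_τ(f_𝐭^n(x)))` that contains `x`. -/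
def pullback (f : Circ → Circ) (τ : ℝ) (n : ℕ) (x : Circ) (t : ℕ → ℝ) : Set Circ :=
  connectedComponentIn (randIter f t n ⁻¹' Metric.ball (randIter f t n x) τ) x

/-- The expansion `Λ_τ^{(n)}(x, 𝐭)`. -/
def expansion (f : Circ → Circ) (τ : ℝ) (n : ℕ) (x : Circ) (t : ℕ → ℝ) : ℝ :=
  ⨅ y : pullback f τ n x t, rightDeriv (randIter f t n) (y : Circ)

/-- The distortion sum `𝓛_τ^{(n)}(x, 𝐭)`. For maps of the class above every summand lies in
`(0, 1]`, so that the supremum is that of a bounded set. -/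
def distortion (α : ℝ) (f : Circ → Circ) (τ : ℝ) (n : ℕ) (x : Circ) (t : ℕ → ℝ) : ℝ :=
  ⨆ y : pullback f τ n x t, ∑ j ∈ Finset.range n,
    (1 / rightDeriv (randIter f (shift j t) (n - j)) (randIter f t j (y : Circ))) ^ α

/-! ### The neighbourhood `I` and the constants `τ_*`, `λ_*` -/

/-- The properties of `I` with respect to a map `g`: `g(I)` compactly contains `I`; `g` is
injective on `I`; a point that leaves `I` does not return at the next step; and a point of `I`
that stays in `I` stays in the same component. -/
structure IsEscapeRegion (g : Circ → Circ) (I : Set Circ) : Prop where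
  compactly : closure I ⊆ interior (g '' I)
  injOn : InjOn g I
  leave : ∀ x ∈ I, g x ∉ I → g (g x) ∉ I
  stay : ∀ x ∈ I, g x ∈ I → g x ∈ connectedComponentIn I x

/-- `I` is a neighbourhood of `P₀`, each component of which contains a unique fixed point
(a point of `P₀`), and the properties above hold for all `f_s` with `|s|` small. -/
structure IsAdmissibleNhd (f : Circ → Circ) (P₀ I : Set Circ) : Prop where
  nhd : P₀ ⊆ interior I
  unique_fixed : ∀ x ∈ I, ∃ p ∈ P₀, {y ∈ connectedComponentIn I x | f y = y} = {p}
  escape : ∃ s₀ : ℝ, 0 < s₀ ∧ ∀ s : ℝ, |s| ≤ s₀ → IsEscapeRegion (perturb f s) I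

/-- `τ` is an admissible scale `τ_*`: a number in `(0, 1/2)` smaller than the distance from
`f⁻¹(I) ∩ I` to the complement of `I`. -/
def IsAdmissibleScale (f : Circ → Circ) (I : Set Circ) (τ : ℝ) : Prop :=
  0 < τ ∧ τ < 1 / 2 ∧ ENNReal.ofReal τ < ⨅ x ∈ f ⁻¹' I ∩ I, Metric.infEDist x Iᶜ

/-- `λ_* = inf {Df(x) : x ∉ f^{-3}(I) ∩ I}`. -/
def lambdaStar (f : Circ → Circ) (I : Set Circ) : ℝ :=
  sInf (rightDeriv f '' (f^[3] ⁻¹' I ∩ I)ᶜ)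

/-! ### Nice sets -/

/-- The section `V^𝐭`. -/
def fiber (V : Set (Circ × (ℕ → ℝ))) (t : ℕ → ℝ) : Set Circ := {x | (x, t) ∈ V}

/-- Nice sets for `ε`-perturbations. -/
structure IsNiceSet (f : Circ → Circ) (P₀ : Set Circ) (ε : ℝ) (V : Set (Circ × (ℕ → ℝ))) :
    Prop where
  measurable : MeasurableSet V
  subset : V ⊆ univ ×ˢ noiseSpace ε
  isOpen_fiber : ∀ t ∈ noiseSpace ε, IsOpen (fiber V t)
  fixed_mem : ∀ t ∈ noiseSpace ε, P₀ ⊆ fiber V t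
  component : ∀ t ∈ noiseSpace ε, ∀ x ∈ fiber V t,
    ∃! p, p ∈ P₀ ∧ p ∈ connectedComponentIn (fiber V t) x
  boundary : ∀ t ∈ noiseSpace ε, ∀ x ∈ frontier (fiber V t), ∀ n : ℕ, 1 ≤ n →
    randIter f t n x ∉ fiber V (shift n t)

end Intermittent

end

namespace Intermittent

/-! Everything is done on the line, with a lift F and its random compositions `X`. The basic objects
are intervals [a, b] whose first T images have no break in their interior and for which the sum of
the lengths of these images to the power α is at most `κ₀` (`Pair`); on them distortion is at most
2. With q the reciprocal of the given exponent in (α, 1) and β = αq < 1, the heart of the proof is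
an induction in `exists_tail`: if L is the length of the image of [a, b] at time T, the points of
[a, b] without a good time up to T + N have measure at most C₄ N^(-q) (b - a)(1 + γ L^(-β)). The
weight L^(-β) penalizes short intervals but is integrable. Three mechanisms reproduce this bound.

Cutting at breaks. At a break the derivative drops by a factor at least χ > 1, so whatever lies to
the left of a break is expanded more than what lies to its right (`compare`). A piece that is short
when it is cut off was therefore proportionally short before, with an extra factor 1/χ for each
break further right. The weights of all pieces add up to a geometric series (`window`, `windows`),
whatever the number of pieces.

Long intervals. If L ≥ η, a bounded number of steps makes the middle third of the image longer than
1. It then covers a fixed point, so a definite proportion of points becomes good, and a small γ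
keeps the cost of cutting below half of that gain (`macro_cycle`).

Short intervals. Away from the fixed points there is uniform expansion. At distance A from a fixed
point, the distance grows per step by a factor at most about 1 + b A^β' and intervals are stretched
by at least 1 + a A^β', with the same β'. A passage from distance a' to distance R a' thus stretches
by any prescribed G once R is large, and noise small at scale a' does not matter (`trip_gain`). Each
part of the interval is cut off when it leaves the δ-neighbourhood; the gain G turns L^(-β) into at
most half of itself plus a constant (`small_cycle`). The parts that stay for n steps have length
O(n^(-1/α)) by `exists_len_le`, an admissible loss.

One cycle multiplies the weighted bound by some θ < 1 and uses at most a fraction ρ of the remaining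
time, with (1 - ρ)^(-q) θ < 1; this closes the induction.

The fibres of the nice set are the components, around the fixed points, of the open set `Near` of
points whose orbit ever enters the δ-neighbourhood. A boundary point whose orbit hits the nice set
would lie in `Near`, hence in the interior. The components stay within 2δ because on each side, at
distance between δ and 3δ/2, there is a point whose orbit avoids the δ-neighbourhood forever
(`exists_avoiding`): an interval next to the neighbourhood has grown enough, when it comes back, to
cover another such interval. The function m_V is the first good time; at a good time the pullback of
a ball lies in an interval of small distortion, which bounds the distortion sum and yields any
prescribed expansion (`Good.bounds`). -/

/-- The lift to the real line of a circle map of class `𝓔_α`, with its right derivative `D`, the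
lifts `Q` of the fixed points and the lifts `B` of the points where the derivative jumps. -/
structure LiftSystem (α : ℝ) where
  F : ℝ → ℝ
  D : ℝ → ℝ
  Q : Set ℝ
  B : Set ℝ
  d : ℤ
  r : ℝ
  H : ℝ
  g : ℝ
  χ : ℝ
  Λ : ℝ
  a : ℝ
  b : ℝ
  α_pos : 0 < α
  strictMono : StrictMono F
  cont : Continuous F
  map_add_one : ∀ u, F (u + 1) = F u + d
  hasDeriv : ∀ u, HasDerivWithinAt F (D u) (Ici u) u
  one_le : ∀ u, 1 ≤ D u
  le_Λ : ∀ u, D u ≤ Λ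
  Q_nonempty : Q.Nonempty
  Q_fixed : ∀ c ∈ Q, ∃ n : ℤ, F c = c + n
  Q_add : ∀ c ∈ Q, ∀ n : ℤ, c + n ∈ Q
  r_pos : 0 < r
  Q_sep : ∀ c ∈ Q, ∀ c' ∈ Q, c ≠ c' → r ≤ |c - c'|
  a_pos : 0 < a
  b_pos : 0 < b
  -- The exponent β is α on a side where the derivative at the fixed point equals 1 and 0 on a side
  -- where it exceeds 1, so neutral and expanding sides are treated alike.
  right : ∀ c ∈ Q, ∃ β, 0 ≤ β ∧ β ≤ α ∧ (∀ z, 0 < z → z < r → 1 + a * z ^ β ≤ D (c + z)) ∧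
    ∀ z, 0 < z → z < r → F (c + z) - F c ≤ z * (1 + b * z ^ β)
  left : ∀ c ∈ Q, ∃ β, 0 ≤ β ∧ β ≤ α ∧ (∀ z, 0 < z → z < r → 1 + a * z ^ β ≤ D (c - z)) ∧
    ∀ z, 0 < z → z < r → F c - F (c - z) ≤ z * (1 + b * z ^ β)
  away : ∀ ρ > 0, ∃ l > 1, ∀ u, (∀ c ∈ Q, ρ ≤ |u - c|) → l ≤ D u
  H_pos : 0 < H
  g_pos : 0 < g
  one_lt_χ : 1 < χ
  holder : ∀ u v, u ≤ v → v - u ≤ g → (∀ x ∈ Ioc u v, x ∉ B) → |D u - D v| ≤ H * (v - u) ^ α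
  -- Derivatives only drop at breaks. This one-sided Hölder bound therefore survives across breaks,
  -- and the next field improves it by the factor χ as soon as there is one.
  upper : ∀ u v, u ≤ v → v - u ≤ g → D v ≤ D u + H * (v - u) ^ α
  jump : ∀ u v q, q ∈ B → u < q → q ≤ v → v - u ≤ g → χ * D v ≤ D u + H * (v - u) ^ α
  B_sep : ∀ q ∈ B, ∀ q' ∈ B, |q - q'| ≤ g → q = q'

namespace LiftSystem
variable {α : ℝ} (S : LiftSystem α)

/-! ### Slopes -/

lemma le_slope {m u v : ℝ} (huv : u ≤ v) (h : ∀ x ∈ Ico u v, m ≤ S.D x) :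
    m * (v - u) ≤ S.F v - S.F u := by
  have key := image_le_of_deriv_right_le_deriv_boundary (f := fun x => m * (x - u))
    (f' := fun _ => m) (a := u) (b := v) (B := fun x => S.F x - S.F u) (B' := S.D)
    (by fun_prop) (fun x _ => by
      simpa using (((hasDerivAt_id x).sub_const u).const_mul m).hasDerivWithinAt)
    (by simp) ((S.cont.sub continuous_const).continuousOn)
    (fun x _ => (S.hasDeriv x).sub_const _) h
  exact key (right_mem_Icc.2 huv)

lemma slope_le {m u v : ℝ} (huv : u ≤ v) (h : ∀ x ∈ Ico u v, S.D x ≤ m) :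
    S.F v - S.F u ≤ m * (v - u) := by
  have key := image_le_of_deriv_right_le_deriv_boundary (B := fun x => m * (x - u))
    (B' := fun _ => m) (a := u) (b := v) (f := fun x => S.F x - S.F u) (f' := S.D)
    ((S.cont.sub continuous_const).continuousOn) (fun x _ => (S.hasDeriv x).sub_const _)
    (by simp) (by fun_prop) (fun x _ => by
      simpa using (((hasDerivAt_id x).sub_const u).const_mul m).hasDerivWithinAt) h
  exact key (right_mem_Icc.2 huv)

lemma sub_le_sub_F {u v : ℝ} (huv : u ≤ v) : v - u ≤ S.F v - S.F u := by
  simpa using S.le_slope (m := 1) huv fun x _ => S.one_le x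

lemma sub_F_le {u v : ℝ} (huv : u ≤ v) : S.F v - S.F u ≤ S.Λ * (v - u) :=
  S.slope_le huv fun x _ => S.le_Λ x

lemma one_le_Λ : 1 ≤ S.Λ := (S.one_le 0).trans (S.le_Λ 0)

lemma surjective : Function.Surjective S.F := by
  apply S.cont.surjective
  · refine tendsto_atTop_mono' _ ?_ (tendsto_atTop_add_const_right atTop (S.F 0) tendsto_id)
    filter_upwards [eventually_ge_atTop 0] with x hx
    have := S.sub_le_sub_F hx
    simp only [id]; linarith
  · refine tendsto_atBot_mono' _ ?_ (tendsto_atBot_add_const_right atBot (S.F 0) tendsto_id)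
    filter_upwards [eventually_le_atBot 0] with x hx
    have := S.sub_le_sub_F hx
    simp only [id]; linarith

lemma map_add_int (u : ℝ) (n : ℤ) : S.F (u + n) = S.F u + S.d * n := by
  induction n using Int.induction_on with
  | zero => simp
  | succ k ih =>
    have := S.map_add_one (u + k)
    push_cast at *
    rw [← add_assoc, this, ih]; ring
  | pred k ih =>
    have := S.map_add_one (u + (-(k : ℝ) - 1))
    push_cast at *
    rw [show u + (-(k : ℝ) - 1) + 1 = u + -k by ring, ih] at this
    linarith

lemma D_add_int (u : ℝ) (n : ℤ) : S.D (u + n) = S.D u := by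
  have h1 := S.hasDeriv (u + n)
  have h2 : HasDerivWithinAt (fun x => S.F (x + n)) (S.D (u + n)) (Ici u) u := by
    have := h1.scomp u (h := fun x : ℝ => x + n) (s := Ici u) (h' := 1)
      ((hasDerivAt_id u).add_const _).hasDerivWithinAt
      (fun x (hx : u ≤ x) => show u + n ≤ x + n by linarith)
    rw [one_smul] at this
    exact this
  simp only [S.map_add_int] at h2
  have h3 := (S.hasDeriv u).add_const (S.d * n : ℝ)
  exact (uniqueDiffWithinAt_Ici u).eq_deriv _ h2 h3

/-- The orbit of a lifted fixed point under the unperturbed map. -/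
lemma exists_center {c : ℝ} (hc : c ∈ S.Q) :
    ∃ N : ℕ → ℤ, N 0 = 0 ∧ ∀ i, S.F (c + N i) = c + N (i + 1) := by
  obtain ⟨k, hk⟩ := S.Q_fixed c hc
  let N : ℕ → ℤ := fun i => Nat.rec 0 (fun _ m => k + S.d * m) i
  refine ⟨N, rfl, fun i => ?_⟩
  rw [S.map_add_int, hk, show N (i + 1) = k + S.d * N i from rfl]
  push_cast; ring

/-- For short intervals: only one lifted fixed point has to be watched, all others being at distance
at least r / 2. -/
lemma near_Q (u : ℝ) : ∃ c ∈ S.Q, ∀ c' ∈ S.Q, c' ≠ c → S.r / 2 ≤ |u - c'| := by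
  by_cases h : ∃ c ∈ S.Q, |u - c| < S.r / 2
  · obtain ⟨c, hc, hcu⟩ := h
    refine ⟨c, hc, fun c' hc' hne => ?_⟩
    have h1 := S.Q_sep c' hc' c hc hne
    have h2 : |c' - c| ≤ |u - c| + |u - c'| := by
      rw [show c' - c = (u - c) - (u - c') by ring]; exact abs_sub _ _
    linarith
  · push Not at h
    obtain ⟨c, hc⟩ := S.Q_nonempty
    exact ⟨c, hc, fun c' hc' _ => h c' hc'⟩

lemma exists_Q_mem (x : ℝ) : ∃ c ∈ S.Q, x ≤ c ∧ c < x + 1 := by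
  obtain ⟨c, hc⟩ := S.Q_nonempty
  refine ⟨c + ⌈x - c⌉, S.Q_add c hc _, ?_, ?_⟩
  · linarith [Int.le_ceil (x - c)]
  · linarith [Int.ceil_lt_add_one (x - c)]

/-! ### Growth of intervals -/

/-- Near a fixed point the local lower bound has an exponent β ≤ α, and s ^ α ≤ z ^ β for s ≤ z, s ≤
1. Elsewhere the expansion is uniform. -/
lemma exists_le_D : ∃ c₀ > 0, ∀ s, 0 < s → s ≤ 1 → ∀ u, (∀ c ∈ S.Q, s ≤ |u - c|) →
    1 + c₀ * s ^ α ≤ S.D u := by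
  obtain ⟨l, hl, hl'⟩ := S.away (S.r / 2) (by linarith [S.r_pos])
  refine ⟨min S.a (l - 1), lt_min S.a_pos (by linarith), fun s hs hs1 u hu => ?_⟩
  have hsα : s ^ α ≤ 1 := Real.rpow_le_one hs.le hs1 S.α_pos.le
  have hsα0 : 0 < s ^ α := Real.rpow_pos_of_pos hs α
  have hpow : ∀ β, 0 ≤ β → β ≤ α → ∀ z, s ≤ z → s ^ α ≤ z ^ β := fun β h0 h1 z hz =>
    (Real.rpow_le_rpow_of_exponent_ge hs hs1 h1).trans (Real.rpow_le_rpow hs.le hz h0)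
  by_cases h : ∀ c ∈ S.Q, S.r / 2 ≤ |u - c|
  · have := hl' u h
    have : min S.a (l - 1) * s ^ α ≤ (l - 1) * 1 := by
      apply mul_le_mul (min_le_right _ _) hsα hsα0.le (by linarith)
    linarith
  · push Not at h
    obtain ⟨c, hc, hcu⟩ := h
    have hsu := hu c hc
    have hfin : ∀ β, 0 ≤ β → β ≤ α → ∀ z, s ≤ z →
        min S.a (l - 1) * s ^ α ≤ S.a * z ^ β := fun β h0 h1 z hz =>
      mul_le_mul (min_le_left _ _) (hpow β h0 h1 z hz) hsα0.le S.a_pos.le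
    rcases le_total c u with hle | hle
    · rw [abs_of_nonneg (by linarith)] at hcu hsu
      obtain ⟨β, h0, h1, h2, -⟩ := S.right c hc
      have := h2 (u - c) (by linarith) (by linarith [S.r_pos])
      rw [add_sub_cancel] at this
      linarith [hfin β h0 h1 _ hsu]
    · rw [abs_of_nonpos (by linarith)] at hcu hsu
      obtain ⟨β, h0, h1, h2, -⟩ := S.left c hc
      have := h2 (c - u) (by linarith) (by linarith [S.r_pos])
      rw [sub_sub_cancel] at this
      linarith [hfin β h0 h1 (c - u) (by linarith)]

/-- Every interval is expanded, the more so the longer it is. -/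
lemma exists_growth : ∃ c > 0, ∀ u v, u ≤ v → v ≤ u + 1 →
    (v - u) * (1 + c * (v - u) ^ α) ≤ S.F v - S.F u := by
  obtain ⟨c₀, hc₀, h⟩ := S.exists_le_D
  have hr := S.r_pos
  -- The length s = κL is at most L / 8 and r / 8. If some fixed point lies in (u - s, u + 2s), then
  -- [u + 3s, u + 4s] is at distance s from it and from all others; if there is none, [u, u + s]
  -- will do.
  set κ := min 1 S.r / 8 with hκ
  have hκ0 : 0 < κ := by positivity
  have hκ1 : κ ≤ 1 / 8 := by rw [hκ]; linarith [min_le_left 1 S.r]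
  have hκr : κ ≤ S.r / 8 := by rw [hκ]; linarith [min_le_right 1 S.r]
  refine ⟨c₀ * κ ^ α * κ, by positivity, fun u v huv hv1 => ?_⟩
  rcases huv.eq_or_lt with rfl | huv'
  · simp
  set L := v - u with hL
  have hL0 : 0 < L := by linarith
  have hL1 : L ≤ 1 := by linarith
  set s := κ * L with hs
  have hs0 : 0 < s := by positivity
  have hs1 : s ≤ L / 8 := by nlinarith
  have hsr : s ≤ S.r / 8 := by nlinarith
  -- a subinterval of length `s` at distance `s` from the fixed points
  obtain ⟨x, hx1, hx2, hx3⟩ : ∃ x, u ≤ x ∧ x + s ≤ v ∧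
      ∀ y ∈ Icc x (x + s), ∀ c ∈ S.Q, s ≤ |y - c| := by
    by_cases hq : ∃ c ∈ S.Q, u - s < c ∧ c < u + 2 * s
    · obtain ⟨c, hc, hc1, hc2⟩ := hq
      refine ⟨u + 3 * s, by linarith, by linarith, fun y hy c' hc' => ?_⟩
      by_cases hcc : c' = c
      · subst hcc
        rw [abs_of_nonneg (by linarith [hy.1])]; linarith [hy.1]
      · have := S.Q_sep c' hc' c hc hcc
        rcases le_abs.1 this with h' | h'
        · rw [abs_of_nonpos (by linarith [hy.2])]; linarith [hy.2]
        · rw [abs_of_nonneg (by linarith [hy.1])]; linarith [hy.1]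
    · push Not at hq
      refine ⟨u, le_rfl, by linarith, fun y hy c hc => ?_⟩
      by_cases hc1 : u - s < c
      · have := hq c hc hc1
        rw [abs_of_nonpos (by linarith [hy.2])]; linarith [hy.2]
      · rw [abs_of_nonneg (by linarith [hy.1])]; linarith [hy.1]
  have e1 := S.sub_le_sub_F hx1
  have e2 := S.sub_le_sub_F hx2
  have e3 := S.le_slope (m := 1 + c₀ * s ^ α) (u := x) (v := x + s) (by linarith)
    fun y hy => h s hs0 (by linarith) y (hx3 y ⟨hy.1, hy.2.le⟩)
  have hpow : s ^ α = κ ^ α * L ^ α := Real.mul_rpow hκ0.le hL0.le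
  have : (1 + c₀ * s ^ α) * (x + s - x) = s + L * (c₀ * κ ^ α * κ * L ^ α) := by
    rw [hpow, hs]; ring
  rw [this] at e3
  linarith

/-! ### Random orbits on the line -/

/-- The lifted random orbit. -/
def X (t : ℕ → ℝ) : ℕ → ℝ → ℝ
  | 0 => fun u => u
  | n + 1 => fun u => S.F (X t n u) + t n

variable (t : ℕ → ℝ)

@[simp] lemma X_zero (u : ℝ) : S.X t 0 u = u := rfl

lemma X_succ (n : ℕ) (u : ℝ) : S.X t (n + 1) u = S.F (S.X t n u) + t n := rfl

lemma X_strictMono (n : ℕ) : StrictMono (S.X t n) := by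
  induction n with
  | zero => exact strictMono_id
  | succ n ih => exact fun u v h => by simpa [X_succ] using S.strictMono (ih h)

lemma X_continuous (n : ℕ) : Continuous (S.X t n) := by
  induction n with
  | zero => exact continuous_id
  | succ n ih => exact (S.cont.comp ih).add continuous_const

lemma X_surjective (n : ℕ) : Function.Surjective (S.X t n) := by
  induction n with
  | zero => exact Function.surjective_id
  | succ n ih =>
    intro y
    obtain ⟨z, hz⟩ := S.surjective (y - t n)
    obtain ⟨u, rfl⟩ := ih z
    exact ⟨u, by rw [X_succ, hz]; ring⟩

lemma X_le {n : ℕ} {u v : ℝ} : S.X t n u ≤ S.X t n v ↔ u ≤ v := (S.X_strictMono t n).le_iff_le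

lemma X_lt {n : ℕ} {u v : ℝ} : S.X t n u < S.X t n v ↔ u < v := (S.X_strictMono t n).lt_iff_lt

/-- The length of the image of `[a, b]` at time `j`. -/
def len (j : ℕ) (a b : ℝ) : ℝ := S.X t j b - S.X t j a

@[simp] lemma len_zero (a b : ℝ) : S.len t 0 a b = b - a := rfl

lemma len_add (j : ℕ) (a b c : ℝ) : S.len t j a b + S.len t j b c = S.len t j a c := by
  simp only [len]; ring

lemma len_pos {j : ℕ} {a b : ℝ} (h : a < b) : 0 < S.len t j a b := sub_pos.2 ((S.X_lt t).2 h)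

lemma len_nonneg {j : ℕ} {a b : ℝ} (h : a ≤ b) : 0 ≤ S.len t j a b := sub_nonneg.2 ((S.X_le t).2 h)

lemma len_mono {j : ℕ} {a b a' b' : ℝ} (h : a ≤ a') (h' : b' ≤ b) :
    S.len t j a' b' ≤ S.len t j a b :=
  sub_le_sub ((S.X_le t).2 h') ((S.X_le t).2 h)

lemma len_succ (j : ℕ) (a b : ℝ) :
    S.len t (j + 1) a b = S.F (S.X t j b) - S.F (S.X t j a) := by
  simp only [len, X_succ]; ring

lemma len_le_succ (j : ℕ) {a b : ℝ} (h : a ≤ b) : S.len t j a b ≤ S.len t (j + 1) a b := by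
  rw [len_succ]; exact S.sub_le_sub_F ((S.X_le t).2 h)

lemma len_le_of_le {i j : ℕ} (hij : i ≤ j) {a b : ℝ} (h : a ≤ b) :
    S.len t i a b ≤ S.len t j a b := by
  induction j, hij using Nat.le_induction with
  | base => exact le_rfl
  | succ j _ ih => exact ih.trans (S.len_le_succ t j h)

lemma len_succ_le (j : ℕ) {a b : ℝ} (h : a ≤ b) : S.len t (j + 1) a b ≤ S.Λ * S.len t j a b := by
  rw [len_succ]; exact S.sub_F_le ((S.X_le t).2 h)

lemma len_add_le (j n : ℕ) {a b : ℝ} (h : a ≤ b) :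
    S.len t (j + n) a b ≤ S.Λ ^ n * S.len t j a b := by
  induction n with
  | zero => simp
  | succ n ih =>
    calc S.len t (j + n + 1) a b ≤ S.Λ * S.len t (j + n) a b := S.len_succ_le t _ h
      _ ≤ S.Λ * (S.Λ ^ n * S.len t j a b) :=
        mul_le_mul_of_nonneg_left ih (by linarith [S.one_le_Λ])
      _ = _ := by ring

lemma exists_len_eq (j : ℕ) (a : ℝ) {h : ℝ} (hh : 0 ≤ h) : ∃ b, a ≤ b ∧ S.len t j a b = h := by
  obtain ⟨b, hb⟩ := S.X_surjective t j (S.X t j a + h)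
  exact ⟨b, (S.X_le t).1 (by rw [hb]; linarith), by rw [len, hb]; ring⟩

end LiftSystem

/-! ### Rates of escape from the fixed points -/

/-- A positive sequence growing by the factor `1 + c ℓ ^ α` and bounded by one is polynomially
small at its start. -/
lemma le_rpow_of_growth {α c : ℝ} (hα : 0 < α) (hc : 0 < c) :
    ∃ C > 0, ∀ (n : ℕ) (l : ℕ → ℝ), 1 ≤ n → (∀ i ≤ n, 0 < l i) →
      (∀ i < n, l i ≤ 1 → l i * (1 + c * l i ^ α) ≤ l (i + 1)) → (∀ i < n, l i ≤ l (i + 1)) →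
      l n ≤ 1 → l 0 ≤ C * (n : ℝ) ^ (-1 / α) := by
  -- For y in [0, 1], (1 + c y) ^ α ≥ 1 + d y and (1 + d y)⁻¹ ≤ 1 - c' y. With y = l ^ α, each step
  -- lowers l ^ (-α) by at least c'.
  set d := α * c / (1 + c) with hd
  have hd0 : 0 < d := by positivity
  set c' := d / (1 + d) with hc'
  have hc'0 : 0 < c' := by positivity
  refine ⟨c' ^ (-1 / α), by positivity, fun n l hn hpos hgr hmono hl => ?_⟩
  have hle1 : ∀ k ≤ n, l (n - k) ≤ 1 := by
    intro k hk
    induction k with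
    | zero => simpa using hl
    | succ k ih =>
      have := hmono (n - (k + 1)) (by omega)
      rw [show n - (k + 1) + 1 = n - k by omega] at this
      exact this.trans (ih (by omega))
  have hle1' : ∀ i ≤ n, l i ≤ 1 := fun i hi => by
    have := hle1 (n - i) (by omega)
    rwa [show n - (n - i) = i by omega] at this
  -- the inverse power decreases by a definite amount
  have step : ∀ i < n, (l (i + 1)) ^ (-α) ≤ (l i) ^ (-α) - c' := by
    intro i hi
    have h0 := hpos i hi.le
    have h1 := hle1' i hi.le
    set y := l i ^ α with hy
    have hy0 : 0 < y := by positivity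
    have hy1 : y ≤ 1 := Real.rpow_le_one h0.le h1 hα.le
    have hb : 1 + d * y ≤ (1 + c * y) ^ α := by
      have hlog : c * y / (1 + c) ≤ Real.log (1 + c * y) := by
        have h2 := Real.one_sub_inv_le_log_of_pos (show 0 < 1 + c * y by positivity)
        refine le_trans ?_ h2
        rw [show 1 - (1 + c * y)⁻¹ = c * y / (1 + c * y) by field_simp; ring]
        gcongr
        nlinarith
      have h3 := Real.add_one_le_exp (Real.log (1 + c * y) * α)
      rw [Real.rpow_def_of_pos (by positivity)]
      have : d * y = c * y / (1 + c) * α := by rw [hd]; field_simp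
      nlinarith [mul_le_mul_of_nonneg_right hlog hα.le]
    have h4 : (l (i + 1)) ^ (-α) ≤ (l i * (1 + c * y)) ^ (-α) :=
      Real.rpow_le_rpow_of_nonpos (by positivity) (hgr i hi h1) (by linarith)
    refine h4.trans ?_
    rw [Real.rpow_neg (by positivity), Real.mul_rpow h0.le (by positivity),
      Real.rpow_neg h0.le, ← hy, mul_inv]
    have h5 : ((1 + c * y) ^ α)⁻¹ ≤ (1 + d * y)⁻¹ := by gcongr
    have h6 : (1 + d * y)⁻¹ ≤ 1 - c' * y := by
      rw [inv_le_iff_one_le_mul₀ (by positivity)]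
      have : c' * (1 + d) = d := by rw [hc']; field_simp
      have hc1 : c' * d * y ≤ c' * d := by nlinarith [mul_pos hc'0 hd0]
      nlinarith [mul_nonneg hy0.le (sub_nonneg.2 hc1)]
    calc y⁻¹ * ((1 + c * y) ^ α)⁻¹ ≤ y⁻¹ * (1 - c' * y) := by gcongr; exact h5.trans h6
      _ = y⁻¹ - c' := by field_simp
  have tot : ∀ k ≤ n, c' * k ≤ (l 0) ^ (-α) - (l k) ^ (-α) := by
    intro k hk
    induction k with
    | zero => simp
    | succ k ih =>
      have := step k (by omega)
      have := ih (by omega)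
      push_cast; linarith
  have h7 := tot n le_rfl
  have h8 : 0 < l n ^ (-α) := Real.rpow_pos_of_pos (hpos n le_rfl) _
  have hn0 : (0 : ℝ) < n := by exact_mod_cast hn
  have h9 : c' * n ≤ l 0 ^ (-α) := by linarith
  have h10 := Real.rpow_le_rpow_of_nonpos (by positivity) h9
    (show -1 / α ≤ 0 from div_nonpos_of_nonpos_of_nonneg (by norm_num) hα.le)
  rw [← Real.rpow_mul (hpos 0 (Nat.zero_le _)).le, show -α * (-1 / α) = 1 by field_simp,
    Real.rpow_one, Real.mul_rpow hc'0.le hn0.le] at h10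
  exact h10

namespace LiftSystem
variable {α : ℝ} (S : LiftSystem α)

/-- Intervals that stay short for `n` steps are of length `O(n ^ (-1/α))`. -/
lemma exists_len_le : ∃ C > 0, ∀ (t : ℕ → ℝ) (T n : ℕ) (a b : ℝ), 1 ≤ n → a < b →
    S.len t (T + n) a b ≤ 1 → S.len t T a b ≤ C * (n : ℝ) ^ (-1 / α) := by
  obtain ⟨c, hc, h⟩ := S.exists_growth
  obtain ⟨C, hC, h'⟩ := le_rpow_of_growth S.α_pos hc
  refine ⟨C, hC, fun t T n a b hn hab hl => ?_⟩
  have := h' n (fun i => S.len t (T + i) a b) hn (fun i _ => S.len_pos t hab) ?_ ?_ hl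
  · simpa using this
  · intro i _ h1
    have e := h (S.X t (T + i) a) (S.X t (T + i) b) ((S.X_le t).2 hab.le)
      (by simp only [len] at h1; linarith)
    show _ ≤ S.len t (T + i + 1) a b
    rw [len_succ]; exact e
  · exact fun i _ => S.len_le_succ t (T + i) hab.le

end LiftSystem

/-- An interval at distance `A` of a fixed point that travels from `A ≤ a'` to `A ≥ b'` is
expanded by a power of `b' / a'`. -/
lemma trip_gain {a b : ℝ} (ha : 0 < a) (hb : 0 < b) (G : ℝ) (hG : 0 < G) :
    ∃ R ≥ 1, ∀ β a' b' ε : ℝ, 0 ≤ β → 0 < a' → a' ≤ 1 → R * a' ≤ b' → ε ≤ b * a' * a' ^ β →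
      ∀ (n : ℕ) (A l : ℕ → ℝ), A 0 ≤ a' → b' ≤ A n → 0 ≤ l 0 → (∀ i < n, l i ≤ l (i + 1)) →
        (∀ i < n, A i ≤ a' → A (i + 1) ≤ a' * (1 + b * a' ^ β) + ε) →
        (∀ i < n, a' < A i → A (i + 1) ≤ A i * (1 + b * A i ^ β) + ε) →
        (∀ i < n, a' < A i → l i * (1 + a * A i ^ β) ≤ l (i + 1)) →
        G * l 0 ≤ l n := by
  -- Bernoulli's inequality gives (1 + 2b A ^ β) ^ θ ≤ 1 + a A ^ β: the growth of the distance to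
  -- the power θ is dominated by the growth of the length. The factor 2 in 2b pays for the noise,
  -- since ε ≤ b a' a' ^ β ≤ b A A ^ β once A > a'.
  set θ := min 1 (a / (2 * b)) with hθ
  have hθ0 : 0 < θ := lt_min one_pos (by positivity)
  have hθ1 : θ ≤ 1 := min_le_left _ _
  have hθa : θ * (2 * b) ≤ a := by
    have : θ ≤ a / (2 * b) := min_le_right _ _
    rwa [le_div_iff₀ (by positivity)] at this
  set C := 1 + 2 * b with hC
  have hC1 : 1 ≤ C := by linarith
  refine ⟨max 1 (C * G ^ (1 / θ)), le_max_left _ _, fun β a' b' ε hβ ha' ha1 hR hε n A l hA0 hAn hl0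
    hmono h1 h2 h3 => ?_⟩
  have hCa : 0 < C * a' := by positivity
  have ha'β : a' ^ β ≤ 1 := Real.rpow_le_one ha'.le ha1 hβ
  -- The length stays above a θ-power of the distance in units of C a'. A return to distance at most
  -- a' is harmless: the next distance is at most C a', so that power is at most 1.
  have inv : ∀ i ≤ n, l 0 ≤ l i ∧ (a' < A i → l 0 * (A i / (C * a')) ^ θ ≤ l i) := by
    intro i hi
    induction i with
    | zero => exact ⟨le_rfl, fun h => absurd hA0 (not_le.2 h)⟩
    | succ i ih =>
      obtain ⟨ih1, ih2⟩ := ih (by omega)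
      have hi' : i < n := by omega
      refine ⟨ih1.trans (hmono i hi'), fun hlt => ?_⟩
      by_cases hA : A i ≤ a'
      · have e1 := h1 i hi' hA
        have e2 : A (i + 1) ≤ C * a' := by
          have : b * a' * a' ^ β ≤ b * a' := mul_le_of_le_one_right (by positivity) ha'β
          nlinarith
        have e3 : (A (i + 1) / (C * a')) ^ θ ≤ 1 :=
          Real.rpow_le_one (by have := ha'.trans hlt; positivity) ((div_le_one hCa).2 e2) hθ0.le
        calc l 0 * (A (i + 1) / (C * a')) ^ θ ≤ l 0 * 1 := by gcongr
          _ ≤ l (i + 1) := by rw [mul_one]; exact ih1.trans (hmono i hi')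
      · push Not at hA
        have hAi : 0 < A i := ha'.trans hA
        have e0 : a' ^ β ≤ A i ^ β := Real.rpow_le_rpow ha'.le hA.le hβ
        have e1 := h2 i hi' hA
        have hx : 0 < A i ^ β := Real.rpow_pos_of_pos hAi β
        have e2 : A (i + 1) ≤ A i * (1 + 2 * b * A i ^ β) := by
          have : b * a' * a' ^ β ≤ b * A i * A i ^ β := by gcongr
          nlinarith
        have e3 : (1 + 2 * b * A i ^ β) ^ θ ≤ 1 + a * A i ^ β := by
          have := rpow_one_add_le_one_add_mul_self (s := 2 * b * A i ^ β) (p := θ)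
            (by have : 0 < 2 * b * A i ^ β := by positivity
                linarith) hθ0.le hθ1
          nlinarith
        have hl : 0 ≤ l i := hl0.trans ih1
        calc l 0 * (A (i + 1) / (C * a')) ^ θ
            ≤ l 0 * (A i * (1 + 2 * b * A i ^ β) / (C * a')) ^ θ := by
              have := ha'.trans hlt
              gcongr
          _ = (l 0 * (A i / (C * a')) ^ θ) * (1 + 2 * b * A i ^ β) ^ θ := by
              rw [mul_div_right_comm, Real.mul_rpow (by positivity) (by positivity)]; ring
          _ ≤ l i * (1 + a * A i ^ β) := by
              gcongr
              exact ih2 hA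
          _ ≤ l (i + 1) := h3 i hi' hA
  have hRG : C * G ^ (1 / θ) * a' ≤ b' :=
    (mul_le_mul_of_nonneg_right (le_max_right _ _) ha'.le).trans hR
  have hGle : C * G ^ (1 / θ) * a' ≤ A n := hRG.trans hAn
  have hGp : G ≤ (A n / (C * a')) ^ θ := by
    have : G ^ (1 / θ) ≤ A n / (C * a') := by rw [le_div_iff₀ hCa]; linarith
    calc G = (G ^ (1 / θ)) ^ θ := by
          rw [← Real.rpow_mul hG.le, one_div_mul_cancel hθ0.ne', Real.rpow_one]
      _ ≤ _ := by gcongr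
  obtain ⟨k1, k2⟩ := inv n le_rfl
  by_cases hlt : a' < A n
  · calc G * l 0 ≤ (A n / (C * a')) ^ θ * l 0 := by gcongr
      _ ≤ l n := by rw [mul_comm]; exact k2 hlt
  · have hA : 0 < A n := lt_of_lt_of_le (by positivity) hGle
    have : (A n / (C * a')) ^ θ ≤ 1 := Real.rpow_le_one (by positivity)
      ((div_le_one hCa).2 (by push Not at hlt; nlinarith)) hθ0.le
    calc G * l 0 ≤ 1 * l 0 := by gcongr; exact hGp.trans this
      _ ≤ l n := by rw [one_mul]; exact k1

namespace LiftSystem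
variable {α : ℝ} (S : LiftSystem α)

/-- The least noise level up to which intervals escaping from the `a'`-neighbourhood of a fixed
point behave as without noise. -/
lemma exists_trip_gain (G : ℝ) (hG : 0 < G) : ∃ R ≥ 1, ∀ a' δ : ℝ, 0 < a' → a' ≤ 1 → R * a' ≤ δ →
    2 * δ ≤ S.r → ∃ ε₀ > 0, ∀ t : ℕ → ℝ, (∀ i, |t i| ≤ ε₀) → ∀ (u v : ℝ) (j n : ℕ) (c : ℝ)
      (N : ℕ → ℤ), c ∈ S.Q → (∀ i, S.F (c + N i) = c + N (i + 1)) → u ≤ v →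
      (∀ i < n, S.X t (j + i) u < c + N i + δ → c + N i - δ < S.X t (j + i) v →
        S.len t (j + i) u v ≤ δ) →
      S.X t j u ≤ c + N 0 + a' → c + N 0 - a' ≤ S.X t j v →
      (c + N n + δ ≤ S.X t (j + n) u ∨ S.X t (j + n) v ≤ c + N n - δ) →
      G * S.len t j u v ≤ S.len t (j + n) u v := by
  obtain ⟨R, hR1, hR⟩ := trip_gain S.a_pos S.b_pos G hG
  -- As a' ≤ 1, the noise level with exponent α is admissible for every β ≤ α.
  refine ⟨R, hR1, fun a' δ ha' ha1 hRa hδ => ⟨S.b * a' * a' ^ α, by have := S.b_pos; positivity,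
    fun t ht u v j n c N hc hN huv hlen hu hv hex => ?_⟩⟩
  have hb := S.b_pos
  have ha := S.a_pos
  have hr := S.r_pos
  have haδ : a' ≤ δ := by nlinarith
  have hε : ∀ β, 0 ≤ β → β ≤ α → S.b * a' * a' ^ α ≤ S.b * a' * a' ^ β := fun β _ h1 => by
    have := Real.rpow_le_rpow_of_exponent_ge ha' ha1 h1
    gcongr
  rcases hex with hex | hex
  · -- exit on the right
    obtain ⟨β, hβ0, hβα, hD, hF⟩ := S.right c hc
    have hex' : ∃ i, c + N i + δ ≤ S.X t (j + i) u := ⟨n, hex⟩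
    classical
    -- Up to the first exit time the left end is within δ to the right of the centre when it is
    -- beyond a', so the whole interval is within 2δ ≤ r and the local bounds apply. After it,
    -- lengths do not decrease.
    set n' := Nat.find hex' with hn'
    have hn'n : n' ≤ n := Nat.find_min' hex' hex
    have hn'spec : c + N n' + δ ≤ S.X t (j + n') u := Nat.find_spec hex'
    have hlt : ∀ i < n', S.X t (j + i) u < c + N i + δ := fun i hi => by
      simpa using Nat.find_min hex' hi
    have hF' : ∀ (m : ℤ) z, 0 < z → z < S.r → S.F (c + m + z) ≤ S.F (c + m) + z * (1 + S.b * z ^ β) := by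
      intro m z h0 h1
      have := hF z h0 h1
      rw [show c + m + z = c + z + m by ring, S.map_add_int, S.map_add_int]; linarith
    have key := hR β a' δ _ hβ0 ha' ha1 hRa (hε β hβ0 hβα) n'
      (fun i => S.X t (j + i) u - (c + N i)) (fun i => S.len t (j + i) u v)
      (by simp only [add_zero]; linarith) (by linarith) (S.len_nonneg t huv)
      (fun i _ => S.len_le_succ t (j + i) huv) ?_ ?_ ?_
    · exact key.trans (S.len_le_of_le t (by omega) huv)
    · intro i _ h
      have h1 : S.F (S.X t (j + i) u) ≤ S.F (c + N i + a') := S.strictMono.monotone (by linarith)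
      have h2 := hF' (N i) a' ha' (by linarith)
      rw [hN] at h2
      have h3 := (abs_le.1 (ht (j + i))).2
      show S.F (S.X t (j + i) u) + t (j + i) - (c + N (i + 1)) ≤ _
      linarith
    · intro i hi h
      have h2 := hF' (N i) (S.X t (j + i) u - (c + N i)) (by linarith) (by linarith [hlt i hi])
      rw [hN, add_sub_cancel] at h2
      have h3 := (abs_le.1 (ht (j + i))).2
      show S.F (S.X t (j + i) u) + t (j + i) - (c + N (i + 1)) ≤ _
      linarith
    · intro i hi h
      have hl := hlen i (by omega) (hlt i hi)
        (by have := (S.X_le t (n := j + i)).2 huv; linarith)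
      show _ ≤ S.len t (j + i + 1) u v
      rw [len_succ, mul_comm]
      refine S.le_slope ((S.X_le t).2 huv) fun x hx => ?_
      have hx2 : x < c + N i + 2 * δ := by
        have := hlt i hi
        simp only [len] at hl
        linarith [hx.2]
      have := hD (x - (c + N i)) (by linarith [hx.1]) (by linarith)
      rw [show c + (x - (c + N i)) = x + ((-N i : ℤ) : ℝ) by push_cast; ring, S.D_add_int] at this
      refine le_trans ?_ this
      have := hx.1
      gcongr
      linarith
  · -- exit on the left
    obtain ⟨β, hβ0, hβα, hD, hF⟩ := S.left c hc
    have hex' : ∃ i, S.X t (j + i) v ≤ c + N i - δ := ⟨n, hex⟩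
    classical
    set n' := Nat.find hex' with hn'
    have hn'n : n' ≤ n := Nat.find_min' hex' hex
    have hn'spec : S.X t (j + n') v ≤ c + N n' - δ := Nat.find_spec hex'
    have hlt : ∀ i < n', c + N i - δ < S.X t (j + i) v := fun i hi => by
      simpa using Nat.find_min hex' hi
    have hF' : ∀ (m : ℤ) z, 0 < z → z < S.r → S.F (c + m) ≤ S.F (c + m - z) + z * (1 + S.b * z ^ β) := by
      intro m z h0 h1
      have := hF z h0 h1
      rw [show c + m - z = c - z + m by ring, S.map_add_int, S.map_add_int]; linarith
    have key := hR β a' δ _ hβ0 ha' ha1 hRa (hε β hβ0 hβα) n'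
      (fun i => c + N i - S.X t (j + i) v) (fun i => S.len t (j + i) u v)
      (by simp only [add_zero]; linarith) (by linarith) (S.len_nonneg t huv)
      (fun i _ => S.len_le_succ t (j + i) huv) ?_ ?_ ?_
    · exact key.trans (S.len_le_of_le t (by omega) huv)
    · intro i _ h
      have h1 : S.F (c + N i - a') ≤ S.F (S.X t (j + i) v) := S.strictMono.monotone (by linarith)
      have h2 := hF' (N i) a' ha' (by linarith)
      rw [hN] at h2
      have h3 := (abs_le.1 (ht (j + i))).1
      show c + N (i + 1) - (S.F (S.X t (j + i) v) + t (j + i)) ≤ _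
      linarith
    · intro i hi h
      have h2 := hF' (N i) (c + N i - S.X t (j + i) v) (by linarith) (by linarith [hlt i hi])
      rw [hN, sub_sub_cancel] at h2
      have h3 := (abs_le.1 (ht (j + i))).1
      show c + N (i + 1) - (S.F (S.X t (j + i) v) + t (j + i)) ≤ _
      linarith
    · intro i hi h
      have hl := hlen i (by omega) (by have := (S.X_le t (n := j + i)).2 huv; linarith) (hlt i hi)
      show _ ≤ S.len t (j + i + 1) u v
      rw [len_succ, mul_comm]
      refine S.le_slope ((S.X_le t).2 huv) fun x hx => ?_
      have hx2 : c + N i - 2 * δ < x := by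
        have := hlt i hi
        simp only [len] at hl
        linarith [hx.1]
      have := hD (c + N i - x) (by linarith [hx.2]) (by linarith)
      rw [show c - (c + N i - x) = x + ((-N i : ℤ) : ℝ) by push_cast; ring, S.D_add_int] at this
      refine le_trans ?_ this
      have := hx.2
      gcongr
      linarith

end LiftSystem
-- Points whose orbits avoid the fixed points
namespace LiftSystem
variable {α : ℝ} (S : LiftSystem α)

lemma X_add (t : ℕ → ℝ) (k n : ℕ) (u : ℝ) :
    S.X t (k + n) u = S.X (shift k t) n (S.X t k u) := by
  induction n with
  | zero => rfl
  | succ n ih => rw [← add_assoc, X_succ, ih, X_succ, shift, add_comm k n]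

lemma center_mem {c : ℝ} (hc : c ∈ S.Q) (m : ℤ) : c + m ∈ S.Q := S.Q_add c hc m

/-- Under small noise, points cannot come back to the `δ`-neighbourhood of the same lifted fixed
point. -/
lemma exists_stay {δ : ℝ} (hδ : 0 < δ) (hδ1 : δ ≤ 1) : ∃ ε₀ > 0, ∀ s, |s| ≤ ε₀ → ∀ (c c' : ℝ),
    S.F c = c' → ∀ z, (c + δ ≤ z → c' + δ + 2 * ε₀ ≤ S.F z + s) ∧
      (z ≤ c - δ → S.F z + s ≤ c' - δ - 2 * ε₀) := by
  obtain ⟨c₀, hc₀, h⟩ := S.exists_growth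
  have hp : 0 < c₀ * δ ^ α := by positivity
  -- The image of an interval of length δ ending at c exceeds δ by at least three times this number:
  -- one third absorbs the noise, the other two are the margin 2ε₀.
  refine ⟨δ * (c₀ * δ ^ α) / 3, by positivity, fun s hs c c' hcc z => ⟨fun hz => ?_, fun hz => ?_⟩⟩
  · have h1 := h c (c + δ) (by linarith) (by linarith)
    have h2 := S.strictMono.monotone hz
    rw [add_sub_cancel_left, hcc] at h1
    linarith [(abs_le.1 hs).1]
  · have h1 := h (c - δ) c (by linarith) (by linarith)
    have h2 := S.strictMono.monotone hz
    rw [sub_sub_cancel, hcc] at h1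
    linarith [(abs_le.1 hs).2]

/-- Intervals that stay short for n steps have length O(n ^ (-1/α)), which is eventually below l;
the resulting n depends neither on the noise nor on T. -/
lemma exists_one_lt_len {l : ℝ} (hl : 0 < l) : ∃ n ≥ 1, ∀ (t : ℕ → ℝ) (T : ℕ) (a b : ℝ), a < b →
    l ≤ S.len t T a b → 1 < S.len t (T + n) a b := by
  obtain ⟨C, hC, h⟩ := S.exists_len_le
  have h1 : Tendsto (fun n : ℕ => C * (n : ℝ) ^ (-1 / α)) atTop (𝓝 (C * 0)) := by
    refine Tendsto.const_mul _ ?_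
    have := (tendsto_rpow_neg_atTop (show 0 < 1 / α from one_div_pos.2 S.α_pos)).comp
      tendsto_natCast_atTop_atTop
    rw [neg_div]; exact this
  rw [mul_zero] at h1
  obtain ⟨n, hn1, hn⟩ := ((h1.eventually_lt_const hl).and (eventually_ge_atTop 1)).exists
  refine ⟨n, hn, fun t T a b hab hle => ?_⟩
  by_contra! hcon
  linarith [h t T n a b hn hab hcon]

/-- The intervals adjacent to the `δ`-neighbourhood of the fixed points. -/
def IsSide (δ p q : ℝ) : Prop :=
  ∃ c ∈ S.Q, (p = c + δ ∧ q = c + 3 / 2 * δ) ∨ (p = c - 3 / 2 * δ ∧ q = c - δ)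

/-- Let k be the time of first return of the side interval to the δ-neighbourhood; it exists because
the images become longer than 1 and then contain a fixed point. By `exists_stay` the return is not
to the moving centre c + N k, so it happens at distance about r from it. If the image were still
shorter than 3δ, the passage from distance δ to r / 4 would have stretched the interval sixfold,
from δ / 2 to 3δ, a contradiction. An image of length 3δ that meets the δ-neighbourhood of c'
contains a side interval of c'. -/
lemma exists_side_step : ∃ δ₀ > 0, ∀ δ, 0 < δ → δ < δ₀ → ∃ ε₀ > 0, ∀ t : ℕ → ℝ, (∀ i, |t i| ≤ ε₀) →
    ∀ p q, S.IsSide δ p q → ∃ k ≥ 1, (∀ i < k, ∀ x ∈ Icc p q, ∀ c ∈ S.Q, δ ≤ |S.X t i x - c|) ∧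
      ∃ p' q', p ≤ p' ∧ q' ≤ q ∧ S.IsSide δ (S.X t k p') (S.X t k q') := by
  obtain ⟨R, hR1, hR⟩ := S.exists_trip_gain 6 (by norm_num)
  have hr := S.r_pos
  set E := S.r / 4 with hE
  refine ⟨min 1 (min (E / R) (E / 4)), by positivity, fun δ hδ hδ' => ?_⟩
  obtain ⟨hδ1, hδR, hδE⟩ : δ < 1 ∧ δ < E / R ∧ δ < E / 4 := by
    simpa [lt_min_iff] using hδ'
  obtain ⟨ε₁, hε₁, hstay⟩ := S.exists_stay hδ hδ1.le
  obtain ⟨ε₂, hε₂, htrip⟩ := hR δ E hδ hδ1.le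
    (by rw [lt_div_iff₀ (by linarith)] at hδR; linarith) (by linarith)
  refine ⟨min ε₁ ε₂, by positivity, fun t ht p q hpq => ?_⟩
  have hpq' : q - p = δ / 2 := by
    obtain ⟨c, -, ⟨rfl, rfl⟩ | ⟨rfl, rfl⟩⟩ := hpq <;> ring
  have hlt : p < q := by linarith
  have hex : ∃ k, 1 ≤ k ∧ ∃ x ∈ Icc p q, ∃ c ∈ S.Q, |S.X t k x - c| < δ := by
    obtain ⟨n, hn, h⟩ := S.exists_one_lt_len (l := δ / 2) (by linarith)
    have h1 := h t 0 p q hlt (by simp [hpq'])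
    rw [zero_add] at h1
    obtain ⟨c, hc, hc1, hc2⟩ := S.exists_Q_mem (S.X t n p)
    obtain ⟨x, rfl⟩ := S.X_surjective t n c
    refine ⟨n, hn, x, ⟨(S.X_le t).1 hc1, (S.X_le t (n := n)).1 ?_⟩, _, hc, by simpa using hδ⟩
    simp only [len] at h1; linarith
  classical
  set k := Nat.find hex with hk
  obtain ⟨hk1, x, hx, c', hc', hxc⟩ := Nat.find_spec hex
  have hmin : ∀ i < k, 1 ≤ i → ∀ x ∈ Icc p q, ∀ c ∈ S.Q, δ ≤ |S.X t i x - c| := by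
    intro i hi h1 x hx c hc
    have := Nat.find_min hex hi
    push Not at this
    exact this h1 x hx c hc
  -- the image at time `k` is long
  have hlen : 3 * δ ≤ S.len t k p q := by
    by_contra! hcon
    have hlen' : ∀ i ≤ k, S.len t i p q < 3 * δ := fun i hi =>
      (S.len_le_of_le t hi hlt.le).trans_lt hcon
    obtain ⟨c, hc, hcc⟩ := hpq
    obtain ⟨N, hN0, hN⟩ := S.exists_center hc
    have hside : (∀ i, c + N i + δ ≤ S.X t i p) ∨ (∀ i, S.X t i q ≤ c + N i - δ) := by
      rcases hcc with ⟨hp, hq⟩ | ⟨hp, hq⟩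
      · left; intro i
        induction i with
        | zero => simp [hp, hN0]
        | succ i ih =>
          have := (hstay (t i) ((ht i).trans (min_le_left _ _)) _ _ (hN i) (S.X t i p)).1 ih
          rw [X_succ]; linarith
      · right; intro i
        induction i with
        | zero => simp [hq, hN0]
        | succ i ih =>
          have := (hstay (t i) ((ht i).trans (min_le_left _ _)) _ _ (hN i) (S.X t i q)).2 ih
          rw [X_succ]; linarith
    have hxp := (S.X_le t (n := k)).2 hx.1
    have hxq := (S.X_le t (n := k)).2 hx.2
    have hxc' := abs_lt.1 hxc
    have hlk := hlen' k le_rfl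
    simp only [len] at hlk
    have hne : c' ≠ c + N k := by
      rintro rfl
      rcases hside with h | h
      · linarith [h k]
      · linarith [h k]
    have hsep := S.Q_sep c' hc' _ (S.center_mem hc (N k)) hne
    have hfin := htrip t (fun i => (ht i).trans (min_le_right _ _)) p q 0 k c N hc hN hlt.le
      (fun i hi _ _ => by rw [zero_add]; linarith [hlen' i hi.le])
      (by rcases hcc with ⟨hp, hq⟩ | ⟨hp, hq⟩ <;> simp [hp, hN0]; linarith)
      (by rcases hcc with ⟨hp, hq⟩ | ⟨hp, hq⟩ <;> simp [hq, hN0]; linarith)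
      (by
        rw [zero_add]
        rcases le_abs.1 hsep with h' | h'
        · left; linarith
        · right; linarith)
    rw [zero_add, len_zero, hpq'] at hfin
    linarith
  refine ⟨k, hk1, fun i hi y hy c hc => ?_, ?_⟩
  · rcases Nat.eq_zero_or_pos i with rfl | hi0
    · rw [X_zero]
      obtain ⟨c₁, hc₁, hcc⟩ := hpq
      by_cases hcc' : c = c₁
      · subst hcc'
        rcases hcc with ⟨hp, hq⟩ | ⟨hp, hq⟩
        · rw [le_abs]; left; linarith [hy.1]
        · rw [le_abs]; right; linarith [hy.2]
      · have hsep := S.Q_sep c hc c₁ hc₁ hcc'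
        rcases le_abs.1 hsep with h' | h' <;> rw [le_abs] <;>
          rcases hcc with ⟨hp, hq⟩ | ⟨hp, hq⟩
        · right; linarith [hy.2]
        · right; linarith [hy.2]
        · left; linarith [hy.1]
        · left; linarith [hy.1]
    · exact hmin i hi hi0 y hy c hc
  · have hxp := (S.X_le t (n := k)).2 hx.1
    have hxq := (S.X_le t (n := k)).2 hx.2
    have hxc' := abs_lt.1 hxc
    simp only [len] at hlen
    by_cases hc2 : c' + 3 / 2 * δ ≤ S.X t k q
    · obtain ⟨p', hp'⟩ := S.X_surjective t k (c' + δ)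
      obtain ⟨q', hq'⟩ := S.X_surjective t k (c' + 3 / 2 * δ)
      exact ⟨p', q', (S.X_le t (n := k)).1 (by rw [hp']; linarith),
        (S.X_le t (n := k)).1 (by rw [hq']; exact hc2), c', hc', Or.inl ⟨hp', hq'⟩⟩
    · obtain ⟨p', hp'⟩ := S.X_surjective t k (c' - 3 / 2 * δ)
      obtain ⟨q', hq'⟩ := S.X_surjective t k (c' - δ)
      exact ⟨p', q', (S.X_le t (n := k)).1 (by rw [hp']; linarith),
        (S.X_le t (n := k)).1 (by rw [hq']; linarith), c', hc', Or.inr ⟨hp', hq'⟩⟩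

/-- Next to the `δ`-neighbourhood of every fixed point, on both sides, there are points whose
random orbit never enters the `δ`-neighbourhood of the fixed points. -/
lemma exists_avoiding : ∃ δ₀ > 0, ∀ δ, 0 < δ → δ < δ₀ → ∃ ε₀ > 0, ∀ t : ℕ → ℝ, (∀ i, |t i| ≤ ε₀) →
    ∀ p q, S.IsSide δ p q → ∃ u ∈ Icc p q, ∀ n, ∀ c ∈ S.Q, δ ≤ |S.X t n u - c| := by
  obtain ⟨δ₀, hδ₀, h⟩ := S.exists_side_step
  refine ⟨δ₀, hδ₀, fun δ hδ hδ' => ?_⟩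
  obtain ⟨ε₀, hε₀, hstep⟩ := h δ hδ hδ'
  refine ⟨ε₀, hε₀, fun t ht p q hpq => ?_⟩
  -- For a finite horizon one pulls back avoiding points from the side interval reached at time k;
  -- since k ≥ 1 the horizon shrinks. Compactness of [p, q] passes to the infinite horizon.
  have fin : ∀ n, ∀ t : ℕ → ℝ, (∀ i, |t i| ≤ ε₀) → ∀ p q, S.IsSide δ p q →
      ∃ u ∈ Icc p q, ∀ i ≤ n, ∀ c ∈ S.Q, δ ≤ |S.X t i u - c| := by
    intro n
    induction n using Nat.strong_induction_on with
    | _ n ih =>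
      intro t ht p q hpq
      obtain ⟨k, hk, hbef, p', q', hp', hq', hs⟩ := hstep t ht p q hpq
      by_cases hkn : k ≤ n
      · obtain ⟨y, hy, hy'⟩ := ih (n - k) (by omega) (shift k t) (fun i => ht _) _ _ hs
        obtain ⟨u, rfl⟩ := S.X_surjective t k y
        have hu1 := hp'.trans ((S.X_le t).1 hy.1)
        have hu2 := ((S.X_le t).1 hy.2).trans hq'
        refine ⟨u, ⟨hu1, hu2⟩, fun i hi c hc => ?_⟩
        by_cases hik : i < k
        · exact hbef i hik u ⟨hu1, hu2⟩ c hc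
        · have := hy' (i - k) (by omega) c hc
          rwa [← X_add, show k + (i - k) = i by omega] at this
      · refine ⟨p, ⟨le_rfl, ?_⟩, fun i hi => hbef i (by omega) p ⟨le_rfl, ?_⟩⟩ <;>
        · obtain ⟨c, -, ⟨rfl, rfl⟩ | ⟨rfl, rfl⟩⟩ := hpq <;> linarith
  have hne := IsCompact.nonempty_iInter_of_sequence_nonempty_isCompact_isClosed
    (fun n => Icc p q ∩ {u | ∀ i ≤ n, ∀ c ∈ S.Q, δ ≤ |S.X t i u - c|})
    (fun n => inter_subset_inter_right _ fun u hu i hi => hu i (by omega))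
    (fun n => by obtain ⟨u, hu, hu'⟩ := fin n t ht p q hpq; exact ⟨u, hu, hu'⟩)
    (isCompact_Icc.inter_right ?_) (fun n => isClosed_Icc.inter ?_)
  · obtain ⟨u, hu⟩ := hne
    simp only [mem_iInter] at hu
    exact ⟨u, (hu 0).1, fun n => (hu n).2 n le_rfl⟩
  all_goals
    simp only [ofPred_forall]
    refine isClosed_iInter fun i => isClosed_iInter fun _ => isClosed_iInter fun c =>
      isClosed_iInter fun _ => ?_
    exact isClosed_le continuous_const (((S.X_continuous t i).sub continuous_const).abs)

end LiftSystem
namespace LiftSystem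
variable {α : ℝ} (S : LiftSystem α)

/-! ### Distortion -/

/-- All slopes in the interval are within K of D u. As slopes are at least 1, the additive error K
is also a relative one, and 1 + 2K is absorbed by the exponential. -/
lemma ratio_step {u v u' v' : ℝ} (hu : u ≤ u') (huv' : u' ≤ v') (hv : v' ≤ v) (hg : v - u ≤ S.g)
    (hB : ∀ q ∈ S.B, q ∉ Ioo u v) :
    (S.F v' - S.F u') * (v - u) ≤
        Real.exp (2 * S.H * (v - u) ^ α) * ((S.F v - S.F u) * (v' - u')) ∧
      (S.F v - S.F u) * (v' - u') ≤
        Real.exp (2 * S.H * (v - u) ^ α) * ((S.F v' - S.F u') * (v - u)) := by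
  have huv : u ≤ v := by linarith
  set K := S.H * (v - u) ^ α with hK
  have hK0 : 0 ≤ K := mul_nonneg S.H_pos.le (Real.rpow_nonneg (by linarith) _)
  have hD : ∀ x ∈ Ico u v, |S.D u - S.D x| ≤ K := fun x hx =>
    (S.holder u x hx.1 (by linarith [hx.2]) fun y hy hyB => hB y hyB ⟨hy.1, hy.2.trans_lt hx.2⟩).trans
      (mul_le_mul_of_nonneg_left (Real.rpow_le_rpow (by linarith [hx.1]) (by linarith [hx.2])
        S.α_pos.le) S.H_pos.le)
  have e1 := S.slope_le (m := S.D u + K) huv fun x hx => by linarith [(abs_le.1 (hD x hx)).1]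
  have e2 := S.le_slope (m := S.D u - K) huv fun x hx => by linarith [(abs_le.1 (hD x hx)).2]
  have e3 := S.slope_le (m := S.D u + K) huv' fun x hx => by
    linarith [(abs_le.1 (hD x ⟨hu.trans hx.1, hx.2.trans_le hv⟩)).1]
  have e4 := S.le_slope (m := S.D u - K) huv' fun x hx => by
    linarith [(abs_le.1 (hD x ⟨hu.trans hx.1, hx.2.trans_le hv⟩)).2]
  have e5 := S.sub_le_sub_F huv
  have e6 := S.sub_le_sub_F huv'
  have h1 : 0 ≤ v - u := by linarith
  have h2 : 0 ≤ v' - u' := by linarith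
  have hexp : 1 + 2 * K ≤ Real.exp (2 * S.H * (v - u) ^ α) := by
    rw [mul_assoc, ← hK]; linarith [Real.add_one_le_exp (2 * K)]
  constructor
  · calc (S.F v' - S.F u') * (v - u) ≤ ((S.D u + K) * (v' - u')) * (v - u) := by gcongr
      _ = ((S.D u - K) * (v - u) + 2 * K * (v - u)) * (v' - u') := by ring
      _ ≤ ((S.F v - S.F u) + 2 * K * (S.F v - S.F u)) * (v' - u') := by gcongr
      _ = (1 + 2 * K) * ((S.F v - S.F u) * (v' - u')) := by ring
      _ ≤ _ := by
        gcongr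
        exact mul_nonneg (by linarith) h2
  · calc (S.F v - S.F u) * (v' - u') ≤ ((S.D u + K) * (v - u)) * (v' - u') := by gcongr
      _ = ((S.D u - K) * (v' - u') + 2 * K * (v' - u')) * (v - u) := by ring
      _ ≤ ((S.F v' - S.F u') + 2 * K * (S.F v' - S.F u')) * (v - u) := by gcongr
      _ = (1 + 2 * K) * ((S.F v' - S.F u') * (v - u)) := by ring
      _ ≤ _ := by
        gcongr
        exact mul_nonneg (by linarith) h1

variable (t : ℕ → ℝ)

lemma ratio {i T : ℕ} (hiT : i ≤ T) {a b a' b' : ℝ} (ha : a ≤ a') (hab : a' ≤ b') (hb : b' ≤ b)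
    (hg : ∀ j ∈ Finset.Ico i T, S.len t j a b ≤ S.g)
    (hB : ∀ j ∈ Finset.Ico i T, ∀ q ∈ S.B, q ∉ Ioo (S.X t j a) (S.X t j b)) :
    S.len t T a' b' * S.len t i a b ≤
        Real.exp (2 * S.H * ∑ j ∈ Finset.Ico i T, S.len t j a b ^ α) *
          (S.len t T a b * S.len t i a' b') ∧
      S.len t T a b * S.len t i a' b' ≤
        Real.exp (2 * S.H * ∑ j ∈ Finset.Ico i T, S.len t j a b ^ α) *
          (S.len t T a' b' * S.len t i a b) := by
  rcases (ha.trans (hab.trans hb)).eq_or_lt with hab0 | hab0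
  · have h1 : a' = a := le_antisymm (by linarith) ha
    have h2 : b' = a := le_antisymm (by linarith) (by linarith)
    subst hab0; subst h1; subst h2
    simp [len]
  induction T, hiT using Nat.le_induction with
  | base => simp [mul_comm]
  | succ T hT ih =>
    obtain ⟨ih1, ih2⟩ := ih (fun j hj => hg j (Finset.Ico_subset_Ico_right (by omega) hj))
      (fun j hj => hB j (Finset.Ico_subset_Ico_right (by omega) hj))
    have hTm : T ∈ Finset.Ico i (T + 1) := by simp; omega
    obtain ⟨s1, s2⟩ := S.ratio_step ((S.X_le t (n := T)).2 ha) ((S.X_le t).2 hab)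
      ((S.X_le t).2 hb) (hg T hTm) (hB T hTm)
    simp only [← len_succ] at s1 s2
    change _ * S.len t T a b ≤ Real.exp (2 * S.H * S.len t T a b ^ α) * (_ * S.len t T a' b') at s1
    change _ * S.len t T a' b' ≤ Real.exp (2 * S.H * S.len t T a b ^ α) * (_ * S.len t T a b) at s2
    rw [Finset.sum_Ico_succ_top (by omega), mul_add, Real.exp_add]
    have p0 := S.len_pos t (j := T) hab0
    have q1 := S.len_nonneg t (j := T + 1) hab
    have q2 := S.len_nonneg t (j := T + 1) hab0.le
    have q3 := S.len_nonneg t (j := i) hab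
    have q4 := S.len_nonneg t (j := i) hab0.le
    have q5 := S.len_nonneg t (j := T) hab
    set e1 := Real.exp (2 * S.H * ∑ j ∈ Finset.Ico i T, S.len t j a b ^ α)
    set e2 := Real.exp (2 * S.H * S.len t T a b ^ α)
    have he1 : 0 < e1 := Real.exp_pos _
    have he2 : 0 < e2 := Real.exp_pos _
    constructor
    · refine le_of_mul_le_mul_right ?_ p0
      calc S.len t (T + 1) a' b' * S.len t i a b * S.len t T a b
          = (S.len t (T + 1) a' b' * S.len t T a b) * S.len t i a b := by ring
        _ ≤ (e2 * (S.len t (T + 1) a b * S.len t T a' b')) * S.len t i a b := by gcongr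
        _ = e2 * S.len t (T + 1) a b * (S.len t T a' b' * S.len t i a b) := by ring
        _ ≤ e2 * S.len t (T + 1) a b * (e1 * (S.len t T a b * S.len t i a' b')) := by gcongr
        _ = _ := by ring
    · rcases hab.eq_or_lt with rfl | hab1
      · simp [len]
      have p1 := S.len_pos t (j := T) hab1
      refine le_of_mul_le_mul_right ?_ p1
      calc S.len t (T + 1) a b * S.len t i a' b' * S.len t T a' b'
          = (S.len t (T + 1) a b * S.len t T a' b') * S.len t i a' b' := by ring
        _ ≤ (e2 * (S.len t (T + 1) a' b' * S.len t T a b)) * S.len t i a' b' := by gcongr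
        _ = e2 * S.len t (T + 1) a' b' * (S.len t T a b * S.len t i a' b') := by ring
        _ ≤ e2 * S.len t (T + 1) a' b' * (e1 * (S.len t T a' b' * S.len t i a b)) := by gcongr
        _ = _ := by ring

/-- The bound on the distortion sum of the intervals in use. -/
noncomputable def κ₀ : ℝ := min (Real.log 2 / (2 * S.H)) (S.g ^ α)

lemma κ₀_pos : 0 < S.κ₀ := by
  have := S.H_pos
  have := S.g_pos
  exact lt_min (div_pos (Real.log_pos (by norm_num)) (by positivity)) (by positivity)

lemma exp_κ₀_le : Real.exp (2 * S.H * S.κ₀) ≤ 2 := by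
  have hH := S.H_pos
  have h : S.κ₀ ≤ Real.log 2 / (2 * S.H) := min_le_left _ _
  rw [le_div_iff₀ (by positivity)] at h
  calc _ ≤ Real.exp (Real.log 2) := Real.exp_le_exp.2 (by linarith)
    _ = 2 := Real.exp_log (by norm_num)

lemma le_g_of_rpow_le {x : ℝ} (hx : 0 ≤ x) (h : x ^ α ≤ S.κ₀) : x ≤ S.g :=
  (Real.rpow_le_rpow_iff hx S.g_pos.le S.α_pos).1 (h.trans (min_le_right _ _))

lemma len_le_g {I : Finset ℕ} {a b : ℝ} (hab : a ≤ b) (h : ∑ j ∈ I, S.len t j a b ^ α ≤ S.κ₀)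
    {j : ℕ} (hj : j ∈ I) : S.len t j a b ≤ S.g :=
  S.le_g_of_rpow_le (S.len_nonneg t hab) ((Finset.single_le_sum
    (f := fun j => S.len t j a b ^ α) (fun _ _ => Real.rpow_nonneg (S.len_nonneg t hab) _) hj).trans h)

/-- Intervals on which the first `T` iterates are smooth with small distortion. -/
structure Pair (a b : ℝ) (T : ℕ) : Prop where
  lt : a < b
  len_le : S.len t T a b ≤ 1
  sum_le : ∑ j ∈ Finset.range T, S.len t j a b ^ α ≤ S.κ₀
  regular : ∀ j < T, ∀ q ∈ S.B, q ∉ Ioo (S.X t j a) (S.X t j b)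

variable {t}

lemma Pair.ratio {a b : ℝ} {T : ℕ} (h : S.Pair t a b T) {j : ℕ} (hj : j ≤ T) {a' b' : ℝ}
    (ha : a ≤ a') (hab : a' ≤ b') (hb : b' ≤ b) :
    S.len t j a' b' * S.len t T a b ≤ 2 * (S.len t T a' b' * S.len t j a b) := by
  have hsub : Finset.Ico j T ⊆ Finset.range T := fun i hi => by
    simp only [Finset.mem_Ico] at hi; simp [hi.2]
  have key := (S.ratio t hj ha hab hb (fun i hi => S.len_le_g t h.lt.le h.sum_le (hsub hi))
    (fun i hi => h.regular i (by simpa using hsub hi))).2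
  have hs : ∑ i ∈ Finset.Ico j T, S.len t i a b ^ α ≤ S.κ₀ :=
    (Finset.sum_le_sum_of_subset_of_nonneg hsub
      fun _ _ _ => Real.rpow_nonneg (S.len_nonneg t h.lt.le) _).trans h.sum_le
  have hexp : Real.exp (2 * S.H * ∑ i ∈ Finset.Ico j T, S.len t i a b ^ α) ≤ 2 :=
    (Real.exp_le_exp.2 (mul_le_mul_of_nonneg_left hs (by linarith [S.H_pos]))).trans S.exp_κ₀_le
  rw [mul_comm]
  refine key.trans (mul_le_mul_of_nonneg_right hexp ?_)
  exact mul_nonneg (S.len_nonneg t hab) (S.len_nonneg t h.lt.le)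

lemma Pair.sub_le {a b : ℝ} {T : ℕ} (h : S.Pair t a b T) {a' b' : ℝ}
    (ha : a ≤ a') (hab : a' ≤ b') (hb : b' ≤ b) :
    b' - a' ≤ 2 * (b - a) / S.len t T a b * S.len t T a' b' := by
  have := h.ratio S (Nat.zero_le _) ha hab hb
  have hp := S.len_pos t (j := T) h.lt
  simp only [len_zero] at this
  rw [div_mul_eq_mul_div, le_div_iff₀ hp]
  linarith

/-- The distortion sum of a part of an interval. -/
lemma Pair.sum_sub_le {a b : ℝ} {T : ℕ} (h : S.Pair t a b T) {a' b' : ℝ}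
    (ha : a ≤ a') (hab : a' ≤ b') (hb : b' ≤ b) :
    ∑ j ∈ Finset.range T, S.len t j a' b' ^ α ≤
      (2 * S.len t T a' b' / S.len t T a b) ^ α * S.κ₀ := by
  have hp := S.len_pos t (j := T) h.lt
  calc ∑ j ∈ Finset.range T, S.len t j a' b' ^ α
      ≤ ∑ j ∈ Finset.range T, (2 * S.len t T a' b' / S.len t T a b) ^ α * S.len t j a b ^ α := by
        refine Finset.sum_le_sum fun j hj => ?_
        have hq := S.len_nonneg t (j := T) hab
        have hq' := S.len_nonneg t (j := j) h.lt.le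
        rw [← Real.mul_rpow (by positivity) hq']
        refine Real.rpow_le_rpow (S.len_nonneg t hab) ?_ S.α_pos.le
        rw [div_mul_eq_mul_div, le_div_iff₀ hp]
        have := h.ratio S (Finset.mem_range.1 hj).le ha hab hb
        linarith
    _ = (2 * S.len t T a' b' / S.len t T a b) ^ α * ∑ j ∈ Finset.range T, S.len t j a b ^ α := by
        rw [Finset.mul_sum]
    _ ≤ _ := by
        refine mul_le_mul_of_nonneg_left h.sum_le (Real.rpow_nonneg ?_ _)
        have hq := S.len_nonneg t (j := T) hab
        positivity

/-! ### Comparison with the neighbour on the right -/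

/-- The derivative on the left interval is at least θ times that on the right one, minus K: breaks
in between only lower the derivative towards the right. The mean slope σ on the left is at least 1,
whence σ + K ≤ e ^ K σ. -/
lemma compare_step {y₁ y₂ w₁ w₂ : ℝ} (hy : y₁ < y₂) (hyw : y₂ ≤ w₁) (hw : w₁ ≤ w₂)
    (hg : w₂ - y₁ ≤ S.g) (θ : ℝ) (hθ : θ = 1 ∨ θ = S.χ ∧ ∃ q ∈ S.B, q ∈ Icc y₂ w₁) :
    θ * (S.F w₂ - S.F w₁) * (y₂ - y₁) ≤
      Real.exp (S.H * (w₂ - y₁) ^ α) * ((S.F y₂ - S.F y₁) * (w₂ - w₁)) := by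
  set K := S.H * (w₂ - y₁) ^ α with hK
  have hK0 : 0 ≤ K := mul_nonneg S.H_pos.le (Real.rpow_nonneg (by linarith) _)
  have hθ0 : 0 < θ := by
    rcases hθ with rfl | ⟨rfl, -⟩
    · exact one_pos
    · linarith [S.one_lt_χ]
  have hpow : ∀ x ∈ Ico y₁ y₂, ∀ x' ∈ Ico w₁ w₂, S.H * (x' - x) ^ α ≤ K := fun x hx x' hx' =>
    mul_le_mul_of_nonneg_left (Real.rpow_le_rpow (by linarith [hx.2, hx'.1])
      (by linarith [hx.1, hx'.2]) S.α_pos.le) S.H_pos.le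
  have hD : ∀ x ∈ Ico y₁ y₂, ∀ x' ∈ Ico w₁ w₂, θ * S.D x' - K ≤ S.D x := by
    intro x hx x' hx'
    have := hpow x hx x' hx'
    rcases hθ with rfl | ⟨rfl, q, hq, hq'⟩
    · have := S.upper x x' (by linarith [hx.2, hx'.1]) (by linarith [hx.1, hx'.2])
      linarith
    · have := S.jump x x' q hq (by linarith [hx.2, hq'.1]) (by linarith [hx'.1, hq'.2])
        (by linarith [hx.1, hx'.2])
      linarith
  have hyp : 0 < y₂ - y₁ := by linarith
  set σ := (S.F y₂ - S.F y₁) / (y₂ - y₁) with hσ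
  have hσ' : S.F y₂ - S.F y₁ = σ * (y₂ - y₁) := by rw [hσ]; field_simp
  have hσ1 : 1 ≤ σ := by rw [hσ, one_le_div hyp]; exact S.sub_le_sub_F hy.le
  have e1 := S.slope_le (m := (σ + K) / θ) hw fun x' hx' => by
    have := S.le_slope (m := θ * S.D x' - K) hy.le fun x hx => hD x hx x' hx'
    rw [hσ'] at this
    have := le_of_mul_le_mul_right this hyp
    rw [le_div_iff₀ hθ0]; linarith
  have hw0 : 0 ≤ w₂ - w₁ := by linarith
  calc θ * (S.F w₂ - S.F w₁) * (y₂ - y₁)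
      ≤ θ * ((σ + K) / θ * (w₂ - w₁)) * (y₂ - y₁) := by gcongr
    _ = (σ + K) * ((w₂ - w₁) * (y₂ - y₁)) := by field_simp
    _ ≤ (Real.exp K * σ) * ((w₂ - w₁) * (y₂ - y₁)) := by
        refine mul_le_mul_of_nonneg_right ?_ (mul_nonneg hw0 hyp.le)
        nlinarith [Real.add_one_le_exp K]
    _ = _ := by rw [hσ']; ring

variable (t)

open Classical in
/-- The number of times in `[T, E)` at which a break lies between the images of `y` and `w`. -/
noncomputable def cuts (T E : ℕ) (y w : ℝ) : ℕ :=
  ((Finset.Ico T E).filter fun j => ∃ q ∈ S.B, q ∈ Icc (S.X t j y) (S.X t j w)).card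

/-- Between the times T and E, an interval is stretched at least as much as one to its right, up to
distortion, and every time a break separates their images this gains a factor χ. Breaks inside the
two intervals do no harm, so this is available even where `ratio` is not. -/
lemma compare {T E : ℕ} (hTE : T ≤ E) {y₁ y₂ w₁ w₂ : ℝ} (hy : y₁ < y₂) (hyw : y₂ ≤ w₁)
    (hw : w₁ ≤ w₂) (hg : ∀ j ∈ Finset.Ico T E, S.len t j y₁ w₂ ≤ S.g) :
    S.χ ^ S.cuts t T E y₂ w₁ * S.len t E w₁ w₂ * S.len t T y₁ y₂ ≤
      Real.exp (S.H * ∑ j ∈ Finset.Ico T E, S.len t j y₁ w₂ ^ α) *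
        (S.len t E y₁ y₂ * S.len t T w₁ w₂) := by
  classical
  induction E, hTE using Nat.le_induction with
  | base => simp [cuts, mul_comm]
  | succ E hE ih =>
    have ih := ih (fun j hj => hg j (Finset.Ico_subset_Ico_right (by omega) hj))
    have hEm : E ∈ Finset.Ico T (E + 1) := by simp; omega
    obtain ⟨θ, hθ, hc⟩ : ∃ θ, (θ = 1 ∨ θ = S.χ ∧ ∃ q ∈ S.B, q ∈ Icc (S.X t E y₂) (S.X t E w₁)) ∧
        S.χ ^ S.cuts t T (E + 1) y₂ w₁ = θ * S.χ ^ S.cuts t T E y₂ w₁ := by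
      by_cases hq : ∃ q ∈ S.B, q ∈ Icc (S.X t E y₂) (S.X t E w₁)
      · refine ⟨S.χ, Or.inr ⟨rfl, hq⟩, ?_⟩
        rw [cuts, ← Finset.insert_Ico_right_eq_Ico_add_one hE, Finset.filter_insert, if_pos hq,
          Finset.card_insert_of_notMem (by simp), pow_succ, mul_comm]; rfl
      · refine ⟨1, Or.inl rfl, ?_⟩
        rw [cuts, ← Finset.insert_Ico_right_eq_Ico_add_one hE, Finset.filter_insert, if_neg hq, one_mul]
        rfl
    have st := S.compare_step ((S.X_lt t (n := E)).2 hy) ((S.X_le t).2 hyw)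
      ((S.X_le t).2 hw) (hg E hEm) θ hθ
    simp only [← len_succ] at st
    change θ * _ * S.len t E y₁ y₂ ≤ Real.exp (S.H * S.len t E y₁ w₂ ^ α) *
      (_ * S.len t E w₁ w₂) at st
    rw [Finset.sum_Ico_succ_top (by omega), mul_add, Real.exp_add, hc]
    have hχ : 0 < S.χ := by linarith [S.one_lt_χ]
    have p1 := S.len_pos t (j := E) hy
    have p2 := S.len_nonneg t (j := E + 1) hy.le
    have p3 := S.len_nonneg t (j := T) hy.le
    set e1 := Real.exp (S.H * ∑ j ∈ Finset.Ico T E, S.len t j y₁ w₂ ^ α)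
    set e2 := Real.exp (S.H * S.len t E y₁ w₂ ^ α)
    have he2 : 0 < e2 := Real.exp_pos _
    refine le_of_mul_le_mul_right ?_ p1
    calc θ * S.χ ^ S.cuts t T E y₂ w₁ * S.len t (E + 1) w₁ w₂ * S.len t T y₁ y₂ * S.len t E y₁ y₂
        = (θ * S.len t (E + 1) w₁ w₂ * S.len t E y₁ y₂) *
            (S.χ ^ S.cuts t T E y₂ w₁ * S.len t T y₁ y₂) := by ring
      _ ≤ (e2 * (S.len t (E + 1) y₁ y₂ * S.len t E w₁ w₂)) *
            (S.χ ^ S.cuts t T E y₂ w₁ * S.len t T y₁ y₂) := by gcongr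
      _ = e2 * S.len t (E + 1) y₁ y₂ *
            (S.χ ^ S.cuts t T E y₂ w₁ * S.len t E w₁ w₂ * S.len t T y₁ y₂) := by ring
      _ ≤ e2 * S.len t (E + 1) y₁ y₂ * (e1 * (S.len t E y₁ y₂ * S.len t T w₁ w₂)) := by gcongr
      _ = _ := by ring

/-- The hypotheses on a set function `μ` under which the contributions of the pieces of an interval
`[a, b]` at time `E` are summed up: `μ` is controlled on the pieces on which the iterates between
the times `T` and `E` are smooth. -/
structure Piecewise (μ : ℝ → ℝ → ℝ) (M γ β κ h : ℝ) (T E : ℕ) (a b : ℝ) : Prop where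
  subadd : ∀ x y z, x ≤ y → y ≤ z → μ x z ≤ μ x y + μ y z
  smooth : ∀ x y, a ≤ x → x < y → y ≤ b → S.len t E x y ≤ h →
    (∀ j ∈ Finset.Ico T E, ∀ q ∈ S.B, q ∉ Ioo (S.X t j x) (S.X t j y)) →
    μ x y ≤ M * ((y - x) * (1 + γ * S.len t E x y ^ (-β)))
  scale : ∀ x y, a ≤ x → x ≤ y → y ≤ b → y - x ≤ κ * S.len t T x y

variable {t} in
lemma Piecewise.mono {μ : ℝ → ℝ → ℝ} {M γ β κ h : ℝ} {T E : ℕ} {a b a' b' : ℝ}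
    (H : S.Piecewise t μ M γ β κ h T E a b) (ha : a ≤ a') (hb : b' ≤ b) :
    S.Piecewise t μ M γ β κ h T E a' b' :=
  ⟨H.subadd, fun x y hx hxy hy => H.smooth x y (ha.trans hx) hxy (hy.trans hb),
    fun x y hx hxy hy => H.scale x y (ha.trans hx) hxy (hy.trans hb)⟩

/-- The preimages of breaks cut [a, b] into pieces that may be very short at time E. Comparison with
the neighbour [b, b'], of length h at time E, shows that a piece of length l there with m cuts
between it and b has length at most 2 χ^(-m) l L / h at time T. Since l · l^(-β) ≤ h · h^(-β), the
weighted pieces are summed by the geometric series in χ⁻¹. -/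
lemma window {μ : ℝ → ℝ → ℝ} {M γ β κ h : ℝ} (hM : 0 ≤ M) (hγ : 0 ≤ γ) (hβ : β < 1)
    (hκ : 0 ≤ κ) (hh : 0 < h) {T E : ℕ} (hTE : T ≤ E) {a b b' : ℝ} (hab : a < b) (hbb : b ≤ b')
    (hW : S.len t E a b ≤ h) (hN : S.len t E b b' = h)
    (hsum : ∑ j ∈ Finset.Ico T E, S.len t j a b' ^ α ≤ S.κ₀)
    (H : S.Piecewise t μ M γ β κ h T E a b) :
    μ a b ≤ M * ((b - a) + γ * κ * (2 / (1 - S.χ⁻¹)) * h ^ (-β) * S.len t T b b') := by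
  classical
  have hχ := S.one_lt_χ
  have hχ0 : 0 < S.χ := by linarith
  have hχi : S.χ⁻¹ < 1 := inv_lt_one_of_one_lt₀ hχ
  have hχi0 : 0 < S.χ⁻¹ := inv_pos.2 hχ0
  have hg : ∀ j ∈ Finset.Ico T E, S.len t j a b' ≤ S.g := fun j hj =>
    S.len_le_g t (hab.le.trans hbb) hsum hj
  set K := 1 / (1 - S.χ⁻¹) with hK
  have hK1 : 1 + S.χ⁻¹ * K = K := by
    have : K * (1 - S.χ⁻¹) = 1 := one_div_mul_cancel (by linarith)
    linarith
  have hK0 : 0 < K := by rw [hK]; exact one_div_pos.2 (by linarith)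
  set L := S.len t T b b' with hL
  have hL0 : 0 ≤ L := S.len_nonneg t hbb
  have hhβ : 0 < h ^ (-β) := Real.rpow_pos_of_pos hh _
  -- a piece without breaks
  have piece : ∀ x y, a ≤ x → x < y → y ≤ b →
      (∀ j ∈ Finset.Ico T E, ∀ q ∈ S.B, q ∉ Ioo (S.X t j x) (S.X t j y)) →
      μ x y ≤ M * ((y - x) + γ * κ * 2 * h ^ (-β) * L * (S.χ⁻¹) ^ S.cuts t T E y b) := by
    intro x y hx hxy hy hreg
    have hle : S.len t E x y ≤ h := (S.len_mono t hx hy).trans hW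
    refine (H.smooth x y hx hxy hy hle hreg).trans (mul_le_mul_of_nonneg_left ?_ hM)
    rw [mul_add, mul_one]
    refine add_le_add_right ?_ _
    have hcomp := S.compare t hTE hxy hy hbb fun j hj =>
      (S.len_mono t hx le_rfl).trans (hg j hj)
    have hexp : Real.exp (S.H * ∑ j ∈ Finset.Ico T E, S.len t j x b' ^ α) ≤ 2 := by
      refine le_trans (Real.exp_le_exp.2 ?_) S.exp_κ₀_le
      have : ∑ j ∈ Finset.Ico T E, S.len t j x b' ^ α ≤ S.κ₀ :=
        (Finset.sum_le_sum fun j _ => Real.rpow_le_rpow (S.len_nonneg t (by linarith))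
          (S.len_mono t hx le_rfl) S.α_pos.le).trans hsum
      have h2 := S.κ₀_pos
      nlinarith [S.H_pos]
    have hl := S.len_pos t (j := E) hxy
    set l := S.len t E x y with hldef
    set m := S.cuts t T E y b
    have hw : S.len t T x y ≤ 2 * (S.χ⁻¹) ^ m * l * L / h := by
      rw [le_div_iff₀ hh]
      have h1 : S.χ ^ m * h * S.len t T x y ≤ 2 * (l * L) := by
        rw [hN] at hcomp
        exact hcomp.trans (mul_le_mul_of_nonneg_right hexp (mul_nonneg hl.le hL0))
      calc S.len t T x y * h = (S.χ⁻¹) ^ m * (S.χ ^ m * h * S.len t T x y) := by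
            rw [inv_pow]; field_simp
        _ ≤ (S.χ⁻¹) ^ m * (2 * (l * L)) := by gcongr
        _ = _ := by ring
    have hpow : l * l ^ (-β) ≤ h * h ^ (-β) := by
      have e : ∀ x : ℝ, 0 < x → x * x ^ (-β) = x ^ (1 - β) := fun x hx => by
        rw [sub_eq_add_neg, Real.rpow_add hx, Real.rpow_one]
      rw [e l hl, e h hh]
      exact Real.rpow_le_rpow hl.le hle (by linarith)
    calc (y - x) * (γ * l ^ (-β)) ≤ (κ * (2 * (S.χ⁻¹) ^ m * l * L / h)) * (γ * l ^ (-β)) := by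
          have h3 := (H.scale x y hx hxy.le hy).trans (mul_le_mul_of_nonneg_left hw hκ)
          gcongr
      _ = γ * κ * 2 * (l * l ^ (-β)) * L * (S.χ⁻¹) ^ m / h := by ring
      _ ≤ γ * κ * 2 * (h * h ^ (-β)) * L * (S.χ⁻¹) ^ m / h := by gcongr
      _ = _ := by field_simp
  -- the points that are mapped to breaks
  set C : ℝ → Set ℝ := fun c' => {c | c ∈ Ioo a c' ∧ ∃ j ∈ Finset.Ico T E, S.X t j c ∈ S.B} with hC
  -- Each image of [a, b'] is at most g long, so it contains at most one break.
  have uniq : ∀ j ∈ Finset.Ico T E, ∀ x y, a ≤ x → x ≤ b' → a ≤ y → y ≤ b' → S.X t j x ∈ S.B →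
      S.X t j y ∈ S.B → x = y := by
    intro j hj x y hx hx' hy hy' hxB hyB
    apply (S.X_strictMono t j).injective
    refine S.B_sep _ hxB _ hyB ?_
    have h1 := hg j hj
    simp only [len] at h1
    have := (S.X_le t (n := j)).2 hx
    have := (S.X_le t (n := j)).2 hx'
    have := (S.X_le t (n := j)).2 hy
    have := (S.X_le t (n := j)).2 hy'
    rw [abs_le]; constructor <;> linarith
  have hCfin : ∀ c' ≤ b, (C c').Finite := by
    intro c' hc'
    have : C c' ⊆ ⋃ j ∈ Finset.Ico T E, {c | c ∈ Ioo a c' ∧ S.X t j c ∈ S.B} := by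
      rintro c ⟨h1, j, hj, h2⟩
      simp only [mem_iUnion]
      exact ⟨j, hj, h1, h2⟩
    refine Set.Finite.subset (Set.Finite.biUnion (Finset.finite_toSet _) fun j hj => ?_) this
    refine Set.Subsingleton.finite fun x hx y hy => ?_
    exact uniq j hj x y hx.1.1.le (by linarith [hx.1.2]) hy.1.1.le (by linarith [hy.1.2]) hx.2 hy.2
  -- Induction on the number of preimages of breaks in (a, c'), splitting off the piece to the right
  -- of the last one. The constant K reproduces itself because K = 1 + χ⁻¹ K.
  have main : ∀ n : ℕ, ∀ c', a < c' → c' ≤ b → (C c').ncard = n →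
      μ a c' ≤ M * ((c' - a) + γ * κ * 2 * h ^ (-β) * L * (S.χ⁻¹) ^ S.cuts t T E c' b * K) := by
    intro n
    induction n using Nat.strong_induction_on with
    | _ n ih =>
      intro c' hac' hc'b hn
      have hreg : ∀ c ∈ Icc a c', (∀ c₁ ∈ C c', c₁ ≤ c) → ∀ j ∈ Finset.Ico T E, ∀ q ∈ S.B,
          q ∉ Ioo (S.X t j c) (S.X t j c') := by
        intro c hc hmax j hj q hq hq'
        obtain ⟨c₁, rfl⟩ := S.X_surjective t j q
        have h1 := (S.X_lt t).1 hq'.1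
        have h2 := (S.X_lt t).1 hq'.2
        have := hmax c₁ ⟨⟨hc.1.trans_lt h1, h2⟩, j, hj, hq⟩
        linarith
      rcases (C c').eq_empty_or_nonempty with hemp | hne
      · refine (piece a c' le_rfl hac' hc'b
          (hreg a ⟨le_rfl, hac'.le⟩ (by simp [hemp]))).trans (mul_le_mul_of_nonneg_left ?_ hM)
        refine add_le_add_right ?_ _
        have : 0 ≤ γ * κ * 2 * h ^ (-β) * L * (S.χ⁻¹) ^ S.cuts t T E c' b := by positivity
        have hK1' : 1 ≤ K := by nlinarith
        nlinarith
      · obtain ⟨c, hcC, hcmax⟩ := Set.exists_max_image (C c') id (hCfin c' hc'b) hne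
        simp only [id] at hcmax
        obtain ⟨⟨hac, hcc'⟩, j₀, hj₀, hcB⟩ := hcC
        have hsub : C c ⊂ C c' := by
          refine ⟨fun x hx => ⟨⟨hx.1.1, hx.1.2.trans hcc'⟩, hx.2⟩, fun hs => ?_⟩
          exact lt_irrefl c (hs (show c ∈ C c' from ⟨⟨hac, hcc'⟩, j₀, hj₀, hcB⟩)).1.2
        have hcard : (C c).ncard < n := hn ▸ Set.ncard_lt_ncard hsub (hCfin c' hc'b)
        have e1 := ih _ hcard c hac (hcc'.le.trans hc'b) rfl
        have e2 := piece c c' hac.le hcc' hc'b (hreg c ⟨hac.le, hcc'.le⟩ hcmax)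
        have e3 := H.subadd a c c' hac.le hcc'.le
        -- The image of c at time j₀ is itself a break. It counts for c, as the intervals in `cuts`
        -- are closed, but not for c' > c, as there is no second break in that image.
        have hcuts : S.cuts t T E c' b + 1 ≤ S.cuts t T E c b := by
          rw [cuts, cuts, ← Finset.card_insert_of_notMem (a := j₀)]
          · refine Finset.card_le_card fun j hj => ?_
            rw [Finset.mem_insert] at hj
            rcases hj with rfl | hj
            · exact Finset.mem_filter.2 ⟨hj₀, _, hcB, le_rfl, (S.X_le t).2 (hcc'.le.trans hc'b)⟩
            · obtain ⟨hj1, q, hq, hq'⟩ := Finset.mem_filter.1 hj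
              exact Finset.mem_filter.2 ⟨hj1, q, hq, ((S.X_le t).2 hcc'.le).trans hq'.1, hq'.2⟩
          · intro hmem
            obtain ⟨hj1, q, hq, hq1, hq2⟩ := Finset.mem_filter.1 hmem
            obtain ⟨x, rfl⟩ := S.X_surjective t j₀ q
            have h1 := (S.X_le t).1 hq1
            have h2 := (S.X_le t).1 hq2
            have := uniq j₀ hj₀ x c (by linarith) (by linarith) hac.le (by linarith) hq hcB
            linarith
        have hpw : (S.χ⁻¹) ^ S.cuts t T E c b ≤ (S.χ⁻¹) ^ S.cuts t T E c' b * S.χ⁻¹ := by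
          rw [← pow_succ]
          exact pow_le_pow_of_le_one hχi0.le hχi.le hcuts
        set P := γ * κ * 2 * h ^ (-β) * L with hP
        have hP0 : 0 ≤ P := by positivity
        have e4 : M * ((c - a) + P * (S.χ⁻¹) ^ S.cuts t T E c b * K) ≤
            M * ((c - a) + P * ((S.χ⁻¹) ^ S.cuts t T E c' b * S.χ⁻¹) * K) := by gcongr
        calc μ a c' ≤ M * ((c - a) + P * ((S.χ⁻¹) ^ S.cuts t T E c' b * S.χ⁻¹) * K) +
              M * ((c' - c) + P * (S.χ⁻¹) ^ S.cuts t T E c' b) := by linarith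
          _ = M * ((c' - a) + P * (S.χ⁻¹) ^ S.cuts t T E c' b * (1 + S.χ⁻¹ * K)) := by ring
          _ = _ := by rw [hK1]
  refine (main _ b hab le_rfl rfl).trans (mul_le_mul_of_nonneg_left (add_le_add_right ?_ _) hM)
  have hp : (S.χ⁻¹) ^ S.cuts t T E b b ≤ 1 := pow_le_one₀ hχi0.le hχi.le
  have : 0 ≤ γ * κ * 2 * h ^ (-β) * L * K := by positivity
  calc γ * κ * 2 * h ^ (-β) * L * (S.χ⁻¹) ^ S.cuts t T E b b * K
      = (γ * κ * 2 * h ^ (-β) * L * K) * (S.χ⁻¹) ^ S.cuts t T E b b := by ring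
    _ ≤ (γ * κ * 2 * h ^ (-β) * L * K) * 1 := by gcongr
    _ = _ := by rw [hK]; ring

/-- Starting from the right end, [a, b] is divided into windows of length h at time E, the leftmost
possibly shorter. Every window has its successor as right neighbour in `window`; the lengths of
these neighbours at time T add up to at most that of [a, b']. -/
lemma windows {μ : ℝ → ℝ → ℝ} {M γ β κ h : ℝ} (hM : 0 ≤ M) (hγ : 0 ≤ γ) (hβ : β < 1)
    (hκ : 0 ≤ κ) (hh : 0 < h) {T E : ℕ} (hTE : T ≤ E) {a b b' : ℝ} (hab : a < b) (hbb : b ≤ b')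
    (hN : S.len t E b b' = h)
    (hsum : ∀ x y, a ≤ x → x ≤ y → y ≤ b' → S.len t E x y ≤ 2 * h →
      ∑ j ∈ Finset.Ico T E, S.len t j x y ^ α ≤ S.κ₀)
    (H : S.Piecewise t μ M γ β κ h T E a b) :
    μ a b ≤ M * ((b - a) + γ * κ * (2 / (1 - S.χ⁻¹)) * h ^ (-β) * S.len t T a b') := by
  have hχi : S.χ⁻¹ < 1 := inv_lt_one_of_one_lt₀ S.one_lt_χ
  set P := γ * κ * (2 / (1 - S.χ⁻¹)) * h ^ (-β) with hP
  have hP0 : 0 ≤ P := by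
    have : 0 < 1 - S.χ⁻¹ := by linarith
    positivity
  have main : ∀ n : ℕ, ∀ x y, a < x → x ≤ b → x ≤ y → y ≤ b' → S.len t E a x ≤ (n + 1) * h →
      S.len t E x y = h → μ a x ≤ M * ((x - a) + P * S.len t T a y) := by
    intro n
    induction n with
    | zero =>
      intro x y hax hxb hxy hy hl hlxy
      have := S.window t hM hγ hβ hκ hh hTE hax hxy (by simpa using hl) hlxy
        (hsum a y le_rfl (hax.le.trans hxy) hy (by rw [← S.len_add t E a x y]; simp at hl; linarith))
        (H.mono S le_rfl hxb)
      refine this.trans (mul_le_mul_of_nonneg_left (add_le_add_right ?_ _) hM)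
      exact mul_le_mul_of_nonneg_left (S.len_mono t hax.le le_rfl) hP0
    | succ n ih =>
      intro x y hax hxb hxy hy hl hlxy
      by_cases hle : S.len t E a x ≤ h
      · exact ih x y hax hxb hxy hy (by nlinarith) hlxy
      · push Not at hle
        obtain ⟨z, hz⟩ := S.X_surjective t E (S.X t E x - h)
        have haz : a < z := (S.X_lt t (n := E)).1 (by rw [hz]; simp only [len] at hle; linarith)
        have hzx : z < x := (S.X_lt t (n := E)).1 (by rw [hz]; linarith)
        have hlz : S.len t E z x = h := by rw [len, hz]; ring
        have e1 := ih z x haz (hzx.le.trans hxb) hzx.le (hxb.trans hbb)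
          (by have := S.len_add t E a z x; push_cast at hl; linarith) hlz
        have e2 := S.window t hM hγ hβ hκ hh hTE hzx hxy hlz.le hlxy
          (hsum z y haz.le (hzx.le.trans hxy) hy (by rw [← S.len_add t E z x y]; linarith))
          (H.mono S haz.le hxb)
        have e3 := H.subadd a z x haz.le hzx.le
        have e4 := S.len_add t T a x y
        calc μ a x ≤ M * ((z - a) + P * S.len t T a x) + M * ((x - z) + P * S.len t T x y) := by
              linarith
          _ = _ := by rw [← e4]; ring
  obtain ⟨n, hn⟩ := exists_nat_ge (S.len t E a b / h)
  refine main n b b' hab le_rfl hbb le_rfl ?_ hN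
  rw [div_le_iff₀ hh] at hn
  nlinarith

end LiftSystem

/-! ### Elementary sums -/

/-- The right side is the integral of the decreasing function s ^ (-β) over [y, x]; the proof is
Bernoulli's inequality for y / x. -/
lemma sub_mul_rpow_le {β x y : ℝ} (hβ0 : 0 ≤ β) (hβ : β < 1) (hy : 0 ≤ y)
    (hx : 0 < x) : (x - y) * x ^ (-β) ≤ (x ^ (1 - β) - y ^ (1 - β)) / (1 - β) := by
  have h1 : 0 < 1 - β := by linarith
  have hb := rpow_one_add_le_one_add_mul_self (s := y / x - 1) (p := 1 - β)
    (by have : 0 ≤ y / x := by positivity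
        linarith) h1.le (by linarith)
  rw [add_sub_cancel, Real.div_rpow hy hx.le] at hb
  have hxp : 0 < x ^ (1 - β) := Real.rpow_pos_of_pos hx _
  rw [div_le_iff₀ hxp] at hb
  have e : x ^ (1 - β) = x * x ^ (-β) := by
    rw [sub_eq_add_neg, Real.rpow_add hx, Real.rpow_one]
  rw [le_div_iff₀ h1]
  have e2 : (1 + (1 - β) * (y / x - 1)) * x ^ (1 - β) =
      x ^ (1 - β) - (1 - β) * ((x - y) * x ^ (-β)) := by
    rw [e]; field_simp; ring
  linarith

/-- Telescoping with shift 3 leaves three initial terms. The shift is 3 because an exiting part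
together with its right neighbour will spread over three consecutive exit steps. -/
lemma sum_sub_shift_le {g : ℕ → ℝ} (hg : Antitone g) (h0 : ∀ i, 0 ≤ g i) (n : ℕ) :
    ∑ i ∈ Finset.range n, (g i - g (i + 3)) ≤ 3 * g 0 := by
  have : ∑ i ∈ Finset.range n, (g i - g (i + 3)) + (g n + g (n + 1) + g (n + 2)) =
      g 0 + g 1 + g 2 := by
    induction n with
    | zero => simp
    | succ n ih =>
      rw [Finset.sum_range_succ, show n + 1 + 1 = n + 2 by rfl, show n + 1 + 2 = n + 3 by rfl]
      linarith
  have h1 := hg (show 0 ≤ 1 by omega)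
  have h2 := hg (show 0 ≤ 2 by omega)
  linarith [h0 n, h0 (n + 1), h0 (n + 2)]

/-- A weighted sum of the decrements of a decreasing sequence. -/
lemma sum_decrement_le {β A B C : ℝ} (hβ0 : 0 ≤ β) (hβ : β < 1) (hA : 0 ≤ A) (hB : 0 ≤ B)
    (hC : 0 ≤ C) {j w : ℕ → ℝ} (hj : Antitone j) (h0 : ∀ i, 0 ≤ j i)
    (hw : ∀ i, 0 < j i → w i ≤ C * j i ^ (-β)) (n : ℕ) :
    ∑ i ∈ Finset.range n, (j i - j (i + 3)) * (A + B * w i) ≤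
      A * (3 * j 0) + B * C * (3 * j 0 ^ (1 - β) / (1 - β)) := by
  have h1 : 0 < 1 - β := by linarith
  have step : ∀ i, (j i - j (i + 3)) * (A + B * w i) ≤ A * (j i - j (i + 3)) +
      B * C / (1 - β) * (j i ^ (1 - β) - j (i + 3) ^ (1 - β)) := by
    intro i
    have hle := hj (show i ≤ i + 3 by omega)
    have h3 := h0 (i + 3)
    rcases (h0 i).eq_or_lt with hz | hpos
    · have : j (i + 3) = 0 := by linarith
      simp [← hz, this]
    · have e1 := sub_mul_rpow_le hβ0 hβ h3 hpos
      have e2 : (j i - j (i + 3)) * w i ≤ (j i - j (i + 3)) * (C * j i ^ (-β)) :=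
        mul_le_mul_of_nonneg_left (hw i hpos) (by linarith)
      calc (j i - j (i + 3)) * (A + B * w i)
          = A * (j i - j (i + 3)) + B * ((j i - j (i + 3)) * w i) := by ring
        _ ≤ A * (j i - j (i + 3)) + B * ((j i - j (i + 3)) * (C * j i ^ (-β))) := by gcongr
        _ = A * (j i - j (i + 3)) + B * C * ((j i - j (i + 3)) * j i ^ (-β)) := by ring
        _ ≤ A * (j i - j (i + 3)) +
            B * C * ((j i ^ (1 - β) - j (i + 3) ^ (1 - β)) / (1 - β)) := by gcongr
        _ = _ := by ring
  refine (Finset.sum_le_sum fun i _ => step i).trans ?_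
  rw [Finset.sum_add_distrib, ← Finset.mul_sum, ← Finset.mul_sum]
  have e1 := sum_sub_shift_le hj h0 n
  have e2 := sum_sub_shift_le (g := fun i => j i ^ (1 - β))
    (fun a b hab => Real.rpow_le_rpow (h0 b) (hj hab) h1.le)
    (fun i => Real.rpow_nonneg (h0 i) _) n
  calc _ ≤ A * (3 * j 0) + B * C / (1 - β) * (3 * j 0 ^ (1 - β)) := by gcongr
    _ = _ := by ring

/-- The start and the power sum of a sequence each step of which either is uniformly expanding or
starts far below the final value. -/
lemma gain_sum {α G l : ℝ} (hα : 0 < α) (hG : 1 ≤ G) (hl : 1 < l) (z : ℕ → ℝ) {T s : ℕ}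
    (hz : ∀ j, 0 ≤ z j) (hmono : Monotone z)
    (h : ∀ j ∈ Finset.Ico T (T + s), G * z j ≤ z (T + s) ∨ l * z j ≤ z (j + 1)) :
    (G ≤ l ^ s → G * z T ≤ z (T + s)) ∧
      ∑ j ∈ Finset.Ico T (T + s), z j ^ α ≤ s * (z (T + s) / G) ^ α +
        z (T + s) ^ α / (l ^ α - 1) := by
  have hG0 : 0 < G := by linarith
  have hlα : 1 < l ^ α := Real.one_lt_rpow hl hα
  constructor
  · intro hGl
    by_cases hex : ∃ j ∈ Finset.Ico T (T + s), G * z j ≤ z (T + s)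
    · obtain ⟨j, hj, hj'⟩ := hex
      have := hmono (Finset.mem_Ico.1 hj).1
      nlinarith
    · push Not at hex
      have : ∀ i ≤ s, l ^ i * z T ≤ z (T + i) := by
        intro i hi
        induction i with
        | zero => simp
        | succ i ih =>
          have hm : T + i ∈ Finset.Ico T (T + s) := by simp; omega
          have h1 := (h (T + i) hm).resolve_left (not_le.2 (hex _ hm))
          calc l ^ (i + 1) * z T = l * (l ^ i * z T) := by ring
            _ ≤ l * z (T + i) := by
              have := ih (by omega)
              gcongr
            _ ≤ _ := h1
      exact (mul_le_mul_of_nonneg_right hGl (hz T)).trans (this s le_rfl)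
  -- A step of the first kind contributes at most (z (T + s) / G) ^ α; steps of the second kind are
  -- bounded by increments, which telescope.
  · have hstep : ∀ j ∈ Finset.Ico T (T + s), z j ^ α ≤ (z (T + s) / G) ^ α +
        (z (j + 1) ^ α - z j ^ α) / (l ^ α - 1) := by
      intro j hj
      have hm : z j ^ α ≤ z (j + 1) ^ α :=
        Real.rpow_le_rpow (hz j) (hmono (Nat.le_succ j)) hα.le
      rcases h j hj with h1 | h1
      · have : z j ^ α ≤ (z (T + s) / G) ^ α :=
          Real.rpow_le_rpow (hz j) (by rw [le_div_iff₀ hG0]; linarith) hα.le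
        have : 0 ≤ (z (j + 1) ^ α - z j ^ α) / (l ^ α - 1) :=
          div_nonneg (by linarith) (by linarith)
        linarith
      · have h2 : l ^ α * z j ^ α ≤ z (j + 1) ^ α := by
          rw [← Real.mul_rpow (by linarith) (hz j)]
          exact Real.rpow_le_rpow (mul_nonneg (by linarith) (hz j)) h1 hα.le
        have : z j ^ α ≤ (z (j + 1) ^ α - z j ^ α) / (l ^ α - 1) := by
          rw [le_div_iff₀ (by linarith)]; linarith
        have : 0 ≤ (z (T + s) / G) ^ α := Real.rpow_nonneg (div_nonneg (hz _) hG0.le) _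
        linarith
    refine (Finset.sum_le_sum hstep).trans ?_
    rw [Finset.sum_add_distrib, Finset.sum_const, ← Finset.sum_div,
      Finset.sum_Ico_sub (fun j => z j ^ α) (Nat.le_add_right T s)]
    simp only [Nat.card_Ico, add_tsub_cancel_left, nsmul_eq_mul]
    have : 0 ≤ z T ^ α := Real.rpow_nonneg (hz T) _
    have : (z (T + s) ^ α - z T ^ α) / (l ^ α - 1) ≤ z (T + s) ^ α / (l ^ α - 1) :=
      div_le_div_of_nonneg_right (by linarith) (by linarith)
    linarith

/-! ### Passages through the neighbourhood of the fixed points -/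

namespace LiftSystem
variable {α : ℝ} (S : LiftSystem α)

/-- The image of `[x, y]` at time `E` is at distance `ρ` from the fixed points. -/
def Outside (t : ℕ → ℝ) (ρ : ℝ) (E : ℕ) (x y : ℝ) : Prop :=
  ∀ c ∈ S.Q, c + ρ ≤ S.X t E x ∨ S.X t E y ≤ c - ρ

variable {S} in
lemma Outside.mono {t : ℕ → ℝ} {ρ : ℝ} {E : ℕ} {x y x' y' : ℝ} (h : S.Outside t ρ E x y)
    (hx : x ≤ x') (hy : y' ≤ y) : S.Outside t ρ E x' y' := fun c hc =>
  (h c hc).imp (fun h => h.trans ((S.X_le t).2 hx)) (fun h => ((S.X_le t).2 hy).trans h)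

/-- Before arriving outside the `δ / 2`-neighbourhood of the fixed points, a short interval is
expanded uniformly or by a large total amount. -/
lemma exists_gain (G : ℝ) (hG : 1 ≤ G) {δ : ℝ} (hδ : 0 < δ) (hδ1 : δ ≤ 1) (hδr : δ ≤ S.r) :
    ∃ ε₀ > 0, ∃ l > 1, ∀ t : ℕ → ℝ, (∀ i, |t i| ≤ ε₀) → ∀ (E : ℕ) (x y : ℝ), x ≤ y →
      S.len t E x y ≤ δ / 2 → S.Outside t (δ / 2) E x y → ∀ j < E,
        G * S.len t j x y ≤ S.len t E x y ∨ l * S.len t j x y ≤ S.len t (j + 1) x y := by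
  obtain ⟨R, hR1, hR⟩ := S.exists_trip_gain G (by linarith)
  have hR0 : 0 < R := by linarith
  obtain ⟨ε₀, hε₀, htrip⟩ := hR (δ / 2 / R) (δ / 2) (by positivity)
    (by rw [div_le_one hR0]; linarith) (by field_simp; exact le_rfl) (by linarith)
  obtain ⟨l, hl, hl'⟩ := S.away (δ / 2 / R) (by positivity)
  refine ⟨ε₀, hε₀, l, hl, fun t ht E x y hxy hlen hout j hj => ?_⟩
  -- Either the image is at distance δ / (2R) from the fixed points, where expansion is uniform, or
  -- it comes closer to one of them and still has to travel to distance δ / 2, which yields the gain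
  -- G.
  by_cases hmeet : ∀ z ∈ Ico (S.X t j x) (S.X t j y), ∀ c ∈ S.Q, δ / 2 / R ≤ |z - c|
  · right
    rw [len_succ]
    exact S.le_slope ((S.X_le t).2 hxy) fun z hz => hl' z (hmeet z hz)
  · left
    push Not at hmeet
    obtain ⟨z, hz, c, hc, hzc⟩ := hmeet
    obtain ⟨N, hN0, hN⟩ := S.exists_center hc
    have hz' := abs_lt.1 hzc
    have := htrip t ht x y j (E - j) c N hc hN hxy
      (fun i hi _ _ => (S.len_le_of_le t (by omega) hxy).trans hlen)
      (by rw [hN0]; push_cast; linarith [hz.1]) (by rw [hN0]; push_cast; linarith [hz.2])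
      (by rw [show j + (E - j) = E by omega]; exact hout _ (S.center_mem hc _))
    rwa [show j + (E - j) = E by omega] at this

variable (t : ℕ → ℝ)

/-- The contribution of a part `[x₀, x₁]` of a smooth interval `[a, b]` that leaves the
neighbourhood of the fixed points at time `T + s`. -/
lemma exit_window {G l δ c₀ h γ β M : ℝ} {k s T : ℕ} {a b : ℝ} (hG : 1 ≤ G) (hl : 1 < l)
    (hlk : G ≤ l ^ k) (hks : k ≤ s) (hs1 : 1 ≤ s)
    (hgain : ∀ (E : ℕ) (x y : ℝ), x ≤ y → S.len t E x y ≤ δ / 2 → S.Outside t (δ / 2) E x y →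
      ∀ j < E, G * S.len t j x y ≤ S.len t E x y ∨ l * S.len t j x y ≤ S.len t (j + 1) x y)
    (hω : S.Pair t a b T) (hh : 0 < h) (hhδ : 2 * h ≤ δ / 2) (hh1 : h ≤ 1)
    (hhl : (2 * h) ^ α / (l ^ α - 1) ≤ S.κ₀ / 3) (hc₀ : 0 < c₀) (hc₀1 : c₀ ≤ 1)
    (hc₀3 : (2 * c₀) ^ α ≤ 1 / 3) (hc₀κ : (2 * c₀) ^ α ≤ S.κ₀ / 3)
    (hhL : h ≤ G * c₀ * S.len t T a b) (hhs : h ≤ G * c₀ * (s : ℝ) ^ (-1 / α))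
    (hM : 0 ≤ M) (hγ : 0 ≤ γ) (hβ : β < 1) {μ : ℝ → ℝ → ℝ}
    (hμ : ∀ x y z, x ≤ y → y ≤ z → μ x z ≤ μ x y + μ y z)
    (hIH : ∀ x y, S.Pair t x y (T + s) →
      μ x y ≤ M * ((y - x) * (1 + γ * S.len t (T + s) x y ^ (-β))))
    {x₀ x₁ v : ℝ} (hx₀ : a ≤ x₀) (hx : x₀ < x₁) (hx₁ : x₁ ≤ b) (hv : x₁ ≤ v)
    (hlv : S.len t (T + s) x₁ v = h) (hout : S.Outside t (δ / 2) (T + s) x₀ v) :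
    S.len t T x₁ v ≤ S.len t T a b ∧
      μ x₀ x₁ ≤ M * ((x₁ - x₀) + γ * (2 * (b - a) / S.len t T a b) * (2 / (1 - S.χ⁻¹)) *
        h ^ (-β) * S.len t T x₀ v) := by
  have hα := S.α_pos
  have hG0 : 0 < G := by linarith
  have hL : 0 < S.len t T a b := S.len_pos t hω.lt
  have hlα : 1 < l ^ α := Real.one_lt_rpow hl hα
  have hκ := S.κ₀_pos
  have hs0 : (0 : ℝ) < s := by exact_mod_cast hs1
  have key : ∀ x y, x₀ ≤ x → x ≤ y → y ≤ v → S.len t (T + s) x y ≤ 2 * h →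
      G * S.len t T x y ≤ S.len t (T + s) x y ∧
      ∑ j ∈ Finset.Ico T (T + s), S.len t j x y ^ α ≤ s * (S.len t (T + s) x y / G) ^ α +
        S.len t (T + s) x y ^ α / (l ^ α - 1) := by
    intro x y hx hxy hy hle
    have := gain_sum hα hG hl (fun j => S.len t j x y) (T := T) (s := s)
      (fun j => S.len_nonneg t hxy) (fun i j hij => S.len_le_of_le t hij hxy)
      (fun j hj => hgain (T + s) x y hxy (hle.trans hhδ) (hout.mono hx hy) j
        (Finset.mem_Ico.1 hj).2)
    exact ⟨this.1 (hlk.trans (pow_le_pow_right₀ hl.le hks)), this.2⟩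
  have hsum : ∀ x y, x₀ ≤ x → x ≤ y → y ≤ v → S.len t (T + s) x y ≤ 2 * h →
      ∑ j ∈ Finset.Ico T (T + s), S.len t j x y ^ α ≤ 2 * S.κ₀ / 3 := by
    intro x y hx hxy hy hle
    refine (key x y hx hxy hy hle).2.trans ?_
    have h0 := S.len_nonneg t (j := T + s) hxy
    -- The bound h ≤ G c₀ s ^ (-1/α) makes each of the s steps of the first kind in `gain_sum` cost
    -- at most (2 c₀) ^ α / s, hence κ₀ / 3 in total.
    have h1 : (S.len t (T + s) x y / G) ^ α ≤ (2 * c₀) ^ α * (s : ℝ)⁻¹ := by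
      have : (s : ℝ)⁻¹ = ((s : ℝ) ^ (-1 / α)) ^ α := by
        rw [← Real.rpow_mul hs0.le, div_mul_cancel₀ _ hα.ne', Real.rpow_neg_one]
      rw [this, ← Real.mul_rpow (by positivity) (by positivity)]
      refine Real.rpow_le_rpow (by positivity) ?_ hα.le
      rw [div_le_iff₀ hG0]
      nlinarith
    have h2 : s * (S.len t (T + s) x y / G) ^ α ≤ S.κ₀ / 3 := by
      calc _ ≤ s * ((2 * c₀) ^ α * (s : ℝ)⁻¹) := by gcongr
        _ = (2 * c₀) ^ α := by field_simp
        _ ≤ _ := hc₀κ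
    have h3 : S.len t (T + s) x y ^ α / (l ^ α - 1) ≤ S.κ₀ / 3 := by
      refine le_trans ?_ hhl
      exact div_le_div_of_nonneg_right (Real.rpow_le_rpow h0 hle hα.le) (by linarith)
    linarith
  constructor
  · have := (key x₁ v hx.le hv le_rfl (by linarith)).1
    rw [hlv] at this
    have h2 : c₀ * S.len t T a b ≤ S.len t T a b := mul_le_of_le_one_left hL.le hc₀1
    have h3 : G * S.len t T x₁ v ≤ G * (c₀ * S.len t T a b) := by linarith
    exact (le_of_mul_le_mul_left h3 hG0).trans h2
  · refine S.windows t hM hγ hβ ?_ hh (Nat.le_add_right T s) hx hv hlv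
      (fun x y hx hxy hy hle => (hsum x y hx hxy hy hle).trans (by linarith)) ⟨hμ, ?_, ?_⟩
    · have := hω.lt
      exact div_nonneg (by linarith) hL.le
    · intro x y hx0 hxy hy hle hreg
      -- The budget κ₀ is shared: 2 κ₀ / 3 for the times from T on, and κ₀ / 3 before T, because the
      -- piece is at time T at most the fraction c₀ of [a, b].
      refine hIH x y ⟨hxy, hle.trans hh1, ?_, fun j hj q hq hq' => ?_⟩
      · have e1 := hsum x y hx0 hxy.le (hy.trans hv) (by linarith)
        have e2 := hω.sum_sub_le S (hx₀.trans hx0) hxy.le (hy.trans hx₁)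
        have e3 := (key x y hx0 hxy.le (hy.trans hv) (by linarith)).1
        have e4 : 2 * S.len t T x y / S.len t T a b ≤ 2 * c₀ := by
          rw [div_le_iff₀ hL]
          have : G * S.len t T x y ≤ G * (c₀ * S.len t T a b) := by linarith
          linarith [le_of_mul_le_mul_left this hG0]
        have e5 : (2 * S.len t T x y / S.len t T a b) ^ α ≤ 1 / 3 :=
          (Real.rpow_le_rpow (div_nonneg (by linarith [S.len_nonneg t (j := T) hxy.le]) hL.le)
            e4 hα.le).trans hc₀3
        rw [← Finset.sum_range_add_sum_Ico _ (Nat.le_add_right T s)]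
        nlinarith
      · by_cases hjT : j < T
        · exact hω.regular j hjT q hq ⟨((S.X_le t).2 (hx₀.trans hx0)).trans_lt hq'.1,
            hq'.2.trans_le ((S.X_le t).2 (hy.trans hx₁))⟩
        · exact hreg j (Finset.mem_Ico.2 ⟨by omega, hj⟩) q hq hq'
    · exact fun x y hx0 hxy hy => hω.sub_le S (hx₀.trans hx0) hxy (hy.trans hx₁)

end LiftSystem
namespace LiftSystem
variable {α : ℝ} (S : LiftSystem α) {t : ℕ → ℝ}

/-- A subinterval of a short smooth interval that is outside the neighbourhood of the fixed points
at time `T + s`, together with its right neighbour inside an interval of twice the length. -/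
lemma exit_piece {G l δ c₀ h₀ γ α' β M : ℝ} {k s T : ℕ} {a b b' : ℝ} (hG : 1 ≤ G) (hl : 1 < l)
    (hlk : G ≤ l ^ k) (hks : k ≤ s) (hs1 : 1 ≤ s)
    (hgain : ∀ (E : ℕ) (x y : ℝ), x ≤ y → S.len t E x y ≤ δ / 2 → S.Outside t (δ / 2) E x y →
      ∀ j < E, G * S.len t j x y ≤ S.len t E x y ∨ l * S.len t j x y ≤ S.len t (j + 1) x y)
    (hω : S.Pair t a b T) (hh : 0 < h₀) (hhδ : 2 * h₀ ≤ δ / 2) (hh1 : h₀ ≤ 1)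
    (hhl : (2 * h₀) ^ α / (l ^ α - 1) ≤ S.κ₀ / 3) (hc₀ : 0 < c₀) (hc₀1 : c₀ ≤ 1)
    (hc₀3 : (2 * c₀) ^ α ≤ 1 / 3) (hc₀κ : (2 * c₀) ^ α ≤ S.κ₀ / 3)
    (hM : 0 ≤ M) (hγ : 0 ≤ γ) (hβ : β < 1) (hα' : β / α = α') {μ : ℝ → ℝ → ℝ}
    (hμ : ∀ x y z, x ≤ y → y ≤ z → μ x z ≤ μ x y + μ y z)
    (hIH : ∀ x y, S.Pair t x y (T + s) →
      μ x y ≤ M * ((y - x) * (1 + γ * S.len t (T + s) x y ^ (-β))))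
    (hbb : S.len t T b b' = S.len t T a b)
    {x₀ x₁ : ℝ} (hx₀ : a ≤ x₀) (hx : x₀ < x₁) (hx₁ : x₁ ≤ b)
    (hout : ∀ v, x₁ ≤ v → S.len t (T + s) x₁ v ≤ h₀ → S.Outside t (δ / 2) (T + s) x₀ v) :
    ∃ v, x₁ ≤ v ∧ v ≤ b' ∧ S.len t (T + s) x₁ v ≤ h₀ ∧
      μ x₀ x₁ ≤ M * ((x₁ - x₀) + γ * (2 * (b - a) / S.len t T a b) * (2 / (1 - S.χ⁻¹)) *
        (h₀ ^ (-β) + (G * c₀) ^ (-β) * S.len t T a b ^ (-β) + (G * c₀) ^ (-β) * (s : ℝ) ^ α') *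
          S.len t T x₀ v) := by
  have hα := S.α_pos
  have hG0 : 0 < G := by linarith
  have hL : 0 < S.len t T a b := S.len_pos t hω.lt
  have hs0 : (0 : ℝ) < s := by exact_mod_cast hs1
  have hχ : S.χ⁻¹ < 1 := inv_lt_one_of_one_lt₀ S.one_lt_χ
  set L := S.len t T a b with hLdef
  -- The largest window size allowed by `exit_window`. Since h ^ (-β) is one of the three
  -- corresponding powers, it is at most their sum; the last one produces s ^ (β / α) = s ^ α'.
  set h := min h₀ (min (G * c₀ * L) (G * c₀ * (s : ℝ) ^ (-1 / α))) with hhdef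
  have hh0 : 0 < h := by positivity
  have hle : h ≤ h₀ := min_le_left _ _
  obtain ⟨v, hv, hlv⟩ := S.exists_len_eq t (T + s) x₁ hh0.le
  obtain ⟨e1, e2⟩ := S.exit_window t hG hl hlk hks hs1 hgain hω hh0 (by linarith) (by linarith)
    ((div_le_div_of_nonneg_right (Real.rpow_le_rpow (by linarith) (by linarith) hα.le)
      (by have := Real.one_lt_rpow hl hα; linarith)).trans hhl) hc₀ hc₀1 hc₀3 hc₀κ
    ((min_le_right _ _).trans (min_le_left _ _)) ((min_le_right _ _).trans (min_le_right _ _))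
    hM hγ hβ hμ hIH hx₀ hx hx₁ hv hlv (hout v hv (hlv.trans_le hle))
  refine ⟨v, hv, ?_, hlv.trans_le hle, e2.trans (mul_le_mul_of_nonneg_left ?_ hM)⟩
  · have h1 := (S.X_le t (n := T)).2 hx₁
    refine (S.X_le t (n := T)).1 ?_
    rw [← hLdef] at e1
    simp only [len] at hbb e1 ⊢
    linarith
  · have hpow : h ^ (-β) ≤
        h₀ ^ (-β) + (G * c₀) ^ (-β) * L ^ (-β) + (G * c₀) ^ (-β) * (s : ℝ) ^ α' := by
      have p1 : 0 < h₀ ^ (-β) := Real.rpow_pos_of_pos hh _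
      have p2 : 0 < (G * c₀) ^ (-β) * L ^ (-β) := by positivity
      have p3 : 0 < (G * c₀) ^ (-β) * ((s : ℝ) ^ (-1 / α)) ^ (-β) := by positivity
      have e3 : (s : ℝ) ^ α' = ((s : ℝ) ^ (-1 / α)) ^ (-β) := by
        rw [← Real.rpow_mul hs0.le, ← hα']; congr 1; field_simp
      rw [e3]
      rw [← Real.mul_rpow (by positivity) (by positivity)] at p2 p3 ⊢
      rw [← Real.mul_rpow (by positivity) (by positivity)]
      rcases min_choice h₀ (min (G * c₀ * L) (G * c₀ * (s : ℝ) ^ (-1 / α))) with h1 | h1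
      · rw [hhdef, h1]; linarith
      · rcases min_choice (G * c₀ * L) (G * c₀ * (s : ℝ) ^ (-1 / α)) with h2 | h2
        · rw [hhdef, h1, h2]; linarith
        · rw [hhdef, h1, h2]; linarith
    refine add_le_add_right ?_ _
    have h1 : 0 ≤ S.len t T x₀ v := S.len_nonneg t (hx.le.trans hv)
    have h2 : 0 ≤ b - a := by linarith [hω.lt]
    have h3 : 0 < 1 - S.χ⁻¹ := by linarith
    gcongr

set_option maxHeartbeats 2000000 in
/-- The contribution of a short smooth interval, run until its parts leave the neighbourhood of
the fixed points. -/
lemma small_cycle {G l δ c₀ h₀ ε₁ γ α' β M C C' : ℝ} {k n T : ℕ} {a b : ℝ} (hG : 1 ≤ G)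
    (hl : 1 < l) (hlk : G ≤ l ^ k) (hk : 3 ≤ k)
    (hgain : ∀ (E : ℕ) (x y : ℝ), x ≤ y → S.len t E x y ≤ δ / 2 → S.Outside t (δ / 2) E x y →
      ∀ j < E, G * S.len t j x y ≤ S.len t E x y ∨ l * S.len t j x y ≤ S.len t (j + 1) x y)
    (hstay : ∀ i, ∀ c c' : ℝ, S.F c = c' → ∀ z, (c + δ ≤ z → c' + δ + 2 * ε₁ ≤ S.F z + t i) ∧
      (z ≤ c - δ → S.F z + t i ≤ c' - δ - 2 * ε₁)) (hε₁ : 0 < ε₁) (htδ : ∀ i, |t i| ≤ δ)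
    (hδ : 0 < δ) (hδ1 : 2 * δ ≤ 1) (hδr : (S.Λ + 3) * δ ≤ S.r)
    (hC : ∀ (T n : ℕ) (a b : ℝ), 1 ≤ n → a < b → S.len t (T + n) a b ≤ 1 →
      S.len t T a b ≤ C * (n : ℝ) ^ (-1 / α)) (hC0 : 0 < C) (hC' : C' = C * 3 ^ (1 / α))
    (hω : S.Pair t a b T) (hh : 0 < h₀) (hhδ : 2 * h₀ ≤ δ / 2) (hh1 : h₀ ≤ 1)
    (hhΛ : S.Λ * h₀ ≤ 2 * ε₁)
    (hhl : (2 * h₀) ^ α / (l ^ α - 1) ≤ S.κ₀ / 3) (hc₀ : 0 < c₀) (hc₀1 : c₀ ≤ 1)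
    (hc₀3 : (2 * c₀) ^ α ≤ 1 / 3) (hc₀κ : (2 * c₀) ^ α ≤ S.κ₀ / 3)
    (hL1 : S.Λ ^ k * S.len t T a b ≤ δ / 4)
    (hL2 : 2 * S.len t T a b ≤ C' * ((k + 1 : ℕ) : ℝ) ^ (-1 / α))
    (hM : 0 ≤ M) (hγ : 0 ≤ γ) (hβ0 : 0 ≤ β) (hβ : β < 1) (hα' : β / α = α') {μ : ℝ → ℝ → ℝ}
    (hμ : ∀ x y z, x ≤ y → y ≤ z → μ x z ≤ μ x y + μ y z) (hμ' : ∀ x y, x ≤ y → μ x y ≤ y - x)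
    (hIH : ∀ T', T < T' → T' ≤ T + (k + n) → ∀ x y, S.Pair t x y T' →
      μ x y ≤ M * ((y - x) * (1 + γ * S.len t T' x y ^ (-β)))) :
    μ a b ≤ M * ((b - a) + γ * (2 * (b - a) / S.len t T a b) * (2 / (1 - S.χ⁻¹)) *
        ((h₀ ^ (-β) + (G * c₀) ^ (-β) * S.len t T a b ^ (-β)) * (3 * (2 * S.len t T a b)) +
          (G * c₀) ^ (-β) * C' ^ β * (3 * (2 * S.len t T a b) ^ (1 - β) / (1 - β)))) +
      2 * (b - a) / S.len t T a b * (C * ((k + n : ℕ) : ℝ) ^ (-1 / α)) := by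
  have hα := S.α_pos
  have hG0 : 0 < G := by linarith
  have hΛ := S.one_le_Λ
  have hab := hω.lt
  have hL : 0 < S.len t T a b := S.len_pos t hω.lt
  have hχ : S.χ⁻¹ < 1 := inv_lt_one_of_one_lt₀ S.one_lt_χ
  set L := S.len t T a b with hLdef
  obtain ⟨b', hbb', hb'⟩ := S.exists_len_eq t T b hL.le
  have hab' : S.len t T a b' = 2 * L := by rw [← S.len_add t T a b b', hb']; ring
  obtain ⟨c, hc, hcfar⟩ := S.near_Q (S.X t (T + k) a)
  obtain ⟨N, hN0, hN⟩ := S.exists_center hc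
  -- The points of [v i, u i] are those within δ of the moving centre at time T + k + i. By `hstay`
  -- points that leave do not come back to it, so these intervals decrease, each end moving by at
  -- least 2ε₁ at the later time.
  choose u hu using fun i => S.X_surjective t (T + k + i) (c + N i + δ)
  choose v hv using fun i => S.X_surjective t (T + k + i) (c + N i - δ)
  have hu1 : ∀ i, 2 * ε₁ ≤ S.len t (T + k + i + 1) (u (i + 1)) (u i) := fun i => by
    have e1 := (hstay (T + k + i) _ _ (hN i) (S.X t (T + k + i) (u i))).1 (by rw [hu])
    have e2 := hu (i + 1)
    rw [← X_succ] at e1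
    rw [← add_assoc] at e2
    rw [len, e2]; linarith
  have hv1 : ∀ i, 2 * ε₁ ≤ S.len t (T + k + i + 1) (v i) (v (i + 1)) := fun i => by
    have e1 := (hstay (T + k + i) _ _ (hN i) (S.X t (T + k + i) (v i))).2 (by rw [hv])
    have e2 := hv (i + 1)
    rw [← X_succ] at e1
    rw [← add_assoc] at e2
    rw [len, e2]; linarith
  have hu2 : ∀ i, u (i + 1) ≤ u i := fun i => (S.X_le t (n := T + k + i + 1)).1 (by
    have := hu1 i; simp only [len] at this; linarith)
  have hv2 : ∀ i, v i ≤ v (i + 1) := fun i => (S.X_le t (n := T + k + i + 1)).1 (by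
    have := hv1 i; simp only [len] at this; linarith)
  have hvu : ∀ i, v i ≤ u i := fun i => (S.X_le t (n := T + k + i)).1 (by
    rw [hu, hv]; linarith)
  -- The ends are truncated to [a, b'] and preceded by two copies of b'. The part exiting to the
  -- right at time T + k + i lies in [u' (i + 2), u' (i + 1)] and its right neighbour reaches at
  -- most u' i; the two copies cover i = 0 and i = 1.
  obtain ⟨u', u0, u1, us⟩ : ∃ u' : ℕ → ℝ, u' 0 = b' ∧ u' 1 = b' ∧
    ∀ i, u' (i + 2) = max a (min b' (u i)) :=
    ⟨fun | 0 => b' | 1 => b' | (i + 2) => max a (min b' (u i)), rfl, rfl, fun _ => rfl⟩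
  obtain ⟨v', v0, v1, vs⟩ : ∃ v' : ℕ → ℝ, v' 0 = a ∧ v' 1 = a ∧
    ∀ i, v' (i + 2) = max a (min b' (v i)) :=
    ⟨fun | 0 => a | 1 => a | (i + 2) => max a (min b' (v i)), rfl, rfl, fun _ => rfl⟩
  have hab'' : a ≤ b' := by linarith
  have hu'a : Antitone u' := antitone_nat_of_succ_le fun i => by
    match i with
    | 0 => rw [u0, u1]
    | 1 => rw [u1, us]; exact max_le hab'' (min_le_left _ _)
    | i + 2 => rw [us, us]; exact max_le_max le_rfl (min_le_min le_rfl (hu2 i))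
  have hv'm : Monotone v' := monotone_nat_of_le_succ fun i => by
    match i with
    | 0 => rw [v0, v1]
    | 1 => rw [v1, vs]; exact le_max_left _ _
    | i + 2 => rw [vs, vs]; exact max_le_max le_rfl (min_le_min le_rfl (hv2 i))
  have hvu' : ∀ i, v' i ≤ u' i := fun i => by
    match i with
    | 0 => rw [v0, u0]; exact hab''
    | 1 => rw [v1, u1]; exact hab''
    | i + 2 => rw [vs, us]; exact max_le_max le_rfl (min_le_min le_rfl (hvu i))
  have hav' : ∀ i, a ≤ v' i := fun i => v0 ▸ hv'm (Nat.zero_le i)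
  -- Exiting parts are taken in [a, b]; the extension to b' only makes room for right neighbours.
  set U : ℕ → ℝ := fun i => min b (u' i) with hU
  set V : ℕ → ℝ := fun i => min b (v' i) with hV
  have hUV : ∀ i, V i ≤ U i := fun i => min_le_min le_rfl (hvu' i)
  have haV : ∀ i, a ≤ V i := fun i => le_min hab.le (hav' i)
  have hUs : ∀ i, U (i + 1) ≤ U i := fun i => min_le_min le_rfl (hu'a (Nat.le_succ i))
  have hVs : ∀ i, V i ≤ V (i + 1) := fun i => min_le_min le_rfl (hv'm (Nat.le_succ i))
  set W : ℕ → ℝ := fun i => ((k + i : ℕ) : ℝ) ^ α' with hW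
  set A := h₀ ^ (-β) + (G * c₀) ^ (-β) * L ^ (-β) with hA
  set B := (G * c₀) ^ (-β) with hB
  set P := γ * (2 * (b - a) / L) * (2 / (1 - S.χ⁻¹)) with hP
  have hA0 : 0 ≤ A := by positivity
  have hB0 : 0 ≤ B := by positivity
  have hP0 : 0 ≤ P := by
    have h2 : 0 ≤ b - a := by linarith
    have h3 : 0 < 1 - S.χ⁻¹ := by linarith
    positivity
  have hW0 : ∀ i, 0 ≤ W i := fun i => by positivity
  have hkΛ : S.len t (T + k) a b ≤ δ / 4 := (S.len_add_le t T k hab.le).trans hL1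
  -- distance to the other fixed points
  have hr1 : S.Λ * δ + 3 * δ ≤ S.r := by linarith
  have hr2 : 4 * δ ≤ S.r := by nlinarith
  have hΛh : h₀ ≤ 2 * ε₁ := by nlinarith
  have hother : ∀ i (c' : ℝ), c' ∈ S.Q → c' ≠ c + N i → c' + S.r ≤ c + N i ∨ c + N i + S.r ≤ c' := by
    intro i c' hc' hne
    rcases le_abs.1 (S.Q_sep c' hc' _ (S.center_mem hc (N i)) hne) with h | h
    · right; linarith
    · left; linarith
  have hFδ : ∀ i, S.F (c + N i + δ) + t (T + k + i) ≤ c + N (i + 1) + (S.Λ + 1) * δ := fun i => by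
    have := S.sub_F_le (u := c + N i) (v := c + N i + δ) (by linarith)
    rw [hN] at this
    linarith [(abs_le.1 (htδ (T + k + i))).2]
  have hFδ' : ∀ i, c + N (i + 1) - (S.Λ + 1) * δ ≤ S.F (c + N i - δ) + t (T + k + i) := fun i => by
    have := S.sub_F_le (u := c + N i - δ) (v := c + N i) (by linarith)
    rw [hN] at this
    linarith [(abs_le.1 (htδ (T + k + i))).1]
  have core : ∀ i ≤ n, ∀ x₀ x₁, a ≤ x₀ → x₀ < x₁ → x₁ ≤ b →
      (∀ w, x₁ ≤ w → S.len t (T + (k + i)) x₁ w ≤ h₀ →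
        S.Outside t (δ / 2) (T + (k + i)) x₀ w) →
      ∃ w, x₁ ≤ w ∧ w ≤ b' ∧ S.len t (T + (k + i)) x₁ w ≤ h₀ ∧
        μ x₀ x₁ ≤ M * ((x₁ - x₀) + P * (A + B * W i) * S.len t T x₀ w) :=
    fun i hi x₀ x₁ hx₀ hx hx₁ hout => S.exit_piece hG hl hlk (Nat.le_add_right k i) (by omega)
      hgain hω hh hhδ hh1 hhl hc₀ hc₀1 hc₀3 hc₀κ hM hγ hβ hα' hμ
      (hIH _ (by omega) (by omega)) hb' hx₀ hx hx₁ hout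
  have hAW : ∀ i, 0 ≤ P * (A + B * W i) := fun i =>
    mul_nonneg hP0 (add_nonneg hA0 (mul_nonneg hB0 (hW0 i)))
  -- The part is beyond the right edge at time T + k + i but was not one step earlier (`le_prev`),
  -- so it is still within (Λ + 1)δ of the centre and away from all other fixed points. For i = 0
  -- this comes instead from the choice of c and the smallness of the image.
  have right : ∀ i ≤ n, μ (U (i + 2)) (U (i + 1)) ≤ M * ((U (i + 1) - U (i + 2)) +
      P * (A + B * W i) * S.len t T (u' (i + 3)) (u' i)) := by
    intro i hi
    have hlen0 : 0 ≤ S.len t T (u' (i + 3)) (u' i) := S.len_nonneg t (hu'a (by omega))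
    rcases (hUs (i + 1)).eq_or_lt with heq | hlt
    · have e1 : μ (U (i + 2)) (U (i + 1)) ≤ 0 := by
        have := hμ' (U (i + 2)) (U (i + 1)) heq.le
        rw [heq, sub_self] at this
        rwa [heq]
      refine e1.trans (mul_nonneg hM (add_nonneg (by rw [heq, sub_self]) ?_))
      exact mul_nonneg (hAW i) hlen0
    · change U (i + 2) < U (i + 1) at hlt
      have ha2 : a ≤ U (i + 2) := (haV _).trans (hUV _)
      have hUb : U (i + 1) ≤ b := min_le_left _ _
      have hUu : U (i + 2) = u' (i + 2) := by
        rcases min_choice b (u' (i + 2)) with h | h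
        · simp only [hU] at hlt hUb; rw [h] at hlt; linarith
        · exact h
      have hu_le : u i ≤ U (i + 2) := by
        rw [hUu, us]
        rcases le_total (u i) b' with h | h
        · rw [min_eq_right h]; exact le_max_right _ _
        · rw [hUu, us, min_eq_left h, max_eq_right hab''] at hlt
          linarith
      have hXu := (S.X_le t (n := T + k + i)).2 hu_le
      rw [hu] at hXu
      have le_prev : ∀ i', i = i' + 1 → U (i + 1) ≤ u i' := by
        rintro i' rfl
        have h1 : U (i' + 2) ≤ max a (min b' (u i')) := us i' ▸ min_le_right _ _
        rcases le_total a (min b' (u i')) with h | h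
        · rw [max_eq_right h] at h1; exact h1.trans (min_le_right _ _)
        · rw [max_eq_left h] at h1
          have : U (i' + 1 + 1) = U (i' + 2) := rfl
          linarith
      obtain ⟨w, hw1, hw2, hw3, hw4⟩ := core i hi (U (i + 2)) (U (i + 1)) ha2 hlt hUb (by
        intro w hw hwl c' hc'
        rw [← add_assoc] at hwl ⊢
        by_cases hcc : c' = c + N i
        · left; rw [hcc]; linarith
        rcases hother i c' hc' hcc with h | h
        · left; linarith [S.r_pos]
        · rcases Nat.eq_zero_or_pos i with rfl | hi0
          · have hfar := hcfar c' hc' (by rintro rfl; simp [hN0] at hcc)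
            simp only [add_zero] at *
            simp only [len] at hwl hkΛ
            have e1 := (S.X_le t (n := T + k)).2 hUb
            have e2 := (S.X_le t (n := T + k)).2 ha2
            rcases le_abs.1 hfar with h' | h'
            · left; linarith
            · right; linarith
          · right
            obtain ⟨i', rfl⟩ : ∃ i', i = i' + 1 := ⟨i - 1, by omega⟩
            have e1 := (S.X_le t (n := T + k + (i' + 1))).2 (le_prev i' rfl)
            have e2 := hFδ i'
            rw [← hu, ← X_succ] at e2
            rw [← add_assoc (T + k)] at *
            simp only [len] at hwl
            linarith)
      refine hw4.trans (mul_le_mul_of_nonneg_left (add_le_add_right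
        (mul_le_mul_of_nonneg_left (S.len_mono t ?_ ?_) (hAW i)) _) hM)
      · rw [hUu]; exact hu'a (by omega)
      -- The neighbour has length at most h₀ ≤ 2ε₁ when the part exits, which does not exceed the
      -- distance between the images of u (i' + 1) and u i'; so it ends before u i'.
      · match i with
        | 0 => rw [u0]; exact hw2
        | 1 => rw [u1]; exact hw2
        | i' + 2 =>
          rw [us]
          refine le_trans (le_min hw2 ((S.X_le t (n := T + k + (i' + 1) + 1)).1 ?_)) (le_max_right _ _)
          have e1 := (S.X_le t (n := T + k + (i' + 1) + 1)).2 (le_prev (i' + 1) rfl)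
          have e2 := S.len_le_succ t (T + k + (i' + 1)) (hu2 i')
          have e3 := hu1 i'
          rw [show T + (k + (i' + 2)) = T + k + (i' + 1) + 1 by omega] at hw3
          rw [show T + k + i' + 1 = T + k + (i' + 1) by omega] at e3
          simp only [len] at e2 e3 hw3
          linarith
  have left : ∀ i ≤ n, μ (V (i + 1)) (V (i + 2)) ≤ M * ((V (i + 2) - V (i + 1)) +
      P * (A + B * W i) * S.len t T (v' i) (v' (i + 3))) := by
    intro i hi
    have hlen0 : 0 ≤ S.len t T (v' i) (v' (i + 3)) := S.len_nonneg t (hv'm (by omega))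
    rcases (hVs (i + 1)).eq_or_lt with heq | hlt
    · change V (i + 1) = V (i + 2) at heq
      have e1 : μ (V (i + 1)) (V (i + 2)) ≤ 0 := by
        have := hμ' (V (i + 1)) (V (i + 2)) heq.le
        rw [heq, sub_self] at this
        rwa [heq]
      refine e1.trans (mul_nonneg hM (add_nonneg (by rw [heq, sub_self]) ?_))
      exact mul_nonneg (hAW i) hlen0
    · change V (i + 1) < V (i + 2) at hlt
      have hVb : V (i + 2) ≤ b := min_le_left _ _
      have hVv : V (i + 1) = v' (i + 1) := by
        rcases min_choice b (v' (i + 1)) with h | h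
        · simp only [hV] at hlt hVb; rw [h] at hlt; linarith
        · exact h
      have le_v : V (i + 2) ≤ v i := by
        have h1 : V (i + 2) ≤ max a (min b' (v i)) := vs i ▸ min_le_right _ _
        rcases le_total a (min b' (v i)) with h | h
        · rw [max_eq_right h] at h1; exact h1.trans (min_le_right _ _)
        · rw [max_eq_left h] at h1
          linarith [haV (i + 1)]
      have hXv := (S.X_le t (n := T + k + i)).2 le_v
      rw [hv] at hXv
      obtain ⟨w, hw1, hw2, hw3, hw4⟩ := core i hi (V (i + 1)) (V (i + 2)) (haV _) hlt hVb (by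
        intro w hw hwl c' hc'
        rw [← add_assoc] at hwl ⊢
        by_cases hcc : c' = c + N i
        · right; rw [hcc]; simp only [len] at hwl; linarith
        rcases hother i c' hc' hcc with h | h
        · rcases Nat.eq_zero_or_pos i with rfl | hi0
          · have hfar := hcfar c' hc' (by rintro rfl; simp [hN0] at hcc)
            simp only [add_zero] at *
            simp only [len] at hwl hkΛ
            have e1 := (S.X_le t (n := T + k)).2 hVb
            have e2 := (S.X_le t (n := T + k)).2 (haV (0 + 1))
            rcases le_abs.1 hfar with h' | h'
            · left; linarith
            · right; linarith
          · left
            obtain ⟨i', rfl⟩ : ∃ i', i = i' + 1 := ⟨i - 1, by omega⟩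
            have e0 : v i' ≤ V (i' + 2) := by
              have hVv' : V (i' + 2) = v' (i' + 2) := hVv
              rw [hVv', vs]
              rcases le_total (v i') b' with h | h
              · rw [min_eq_right h]; exact le_max_right _ _
              · rw [show V (i' + 1 + 1) = V (i' + 2) from rfl, hVv', vs, min_eq_left h,
                  max_eq_right hab''] at hlt
                linarith
            have e1 := (S.X_le t (n := T + k + (i' + 1))).2 e0
            have e2 := hFδ' i'
            rw [← hv, ← X_succ] at e2
            rw [← add_assoc (T + k)] at *
            simp only [len] at hwl
            change _ ≤ S.X t (T + k + i' + 1) (V (i' + 2))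
            linarith
        · right; simp only [len] at hwl; linarith [S.r_pos])
      refine hw4.trans (mul_le_mul_of_nonneg_left (add_le_add_right
        (mul_le_mul_of_nonneg_left (S.len_mono t ?_ ?_) (hAW i)) _) hM)
      · rw [hVv]; exact hv'm (by omega)
      -- On this side the right neighbour points inwards. It does not pass v (i + 1): the images of
      -- v i and v (i + 1) are at least 2ε₁ apart one step later, hence 2ε₁ / Λ ≥ h₀ apart now.
      · rw [vs (i + 1)]
        refine le_trans (le_min hw2 ((S.X_le t (n := T + k + i)).1 ?_)) (le_max_right _ _)
        have e2 := S.len_succ_le t (T + k + i) (hv2 i)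
        have e3 := hv1 i
        have e4 : h₀ ≤ S.len t (T + k + i) (v i) (v (i + 1)) :=
          le_of_mul_le_mul_left (by linarith) (by linarith : 0 < S.Λ)
        rw [← add_assoc] at hw3
        have e5 := hv i
        simp only [len] at e4 hw3
        linarith
  -- the sum over the exit times
  set j : ℕ → ℝ := fun i => S.len t T (v' i) (u' i) with hj
  have hsplit : ∀ m, μ a b ≤ ∑ i ∈ Finset.range m,
      (μ (U (i + 2)) (U (i + 1)) + μ (V (i + 1)) (V (i + 2))) + μ (V (m + 1)) (U (m + 1)) := by
    intro m
    induction m with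
    | zero =>
      have e1 : V 1 = a := by simp only [hV, v1]; exact min_eq_right hab.le
      have e2 : U 1 = b := by simp only [hU, u1]; exact min_eq_left hbb'
      simp [e1, e2]
    | succ m ih =>
      rw [Finset.sum_range_succ]
      have e1 := hμ (V (m + 1)) (V (m + 2)) (U (m + 1)) (hVs _) ((hUV _).trans (hUs _))
      have e2 := hμ (V (m + 2)) (U (m + 2)) (U (m + 1)) (hUV _) (hUs _)
      linarith
  have hsum : ∀ m ≤ n + 1, ∑ i ∈ Finset.range m,
      (μ (U (i + 2)) (U (i + 1)) + μ (V (i + 1)) (V (i + 2))) ≤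
      M * ((b - a) - (U (m + 1) - V (m + 1)) +
        P * ∑ i ∈ Finset.range m, (j i - j (i + 3)) * (A + B * W i)) := by
    intro m hm
    induction m with
    | zero =>
      have e1 : V 1 = a := by simp only [hV, v1]; exact min_eq_right hab.le
      have e2 : U 1 = b := by simp only [hU, u1]; exact min_eq_left hbb'
      simp [e1, e2]
    | succ m ih =>
      rw [Finset.sum_range_succ, Finset.sum_range_succ]
      have e1 := right m (by omega)
      have e2 := left m (by omega)
      have e3 := ih (by omega)
      have e4 : j m - j (m + 3) = S.len t T (u' (m + 3)) (u' m) + S.len t T (v' m) (v' (m + 3)) := by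
        simp only [hj, len]; ring
      rw [e4]
      refine (add_le_add e3 (add_le_add e1 e2)).trans (le_of_eq ?_)
      change M * (_ - (U (m + 1) - V (m + 1)) + _) + _ =
        M * (b - a - (U (m + 2) - V (m + 2)) + _)
      ring
  have hj0 : j 0 = 2 * L := by simp only [hj, u0, v0]; exact hab'
  have hinside : ∀ i, v' (i + 2) < u' (i + 2) → v i ≤ v' (i + 2) ∧ u' (i + 2) ≤ u i := by
    intro i hlt
    rw [us, vs] at *
    constructor
    · rcases le_total (v i) b' with h | h
      · rw [min_eq_right h]; exact le_max_right _ _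
      · rw [min_eq_left h, max_eq_right hab''] at hlt
        exact absurd hlt (not_lt.2 (max_le hab'' (min_le_left _ _)))
    · rcases le_total a (u i) with h | h
      · exact max_le h (min_le_right _ _)
      · rw [max_eq_left ((min_le_right _ _).trans h)] at hlt
        exact absurd hlt (not_lt.2 (le_max_left _ _))
  -- What lies in [v' (i + 2), u' (i + 2)] has length at most 2δ ≤ 1 at time T + k + i, hence length
  -- O((k + i) ^ (-1/α)) at time T; the factor 3 ^ (1/α) in C' pays for the shift of the index by 2.
  -- Inverting, the weight W i is at most a constant times j i ^ (-β), as `sum_decrement_le`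
  -- requires.
  have hjW : ∀ i, 0 < j i → W i ≤ C' ^ β * j i ^ (-β) := by
    intro i hi
    have hki : (0 : ℝ) < (k + i : ℕ) := by exact_mod_cast (by omega : 0 < k + i)
    have hjC : j i ≤ C' * ((k + i : ℕ) : ℝ) ^ (-1 / α) := by
      have small : i ≤ 1 → j i ≤ C' * ((k + i : ℕ) : ℝ) ^ (-1 / α) := fun hi1 => by
        have e1 : j i = 2 * L := by
          obtain rfl | rfl : i = 0 ∨ i = 1 := by omega
          · exact hj0
          · simp only [hj, u1, v1]; exact hab'
        rw [e1]
        refine hL2.trans (mul_le_mul_of_nonneg_left ?_ (by rw [hC']; positivity))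
        refine Real.rpow_le_rpow_of_nonpos hki (by exact_mod_cast (by omega)) ?_
        rw [neg_div]; exact neg_nonpos.2 (by positivity)
      match i, hi, hki, small with
      | 0, _, _, small => exact small (by omega)
      | 1, _, _, small => exact small (by omega)
      | i + 2, hi, hki, _ =>
        have hlt : v' (i + 2) < u' (i + 2) := (S.X_lt t (n := T)).1 (sub_pos.1 hi)
        obtain ⟨h1, h2⟩ := hinside i hlt
        have e1 := hC T (k + i) _ _ (by omega) hlt ((S.len_mono t h1 h2).trans (by
          rw [← add_assoc, len, hu, hv]; linarith))
        refine e1.trans ?_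
        rw [hC', mul_assoc]
        refine mul_le_mul_of_nonneg_left ?_ hC0.le
        have e2 : (3 : ℝ) ^ (1 / α) = (1 / 3 : ℝ) ^ (-1 / α) := by
          rw [one_div (3 : ℝ), Real.inv_rpow (by norm_num), neg_div, Real.rpow_neg (by norm_num),
            inv_inv]
        rw [e2, ← Real.mul_rpow (by norm_num) hki.le]
        refine Real.rpow_le_rpow_of_nonpos (by positivity) ?_ ?_
        · push_cast
          have : (3 : ℝ) ≤ k := by exact_mod_cast hk
          have : (0 : ℝ) ≤ i := by positivity
          linarith
        · rw [neg_div]; exact neg_nonpos.2 (by positivity)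
    have hC'0 : 0 < C' := by rw [hC']; positivity
    rw [Real.rpow_neg hi.le, ← div_eq_mul_inv, ← Real.div_rpow hC'0.le hi.le]
    have e3 : ((k + i : ℕ) : ℝ) ^ (1 / α) ≤ C' / j i := by
      rw [le_div_iff₀ hi]
      rw [neg_div, Real.rpow_neg hki.le, ← div_eq_mul_inv, le_div_iff₀ (by positivity)] at hjC
      linarith
    have e4 := Real.rpow_le_rpow (by positivity) e3 hβ0
    rwa [← Real.rpow_mul hki.le, show 1 / α * β = α' by rw [← hα']; ring] at e4
  have hjanti : Antitone j := fun i i' h => S.len_mono t (hv'm h) (hu'a h)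
  have hjnn : ∀ i, 0 ≤ j i := fun i => S.len_nonneg t (hvu' i)
  have hfin := sum_decrement_le hβ0 hβ hA0 hB0 (C := C' ^ β) (by rw [hC']; positivity) hjanti hjnn hjW (n + 1)
  rw [hj0] at hfin
  have e1 := hsplit (n + 1)
  have e2 := hsum (n + 1) le_rfl
  -- Nothing is gained on the points that have not left by time T + k + n, but they fill an interval
  -- of polynomially small length.
  have hmid : μ (V (n + 1 + 1)) (U (n + 1 + 1)) ≤
      2 * (b - a) / L * (C * ((k + n : ℕ) : ℝ) ^ (-1 / α)) := by
    have hκ0 : 0 ≤ 2 * (b - a) / L := div_nonneg (by linarith) hL.le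
    refine (hμ' _ _ (hUV _)).trans ?_
    rcases (hUV (n + 2)).eq_or_lt with heq | hlt
    · change V (n + 1 + 1) = U (n + 1 + 1) at heq
      rw [heq, sub_self]
      positivity
    · have hUb : U (n + 2) ≤ b := min_le_left _ _
      have hVv : V (n + 2) = v' (n + 2) := by
        rcases min_choice b (v' (n + 2)) with h | h
        · simp only [hV] at hlt hUb; rw [h] at hlt; linarith
        · exact h
      have hUu : U (n + 2) ≤ u' (n + 2) := min_le_right _ _
      obtain ⟨h1, h2⟩ := hinside n (by rw [← hVv]; exact hlt.trans_le hUu)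
      have h3 := hC T (k + n) _ _ (by omega) hlt ((S.len_mono t (hVv ▸ h1) (hUu.trans h2)).trans (by
          rw [← add_assoc, len, hu, hv]; linarith))
      exact (hω.sub_le S (haV _) hlt.le hUb).trans (mul_le_mul_of_nonneg_left h3 hκ0)
  have e5 := hUV (n + 1 + 1)
  have e6 : M * ((b - a) - (U (n + 1 + 1) - V (n + 1 + 1)) +
        P * ∑ i ∈ Finset.range (n + 1), (j i - j (i + 3)) * (A + B * W i)) ≤
      M * ((b - a) + P * (A * (3 * (2 * L)) + B * C' ^ β * (3 * (2 * L) ^ (1 - β) / (1 - β)))) := by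
    refine mul_le_mul_of_nonneg_left (add_le_add (by linarith) ?_) hM
    exact mul_le_mul_of_nonneg_left hfin hP0
  linarith

/-- For the induction: one passage replaces the weight L ^ (-β) by half of it plus a constant b₁,
apart from the loss L⁻¹ N ^ (-1/α) due to points that need more than N steps. The threshold δ₀ does
not depend on G, while the noise level, η and k do. -/
lemma exists_small_cycle {q : ℝ} (hβ0 : 0 < α * q) (hβ : α * q < 1) :
    ∃ δ₀ > (0 : ℝ), ∀ δ, 0 < δ → δ < δ₀ → ∃ ε₀ > 0, ∃ η > 0, η ≤ 1 ∧ ∃ k : ℕ, ∃ b₁ ≥ 0, ∃ C ≥ 0,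
      ∀ t : ℕ → ℝ, (∀ i, |t i| ≤ ε₀) → ∀ μ : ℝ → ℝ → ℝ,
      (∀ x y z, x ≤ y → y ≤ z → μ x z ≤ μ x y + μ y z) → (∀ x y, x ≤ y → μ x y ≤ y - x) →
      ∀ M γ : ℝ, 0 ≤ M → 0 ≤ γ → ∀ T N : ℕ, k ≤ N →
      (∀ T', T < T' → T' ≤ T + N → ∀ x y, S.Pair t x y T' →
        μ x y ≤ M * ((y - x) * (1 + γ * S.len t T' x y ^ (-(α * q))))) →
      ∀ a b, S.Pair t a b T → S.len t T a b ≤ η →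
        μ a b ≤ M * ((b - a) * (1 + γ * (b₁ + 1 / 2 * S.len t T a b ^ (-(α * q))))) +
          (b - a) * C * (S.len t T a b)⁻¹ * (N : ℝ) ^ (-1 / α) := by
  have hα := S.α_pos
  have hr := S.r_pos
  have hΛ := S.one_le_Λ
  have hκ := S.κ₀_pos
  have hχ : S.χ⁻¹ < 1 := inv_lt_one_of_one_lt₀ S.one_lt_χ
  set β := α * q with hβdef
  obtain ⟨Cg, hCg, hgrow⟩ := S.exists_len_le
  set C' := Cg * 3 ^ (1 / α) with hC'
  have hC'0 : 0 < C' := by positivity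
  set Cχ := 2 / (1 - S.χ⁻¹) with hCχ
  have hCχ0 : 0 < Cχ := div_pos two_pos (by linarith)
  set K₁ := 12 + 6 * C' ^ β * 2 ^ (1 - β) / (1 - β) with hK₁
  have h1β : 0 < 1 - β := by linarith
  have hK₁0 : 0 < K₁ := by positivity
  set c₀ := 1 / 2 * (min 1 S.κ₀ / 3) ^ (1 / α) with hc₀
  have hc₀0 : 0 < c₀ := by positivity
  have hmin : 0 < min 1 S.κ₀ := by positivity
  have hc₀α : (2 * c₀) ^ α = min 1 S.κ₀ / 3 := by
    rw [hc₀, ← mul_assoc, mul_one_div_cancel two_ne_zero, one_mul, ← Real.rpow_mul (by positivity),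
      one_div_mul_cancel hα.ne', Real.rpow_one]
  have hc₀1 : c₀ ≤ 1 := by
    have : (min 1 S.κ₀ / 3) ^ (1 / α) ≤ 1 := by
      refine Real.rpow_le_one (by positivity) ?_ (by positivity)
      linarith [min_le_left 1 S.κ₀]
    rw [hc₀]; linarith
  -- The power L ^ (-β) enters the estimate of `small_cycle` with coefficient Cχ (G c₀) ^ (-β) K₁;
  -- this G makes it at most 1 / 2.
  set G := max 1 ((2 * Cχ * K₁) ^ (1 / β) / c₀) with hG
  have hG1 : 1 ≤ G := le_max_left _ _
  have hGc : Cχ * (G * c₀) ^ (-β) * K₁ ≤ 1 / 2 := by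
    have h1 : (2 * Cχ * K₁) ^ (1 / β) ≤ G * c₀ := by
      rw [← div_le_iff₀ hc₀0]; exact le_max_right _ _
    have h2 := Real.rpow_le_rpow (by positivity) h1 hβ0.le
    rw [← Real.rpow_mul (by positivity), one_div_mul_cancel hβ0.ne', Real.rpow_one] at h2
    rw [Real.rpow_neg (by positivity)]
    have h3 : 0 < (G * c₀) ^ β := by positivity
    rw [mul_assoc, inv_mul_eq_div, mul_div_assoc', div_le_iff₀ h3]
    linarith
  refine ⟨min (1 / 2) (S.r / (S.Λ + 3)), by positivity, fun δ hδ hδ' => ?_⟩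
  obtain ⟨hδ1, hδr⟩ := lt_min_iff.1 hδ'
  rw [lt_div_iff₀ (by linarith)] at hδr
  obtain ⟨ε₂, hε₂, l, hl, hgain⟩ := S.exists_gain G hG1 hδ (by linarith) (by nlinarith)
  obtain ⟨ε₁, hε₁, hstay⟩ := S.exists_stay hδ (by linarith)
  obtain ⟨k₀, hk₀⟩ := pow_unbounded_of_one_lt G hl
  set k := max 3 k₀ with hk
  have hlk : G ≤ l ^ k := hk₀.le.trans (pow_le_pow_right₀ hl.le (le_max_right _ _))
  have hlα : 1 < l ^ α := Real.one_lt_rpow hl hα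
  -- In turn: windows shorter than 1 and small compared with δ, neighbours that do not skip an exit
  -- step, and a geometric part of the distortion sum below κ₀ / 3.
  set h₀ := min (min 1 (δ / 4)) (min (2 * ε₁ / S.Λ)
    (1 / 2 * (S.κ₀ / 3 * (l ^ α - 1)) ^ (1 / α))) with hh₀
  have hlα' : 0 < l ^ α - 1 := by linarith
  have hh₀0 : 0 < h₀ := by positivity
  have hh₀1 : h₀ ≤ 1 := (min_le_left _ _).trans (min_le_left _ _)
  have hh₀δ : h₀ ≤ δ / 4 := (min_le_left _ _).trans (min_le_right _ _)
  have hh₀ε : S.Λ * h₀ ≤ 2 * ε₁ := by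
    have : h₀ ≤ 2 * ε₁ / S.Λ := (min_le_right _ _).trans (min_le_left _ _)
    rw [le_div_iff₀ (by linarith)] at this
    linarith
  have hh₀l : (2 * h₀) ^ α / (l ^ α - 1) ≤ S.κ₀ / 3 := by
    have h1 : h₀ ≤ 1 / 2 * (S.κ₀ / 3 * (l ^ α - 1)) ^ (1 / α) :=
      (min_le_right _ _).trans (min_le_right _ _)
    have h2 := Real.rpow_le_rpow (by positivity)
      (show 2 * h₀ ≤ (S.κ₀ / 3 * (l ^ α - 1)) ^ (1 / α) by linarith) hα.le
    rw [← Real.rpow_mul (by positivity), one_div_mul_cancel hα.ne', Real.rpow_one] at h2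
    rwa [div_le_iff₀ hlα']
  refine ⟨min δ (min ε₁ ε₂), by positivity,
    min 1 (min (δ / 4 / S.Λ ^ k) (C' * ((k + 1 : ℕ) : ℝ) ^ (-1 / α) / 2)), by positivity,
    min_le_left _ _, k, 12 * Cχ * h₀ ^ (-β), by positivity, 2 * Cg, by positivity,
    fun t ht μ hμ hμ' M γ hM hγ T N hkN hIH a b hω hη => ?_⟩
  have hL := S.len_pos t (j := T) hω.lt
  set L := S.len t T a b with hLdef
  have hη1 : L ≤ δ / 4 / S.Λ ^ k := hη.trans ((min_le_right _ _).trans (min_le_left _ _))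
  have hη2 : L ≤ C' * ((k + 1 : ℕ) : ℝ) ^ (-1 / α) / 2 :=
    hη.trans ((min_le_right _ _).trans (min_le_right _ _))
  rw [le_div_iff₀ (by positivity)] at hη1
  obtain ⟨n, rfl⟩ := Nat.exists_eq_add_of_le hkN
  have key := S.small_cycle (t := t) (α' := q) (n := n) hG1 hl hlk (le_max_left _ _)
    (hgain t fun i => (ht i).trans ((min_le_right _ _).trans (min_le_right _ _)))
    (fun i => hstay (t i) ((ht i).trans ((min_le_right _ _).trans (min_le_left _ _)))) hε₁
    (fun i => (ht i).trans (min_le_left _ _)) hδ (by linarith) (by linarith)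
    (fun T n a b => hgrow t T n a b) hCg hC' hω hh₀0 (by linarith) hh₀1 hh₀ε hh₀l hc₀0 hc₀1
    (by rw [hc₀α]; linarith [min_le_left 1 S.κ₀]) (by rw [hc₀α]; linarith [min_le_right 1 S.κ₀])
    (by linarith) (by linarith) hM hγ hβ0.le hβ (by rw [hβdef]; field_simp) hμ hμ' hIH
  rw [← hLdef, ← hCχ] at key
  have hba : 0 < b - a := by linarith [hω.lt]
  have e1 : (2 * L) ^ (1 - β) = 2 ^ (1 - β) * (L * L ^ (-β)) := by
    rw [Real.mul_rpow (by norm_num) hL.le, sub_eq_add_neg, Real.rpow_add hL, Real.rpow_one]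
  have e2 : γ * (2 * (b - a) / L) * Cχ * ((h₀ ^ (-β) + (G * c₀) ^ (-β) * L ^ (-β)) * (3 * (2 * L)) +
      (G * c₀) ^ (-β) * C' ^ β * (3 * (2 * L) ^ (1 - β) / (1 - β))) =
      (b - a) * (γ * (12 * Cχ * h₀ ^ (-β) + (Cχ * (G * c₀) ^ (-β) * K₁) * L ^ (-β))) := by
    rw [e1, hK₁]; field_simp; ring
  rw [e2] at key
  have e3 : 2 * (b - a) / L * (Cg * ((k + n : ℕ) : ℝ) ^ (-1 / α)) =
      (b - a) * (2 * Cg) * L⁻¹ * ((k + n : ℕ) : ℝ) ^ (-1 / α) := by ring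
  rw [e3] at key
  refine key.trans (add_le_add_left (mul_le_mul_of_nonneg_left ?_ hM) _)
  have hLβ : 0 < L ^ (-β) := by positivity
  rw [mul_add (b - a) 1, mul_one]
  gcongr

end LiftSystem
namespace LiftSystem
variable {α : ℝ} (S : LiftSystem α) (t : ℕ → ℝ)

/-! ### Good times -/

/-- The time `m` is good for `u`: the orbit is then in the `δ`-neighbourhood of the fixed points,
and `n` steps earlier `u` is well inside a smooth interval with small distortion. -/
def Good (δ κ : ℝ) (n m₁ m : ℕ) (u : ℝ) : Prop :=
  ∃ T, m = T + n ∧ m₁ ≤ T ∧ (∃ c ∈ S.Q, |S.X t m u - c| < δ) ∧ ∃ a b, a < u ∧ u < b ∧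
    κ < S.len t T a u ∧ κ < S.len t T u b ∧ S.len t T a b < 1 ∧
    ∑ j ∈ Finset.range T, S.len t j a b ^ α < S.κ₀ ∧
    ∀ j < T, ∀ q ∈ S.B, q ∉ Icc (S.X t j a) (S.X t j b)

/-- The derivative of `T - j` iterates compared to the ratio of lengths. -/
lemma len_le_prod {a b : ℝ} (hab : a < b) {T : ℕ}
    (hsum : ∑ j ∈ Finset.range T, S.len t j a b ^ α ≤ S.κ₀)
    (hreg : ∀ j < T, ∀ q ∈ S.B, q ∉ Icc (S.X t j a) (S.X t j b)) {y : ℝ} (hy : y ∈ Ico a b) {j : ℕ}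
    (hj : j ≤ T) :
    S.len t T a b ≤ 2 * S.len t j a b * ∏ i ∈ Finset.Ico j T, S.D (S.X t i y) := by
  have hsub : Finset.Ico j T ⊆ Finset.range T := fun i hi => by
    simp only [Finset.mem_Ico] at hi; simp [hi.2]
  have hg : ∀ i < T, S.len t i a b ≤ S.g := fun i hi =>
    S.len_le_g t hab.le hsum (Finset.mem_range.2 hi)
  have main : ∀ k, j ≤ k → k ≤ T → S.len t k a b ≤
      Real.exp (S.H * ∑ i ∈ Finset.Ico j k, S.len t i a b ^ α) * S.len t j a b *
        ∏ i ∈ Finset.Ico j k, S.D (S.X t i y) := by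
    intro k hk
    induction k, hk using Nat.le_induction with
    | base => simp
    | succ k hk ih =>
      intro hkT
      have ih := ih (by omega)
      rw [Finset.sum_Ico_succ_top hk, Finset.prod_Ico_succ_top hk, mul_add, Real.exp_add]
      set K := S.H * S.len t k a b ^ α with hK
      have hK0 : 0 ≤ K := mul_nonneg S.H_pos.le (Real.rpow_nonneg (S.len_nonneg t hab.le) _)
      have hy1 := (S.X_le t (n := k)).2 hy.1
      have hy2 := (S.X_lt t (n := k)).2 hy.2
      have hgk := hg k (by omega)
      have hD : ∀ x ∈ Ico (S.X t k a) (S.X t k b), S.D x ≤ S.D (S.X t k y) + K := by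
        intro x hx
        have hnb : ∀ w ∈ Icc (S.X t k a) (S.X t k b), w ∉ S.B := fun w hw hwB =>
          hreg k (by omega) w hwB hw
        have hle : ∀ z, 0 ≤ z → z ≤ S.len t k a b → S.H * z ^ α ≤ K := fun z hz hz' =>
          mul_le_mul_of_nonneg_left (Real.rpow_le_rpow hz hz' S.α_pos.le) S.H_pos.le
        simp only [len] at hgk hle
        rcases le_total x (S.X t k y) with h | h
        · have := S.holder x _ h (by linarith [hx.1]) fun w hw =>
            hnb w ⟨by linarith [hx.1, hw.1], by linarith [hw.2]⟩
          have h2 := hle (S.X t k y - x) (by linarith) (by linarith [hx.1])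
          linarith [(abs_le.1 this).2]
        · have := S.holder _ x h (by linarith [hx.2]) fun w hw =>
            hnb w ⟨by linarith [hw.1], by linarith [hw.2, hx.2]⟩
          have h2 := hle (x - S.X t k y) (by linarith) (by linarith [hx.2])
          linarith [(abs_le.1 this).1]
      have e1 := S.slope_le ((S.X_le t).2 hab.le) hD
      rw [← len_succ] at e1
      have hDy := S.one_le (S.X t k y)
      have hexp : S.D (S.X t k y) + K ≤ Real.exp K * S.D (S.X t k y) := by
        nlinarith [Real.add_one_le_exp K]
      have hl0 := S.len_nonneg t (j := k) hab.le
      change _ ≤ (S.D (S.X t k y) + K) * S.len t k a b at e1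
      calc S.len t (k + 1) a b ≤ (Real.exp K * S.D (S.X t k y)) * S.len t k a b :=
            e1.trans (mul_le_mul_of_nonneg_right hexp hl0)
        _ ≤ (Real.exp K * S.D (S.X t k y)) *
            (Real.exp (S.H * ∑ i ∈ Finset.Ico j k, S.len t i a b ^ α) * S.len t j a b *
            ∏ i ∈ Finset.Ico j k, S.D (S.X t i y)) :=
            mul_le_mul_of_nonneg_left ih (mul_nonneg (Real.exp_pos _).le (by linarith))
        _ = _ := by ring
  have hs : ∑ i ∈ Finset.Ico j T, S.len t i a b ^ α ≤ S.κ₀ :=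
    (Finset.sum_le_sum_of_subset_of_nonneg hsub
      fun _ _ _ => Real.rpow_nonneg (S.len_nonneg t hab.le) _).trans hsum
  have hexp : Real.exp (S.H * ∑ i ∈ Finset.Ico j T, S.len t i a b ^ α) ≤ 2 := by
    refine (Real.exp_le_exp.2 ?_).trans S.exp_κ₀_le
    have h1 := mul_le_mul_of_nonneg_left hs S.H_pos.le
    have h2 := mul_pos S.H_pos S.κ₀_pos
    linarith
  refine (main T hj le_rfl).trans ?_
  have h0 := S.len_nonneg t (j := j) hab.le
  have hp : 0 ≤ ∏ i ∈ Finset.Ico j T, S.D (S.X t i y) :=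
    Finset.prod_nonneg fun i _ => by linarith [S.one_le (S.X t i y)]
  gcongr

variable {t}

/-- Expansion and distortion on the pullback of a ball of radius `1 / 2` at a good time. -/
lemma Good.bounds {δ κ c : ℝ} {n m₁ m : ℕ} {u : ℝ} (h : S.Good t δ κ n m₁ m u) (hκ : 0 < κ)
    (hn : ∀ (T : ℕ) (a b : ℝ), a < b → S.len t (T + n) a b ≤ 1 → S.len t T a b < κ)
    (hm₁ : ∀ (T : ℕ) (a b : ℝ), m₁ ≤ T → a < b → S.len t T a b ≤ 1 → S.len t 0 a b * c ≤ κ)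
    {y : ℝ} (hy : |S.X t m y - S.X t m u| ≤ 1 / 2) :
    c ≤ ∏ i ∈ Finset.Ico 0 m, S.D (S.X t i y) ∧
      ∑ j ∈ Finset.range m, (1 / ∏ i ∈ Finset.Ico j m, S.D (S.X t i y)) ^ α ≤ n + S.κ₀ / κ ^ α := by
  obtain ⟨T, rfl, hT, -, a, b, hau, hub, hκa, hκb, hl1, hsum, hreg⟩ := h
  have hα := S.α_pos
  have hab := hau.trans hub
  have hy' := abs_le.1 hy
  -- A point within 1 / 2 of u at time T + n was within κ of it at time T, and u has room κ on both
  -- sides inside [a, b].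
  have hyI : y ∈ Ico a b := by
    constructor
    · by_contra! hlt
      have h1 := hn T y u (hlt.trans hau) (by simp only [len]; linarith)
      have h2 := S.len_mono t (j := T) hlt.le (le_refl u)
      linarith
    · by_contra! hlt
      have h1 := hn T u y (hub.trans_le hlt) (by simp only [len]; linarith)
      have h2 := S.len_mono t (j := T) (le_refl u) hlt
      linarith
  have h2κ : 2 * κ ≤ S.len t T a b := by
    rw [← S.len_add t T a u b]; linarith
  have hone : ∀ i k, 1 ≤ ∏ i ∈ Finset.Ico i k, S.D (S.X t i y) := fun i k =>
    Finset.prod_induction _ (fun x : ℝ => 1 ≤ x) (fun _ _ => one_le_mul_of_one_le_of_one_le) le_rfl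
      fun i _ => S.one_le _
  have hsplit : ∀ j ≤ T, ∏ i ∈ Finset.Ico j T, S.D (S.X t i y) ≤
      ∏ i ∈ Finset.Ico j (T + n), S.D (S.X t i y) := fun j hj => by
    rw [← Finset.prod_Ico_consecutive _ hj (Nat.le_add_right T n)]
    exact le_mul_of_one_le_right (by linarith [hone j T]) (hone _ _)
  have hlow : ∀ j ≤ T, κ ≤ S.len t j a b * ∏ i ∈ Finset.Ico j (T + n), S.D (S.X t i y) := by
    intro j hj
    have h1 := S.len_le_prod t hab hsum.le hreg hyI hj
    have h2 := mul_le_mul_of_nonneg_left (hsplit j hj) (S.len_nonneg t (j := j) hab.le)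
    linarith
  constructor
  · have h1 := hlow 0 (Nat.zero_le _)
    have h2 := hm₁ T a b hT hab hl1.le
    exact le_of_mul_le_mul_left (h2.trans h1) (S.len_pos t hab)
  · rw [← Finset.sum_range_add_sum_Ico _ (Nat.le_add_right T n), add_comm]
    refine add_le_add ?_ ?_
    · calc _ ≤ ∑ j ∈ Finset.Ico T (T + n), (1 : ℝ) := Finset.sum_le_sum fun j _ => by
            have := hone j (T + n)
            refine Real.rpow_le_one (by positivity) ?_ hα.le
            rw [div_le_one (by linarith)]; exact this
        _ = n := by simp
    · calc _ ≤ ∑ j ∈ Finset.range T, S.len t j a b ^ α / κ ^ α := Finset.sum_le_sum fun j hj => by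
            have h1 := hlow j (Finset.mem_range.1 hj).le
            have h2 := hone j (T + n)
            rw [← Real.div_rpow (S.len_nonneg t hab.le) hκ.le]
            refine Real.rpow_le_rpow (by positivity) ?_ hα.le
            rw [div_le_div_iff₀ (by linarith) hκ]; linarith
        _ ≤ _ := by
            rw [← Finset.sum_div]
            exact div_le_div_of_nonneg_right hsum.le (by positivity)

/-- The contribution of an interval whose parts are controlled after a fixed number of steps. -/
lemma windows_fixed {μ : ℝ → ℝ → ℝ} {M γ β κ h : ℝ} (hM : 0 ≤ M) (hγ : 0 ≤ γ) (hβ : β < 1)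
    (hκ : 0 ≤ κ) (hh : 0 < h) (hh1 : h ≤ 1) {T n : ℕ} {a b : ℝ} (hab : a < b)
    (hn : n * (2 * h) ^ α ≤ 2 * S.κ₀ / 3)
    (hμ : ∀ x y z, x ≤ y → y ≤ z → μ x z ≤ μ x y + μ y z)
    (hIH : ∀ x y, S.Pair t x y (T + n) →
      μ x y ≤ M * ((y - x) * (1 + γ * S.len t (T + n) x y ^ (-β))))
    (hprior : ∀ x y, a ≤ x → x ≤ y → y ≤ b → S.len t T x y ≤ h →
      ∑ j ∈ Finset.range T, S.len t j x y ^ α ≤ S.κ₀ / 3)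
    (hreg : ∀ j < T, ∀ q ∈ S.B, q ∉ Ioo (S.X t j a) (S.X t j b))
    (hscale : ∀ x y, a ≤ x → x ≤ y → y ≤ b → y - x ≤ κ * S.len t T x y) :
    μ a b ≤ M * ((b - a) + γ * κ * (2 / (1 - S.χ⁻¹)) * h ^ (-β) * (S.len t T a b + h)) := by
  have hχ : S.χ⁻¹ < 1 := inv_lt_one_of_one_lt₀ S.one_lt_χ
  have hκ₀ := S.κ₀_pos
  obtain ⟨b', hbb', hb'⟩ := S.exists_len_eq t (T + n) b hh.le
  have hsum : ∀ x y, x ≤ y → S.len t (T + n) x y ≤ 2 * h →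
      ∑ j ∈ Finset.Ico T (T + n), S.len t j x y ^ α ≤ 2 * S.κ₀ / 3 := by
    intro x y hxy hle
    calc _ ≤ ∑ j ∈ Finset.Ico T (T + n), (2 * h) ^ α := Finset.sum_le_sum fun j hj =>
          Real.rpow_le_rpow (S.len_nonneg t hxy)
            ((S.len_le_of_le t (Finset.mem_Ico.1 hj).2.le hxy).trans hle) S.α_pos.le
      _ = n * (2 * h) ^ α := by simp
      _ ≤ _ := hn
  refine (S.windows t hM hγ hβ hκ hh (Nat.le_add_right T n) hab hbb' hb'
    (fun x y _ hxy _ hle => (hsum x y hxy hle).trans (by linarith)) ⟨hμ, ?_, hscale⟩).trans ?_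
  · intro x y hx hxy hy hle hreg'
    refine hIH x y ⟨hxy, hle.trans hh1, ?_, fun j hj q hq hq' => ?_⟩
    · rw [← Finset.sum_range_add_sum_Ico _ (Nat.le_add_right T n)]
      have e1 := hprior x y hx hxy.le hy
        ((S.len_le_of_le t (Nat.le_add_right T n) hxy.le).trans hle)
      have e2 := hsum x y hxy.le (by linarith)
      linarith
    · by_cases hjT : j < T
      · exact hreg j hjT q hq ⟨((S.X_le t).2 hx).trans_lt hq'.1, hq'.2.trans_le ((S.X_le t).2 hy)⟩
      · exact hreg' j (Finset.mem_Ico.2 ⟨by omega, hj⟩) q hq hq'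
  · have h1 := S.len_le_of_le t (Nat.le_add_right T n) hbb'
    have h2 := S.len_add t T a b b'
    have h3 : 0 < 1 - S.χ⁻¹ := by linarith
    have : S.len t T a b' ≤ S.len t T a b + h := by linarith
    gcongr

/-- A long smooth interval contains a definite proportion of points for which the time `T + n` is
good. -/
lemma macro_cycle {δ η h γ β M : ℝ} {n m₁ T : ℕ} {a b : ℝ} (hδ : 0 < δ) (hδ1 : δ ≤ 1)
    (hη : 0 < η) (hω : S.Pair t a b T) (hηL : η ≤ S.len t T a b) (hm₁ : m₁ ≤ T) (hT : 1 ≤ T)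
    (hn : ∀ a b, a < b → η / 3 ≤ S.len t T a b → 1 < S.len t (T + n) a b)
    (hh : 0 < h) (hh1 : h ≤ 1) (hhη : h ≤ η) (hhn : n * (2 * h) ^ α ≤ 2 * S.κ₀ / 3)
    (hhη' : (2 * h / η) ^ α ≤ 1 / 3) (hM : 0 ≤ M) (hγ : 0 ≤ γ) (hβ : β < 1) {μ : ℝ → ℝ → ℝ}
    (hμ : ∀ x y z, x ≤ y → y ≤ z → μ x z ≤ μ x y + μ y z)
    (hgood : ∀ x y, x ≤ y → (∀ u ∈ Icc x y, S.Good t δ (η / 7) n m₁ (T + n) u) → μ x y ≤ 0)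
    (hIH : ∀ x y, S.Pair t x y (T + n) →
      μ x y ≤ M * ((y - x) * (1 + γ * S.len t (T + n) x y ^ (-β)))) :
    μ a b ≤ M * ((b - a) * (1 - δ / (4 * S.Λ ^ n) +
      γ * (8 * (2 / (1 - S.χ⁻¹)) * h ^ (-β)))) := by
  have hα := S.α_pos
  have hΛ := S.one_le_Λ
  have hχ : S.χ⁻¹ < 1 := inv_lt_one_of_one_lt₀ S.one_lt_χ
  have hab := hω.lt
  have hL := S.len_pos t (j := T) hab
  set L := S.len t T a b with hLdef
  obtain ⟨a₁, ha₁⟩ := S.X_surjective t T (S.X t T a + L / 3)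
  obtain ⟨b₁, hb₁⟩ := S.X_surjective t T (S.X t T b - L / 3)
  -- The interval witnessing goodness is slightly smaller than [a, b], so that the conditions in
  -- `Good` are strict. Points of the middle third keep a margin L / 3 - η / 21 > η / 7 on either
  -- side.
  obtain ⟨a', ha'⟩ := S.X_surjective t T (S.X t T a + η / 21)
  obtain ⟨b', hb'⟩ := S.X_surjective t T (S.X t T b - η / 21)
  have hLX : S.X t T b - S.X t T a = L := rfl
  have hab₁ : a₁ < b₁ := (S.X_lt t (n := T)).1 (by rw [ha₁, hb₁]; linarith)
  have haa' : a < a' := (S.X_lt t (n := T)).1 (by rw [ha']; linarith)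
  have hbb' : b' < b := (S.X_lt t (n := T)).1 (by rw [hb']; linarith)
  have ha'a₁ : a' < a₁ := (S.X_lt t (n := T)).1 (by rw [ha', ha₁]; linarith)
  have hb₁b' : b₁ < b' := (S.X_lt t (n := T)).1 (by rw [hb₁, hb']; linarith)
  have hlong := hn a₁ b₁ hab₁ (by rw [len, ha₁, hb₁]; linarith)
  -- At time T + n the middle third is longer than 1, so it contains a fixed point and, on one side
  -- of it, an interval of length δ / 2.
  obtain ⟨x, y, hx, hxy, hy, hlen, c, hc, hcxy⟩ : ∃ x y, a₁ ≤ x ∧ x < y ∧ y ≤ b₁ ∧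
      S.len t (T + n) x y = δ / 2 ∧ ∃ c ∈ S.Q, ∀ u ∈ Icc x y, |S.X t (T + n) u - c| < δ := by
    obtain ⟨c, hc, hc1, hc2⟩ := S.exists_Q_mem (S.X t (T + n) a₁)
    simp only [len] at hlong
    obtain ⟨p, hp⟩ := S.X_surjective t (T + n) c
    by_cases hcase : c + δ / 2 ≤ S.X t (T + n) b₁
    · obtain ⟨y, hy⟩ := S.X_surjective t (T + n) (c + δ / 2)
      refine ⟨p, y, (S.X_le t (n := T + n)).1 (by rw [hp]; exact hc1),
        (S.X_lt t (n := T + n)).1 (by rw [hp, hy]; linarith),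
        (S.X_le t (n := T + n)).1 (by rw [hy]; exact hcase), by rw [len, hp, hy]; ring,
        c, hc, fun u hu => ?_⟩
      have h1 := (S.X_le t (n := T + n)).2 hu.1
      have h2 := (S.X_le t (n := T + n)).2 hu.2
      rw [abs_lt]; constructor <;> linarith
    · obtain ⟨y, hy⟩ := S.X_surjective t (T + n) (c - δ / 2)
      refine ⟨y, p, (S.X_le t (n := T + n)).1 (by rw [hy]; linarith),
        (S.X_lt t (n := T + n)).1 (by rw [hp, hy]; linarith),
        (S.X_le t (n := T + n)).1 (by rw [hp]; linarith), by rw [len, hp, hy]; ring,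
        c, hc, fun u hu => ?_⟩
      have h1 := (S.X_le t (n := T + n)).2 hu.1
      have h2 := (S.X_le t (n := T + n)).2 hu.2
      rw [abs_lt]; constructor <;> linarith
  have hxa : a < x := by linarith
  have hyb : y < b := by linarith
  have hxyμ : μ x y ≤ 0 := by
    refine hgood x y hxy.le fun u hu => ⟨T, rfl, hm₁, ⟨c, hc, hcxy u hu⟩, a', b',
      by linarith [hu.1], by linarith [hu.2], ?_, ?_, ?_, ?_, fun j hj q hq hq' => ?_⟩
    · have := (S.X_le t (n := T)).2 (hx.trans hu.1)
      rw [len]; linarith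
    · have := (S.X_le t (n := T)).2 (hu.2.trans hy)
      rw [len]; linarith
    · have := hω.len_le
      rw [len]; linarith
    · refine lt_of_lt_of_le (Finset.sum_lt_sum_of_nonempty ⟨0, by simp; omega⟩ fun j _ => ?_)
        hω.sum_le
      refine Real.rpow_lt_rpow (S.len_nonneg t (by linarith)) ?_ hα
      have h1 := (S.X_lt t (n := j)).2 haa'
      have h2 := (S.X_lt t (n := j)).2 hbb'
      simp only [len]; linarith
    · exact hω.regular j hj q hq ⟨((S.X_lt t).2 haa').trans_le hq'.1,
        hq'.2.trans_lt ((S.X_lt t).2 hbb')⟩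
  -- the proportion
  have hprop : (b - a) * (δ / (4 * S.Λ ^ n)) ≤ y - x := by
    have h1 := (S.ratio t (Nat.zero_le T) hxa.le hxy.le hyb.le
      (fun j hj => S.len_le_g t hab.le hω.sum_le (by simpa using hj))
      (fun j hj => hω.regular j (by simpa using hj))).1
    rw [← Finset.range_eq_Ico] at h1
    have hexp : Real.exp (2 * S.H * ∑ i ∈ Finset.range T, S.len t i a b ^ α) ≤ 2 :=
      (Real.exp_le_exp.2 (mul_le_mul_of_nonneg_left hω.sum_le (by linarith [S.H_pos]))).trans
        S.exp_κ₀_le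
    have h2 : S.len t T x y * (b - a) ≤ 2 * (1 * (y - x)) := by
      refine h1.trans ?_
      simp only [len_zero]
      have h3 : 0 ≤ y - x := by linarith
      have := hω.len_le
      gcongr
    have h4 := S.len_add_le t T n hxy.le
    rw [hlen] at h4
    have h5 : δ / (2 * S.Λ ^ n) ≤ S.len t T x y := by
      rw [div_le_iff₀ (by positivity)]; linarith
    have h6 := mul_le_mul_of_nonneg_right h5 (show 0 ≤ b - a by linarith)
    have h7 : (b - a) * (δ / (4 * S.Λ ^ n)) = δ / (2 * S.Λ ^ n) * (b - a) / 2 := by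
      field_simp; ring
    rw [h7]; linarith
  -- the remaining pieces
  have rest : ∀ x' y', a ≤ x' → x' < y' → y' ≤ b → μ x' y' ≤ M * ((y' - x') +
      (b - a) * (γ * (4 * (2 / (1 - S.χ⁻¹)) * h ^ (-β)))) := by
    intro x' y' hx' hxy' hy'
    have hκ0 : 0 ≤ 2 * (b - a) / L := div_nonneg (by linarith) hL.le
    have h1 := S.windows_fixed (t := t) (n := n) hM hγ hβ hκ0 hh hh1 hxy' hhn hμ hIH
      (fun p q hp hpq hq hle => by
        refine (hω.sum_sub_le S (hx'.trans hp) hpq (hq.trans hy')).trans ?_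
        have h2 : (2 * S.len t T p q / L) ^ α ≤ 1 / 3 := by
          refine le_trans (Real.rpow_le_rpow (div_nonneg ?_ hL.le) ?_ hα.le) hhη'
          · linarith [S.len_nonneg t (j := T) hpq]
          · gcongr
        nlinarith [S.κ₀_pos])
      (fun j hj q hq hq' => hω.regular j hj q hq ⟨((S.X_le t).2 hx').trans_lt hq'.1,
        hq'.2.trans_le ((S.X_le t).2 hy')⟩)
      (fun p q hp hpq hq => hω.sub_le S (hx'.trans hp) hpq (hq.trans hy'))
    refine h1.trans (mul_le_mul_of_nonneg_left (add_le_add_right ?_ _) hM)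
    have h3 := S.len_mono t (j := T) hx' hy'
    have h4 : 0 < 1 - S.χ⁻¹ := by linarith
    have h5 : S.len t T x' y' + h ≤ 2 * L := by linarith
    have h6 : 0 ≤ b - a := by linarith
    calc _ ≤ γ * (2 * (b - a) / L) * (2 / (1 - S.χ⁻¹)) * h ^ (-β) * (2 * L) := by gcongr
      _ = _ := by field_simp; ring
  have e1 := hμ a x b hxa.le (by linarith)
  have e2 := hμ x y b hxy.le hyb.le
  have e3 := rest a x le_rfl hxa (by linarith)
  have e4 := rest y b (by linarith) hyb le_rfl
  have e5 := mul_le_mul_of_nonneg_left hprop hM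
  linarith

end LiftSystem
namespace LiftSystem
variable {α : ℝ} (S : LiftSystem α)

/-! ### The tail of the first good time -/

/-- The points without good times up to `N`. -/
def Bad (t : ℕ → ℝ) (δ κ : ℝ) (n m₁ N : ℕ) : Set ℝ := {u | ∀ m ≤ N, ¬ S.Good t δ κ n m₁ m u}

lemma toReal_volume_inter_subadd (A : Set ℝ) (x y z : ℝ) (hxy : x ≤ y) (hyz : y ≤ z) :
    (volume (Icc x z ∩ A)).toReal ≤
      (volume (Icc x y ∩ A)).toReal + (volume (Icc y z ∩ A)).toReal := by
  have hfin : ∀ u v, volume (Icc u v ∩ A) ≠ ∞ := fun u v =>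
    measure_ne_top_of_subset inter_subset_left (by simp)
  rw [← ENNReal.toReal_add (hfin _ _) (hfin _ _)]
  refine ENNReal.toReal_mono (ENNReal.add_ne_top.2 ⟨hfin _ _, hfin _ _⟩) ?_
  rw [← Icc_union_Icc_eq_Icc hxy hyz, union_inter_distrib_right]
  exact measure_union_le _ _

lemma toReal_volume_inter_le (A : Set ℝ) (x y : ℝ) (hxy : x ≤ y) :
    (volume (Icc x y ∩ A)).toReal ≤ y - x := by
  have h := measure_mono (μ := volume) (inter_subset_left : Icc x y ∩ A ⊆ Icc x y)
  rw [Real.volume_Icc] at h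
  exact ENNReal.toReal_le_of_le_ofReal (by linarith) h

set_option maxHeartbeats 4000000 in
/-- The points of the unit interval without good times up to `N` have polynomially small measure. -/
lemma exists_tail {q : ℝ} (hq : 0 < q) (hβ : α * q < 1) (lam : ℝ) :
    ∃ δ₀ > (0 : ℝ), ∀ δ, 0 < δ → δ < δ₀ → ∃ ε₀ > 0, ∃ κ > 0, ∃ n m₁ : ℕ, 1 ≤ m₁ ∧ ∃ C > 0,
      (∀ (t : ℕ → ℝ) (T : ℕ) (a b : ℝ), a < b → S.len t (T + n) a b ≤ 1 → S.len t T a b < κ) ∧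
      (∀ (t : ℕ → ℝ) (T : ℕ) (a b : ℝ), m₁ ≤ T → a < b → S.len t T a b ≤ 1 →
        S.len t 0 a b * lam ≤ κ) ∧
      ∀ t : ℕ → ℝ, (∀ i, |t i| ≤ ε₀) → ∀ N : ℕ, 1 ≤ N →
        volume (Icc 0 1 ∩ S.Bad t δ κ n m₁ N) ≤ ENNReal.ofReal (C * (N : ℝ) ^ (-q)) := by
  have hα := S.α_pos
  have hΛ := S.one_le_Λ
  have hκ := S.κ₀_pos
  have hχ : S.χ⁻¹ < 1 := inv_lt_one_of_one_lt₀ S.one_lt_χ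
  have hβ0 : 0 < α * q := by positivity
  obtain ⟨δ₀, hδ₀, hsmall⟩ := S.exists_small_cycle hβ0 hβ
  set β := α * q with hβdef
  obtain ⟨Cg, hCg, hgrow⟩ := S.exists_len_le
  set Cχ := 2 / (1 - S.χ⁻¹) with hCχ
  have hCχ0 : 0 < Cχ := div_pos two_pos (by linarith)
  refine ⟨min 1 δ₀, by positivity, fun δ hδ hδ' => ?_⟩
  obtain ⟨hδ1, hδ2⟩ := lt_min_iff.1 hδ'
  obtain ⟨ε₀, hε₀, η₀, hη₀, hη₀1, k, b₁, hb₁, Cs, hCs, hcycle⟩ := hsmall δ hδ hδ2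
  -- Below this threshold the constant b₁ of the short cycle is at most L ^ (-β) / 8, leaving 5 / 8
  -- of the weight.
  set η := min η₀ ((8 * b₁ + 1) ^ (-1 / β)) with hη
  have hη0 : 0 < η := by positivity
  have hηβ : 8 * b₁ ≤ η ^ (-β) := by
    have h1 : η ≤ (8 * b₁ + 1) ^ (-1 / β) := min_le_right _ _
    have h2 := Real.rpow_le_rpow_of_nonpos hη0 h1 (neg_nonpos.2 hβ0.le)
    rw [← Real.rpow_mul (by positivity), show -1 / β * -β = 1 by field_simp, Real.rpow_one] at h2
    linarith
  have htend : Tendsto (fun n : ℕ => Cg * (n : ℝ) ^ (-1 / α)) atTop (𝓝 0) := by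
    have h1 := (tendsto_rpow_neg_atTop (show 0 < 1 / α from one_div_pos.2 hα)).comp
      tendsto_natCast_atTop_atTop
    have h2 := h1.const_mul Cg
    rw [mul_zero] at h2
    rw [neg_div]; exact h2
  have hlen : ∀ κ > 0, ∀ l : ℝ, 0 ≤ l → ∃ m : ℕ, 1 ≤ m ∧ ∀ m' ≥ m, ∀ (t : ℕ → ℝ) (T : ℕ) (a b : ℝ),
      a < b → S.len t (T + m') a b ≤ 1 → S.len t T a b * l < κ := by
    intro κ hκ l hl
    have h3 := htend.mul_const l
    rw [zero_mul] at h3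
    obtain ⟨m, hm⟩ := eventually_atTop.1 ((h3.eventually_lt_const hκ).and (eventually_ge_atTop 1))
    refine ⟨m, (hm m le_rfl).2, fun m' hm' t T a b hab hl1 => ?_⟩
    obtain ⟨h4, h5⟩ := hm m' hm'
    exact (mul_le_mul_of_nonneg_right (hgrow t T m' a b h5 hab hl1) hl).trans_lt h4
  obtain ⟨n₁, hn₁1, hn₁⟩ := S.exists_one_lt_len (l := η / 3) (by positivity)
  obtain ⟨n₂, hn₂1, hn₂⟩ := hlen (η / 7) (by positivity) 1 zero_le_one
  set n := max n₁ n₂ with hn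
  obtain ⟨m₁, hm₁1, hm₁⟩ := hlen (η / 7) (by positivity) |lam| (abs_nonneg _)
  -- The same h serves for the n steps of a long cycle and for the initial m₁ steps.
  set h := min (min 1 η) (min (1 / 2 * (2 * S.κ₀ / 3 / (n + m₁ : ℕ)) ^ (1 / α))
    (η / 2 * (1 / 3) ^ (1 / α))) with hh
  have hn1 : 1 ≤ n := hn₁1.trans (le_max_left _ _)
  have hnm : (0 : ℝ) < (n + m₁ : ℕ) := by exact_mod_cast (by omega)
  have hh0 : 0 < h := by positivity
  have hh1 : h ≤ 1 := (min_le_left _ _).trans (min_le_left _ _)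
  have hhη : h ≤ η := (min_le_left _ _).trans (min_le_right _ _)
  have hhnm : (n + m₁ : ℕ) * (2 * h) ^ α ≤ 2 * S.κ₀ / 3 := by
    have h1 : h ≤ 1 / 2 * (2 * S.κ₀ / 3 / (n + m₁ : ℕ)) ^ (1 / α) :=
      (min_le_right _ _).trans (min_le_left _ _)
    have h2 := Real.rpow_le_rpow (by positivity)
      (show 2 * h ≤ (2 * S.κ₀ / 3 / (n + m₁ : ℕ)) ^ (1 / α) by linarith) hα.le
    rw [← Real.rpow_mul (by positivity), one_div_mul_cancel hα.ne', Real.rpow_one,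
      le_div_iff₀ hnm] at h2
    linarith
  have h2h : 0 ≤ (2 * h) ^ α := by positivity
  have hhn : n * (2 * h) ^ α ≤ 2 * S.κ₀ / 3 := by
    refine le_trans ?_ hhnm
    push_cast
    have : (0 : ℝ) ≤ m₁ := by positivity
    nlinarith
  have hhm : m₁ * (2 * h) ^ α ≤ 2 * S.κ₀ / 3 := by
    refine le_trans ?_ hhnm
    push_cast
    have : (0 : ℝ) ≤ n := by positivity
    nlinarith
  have hhη' : (2 * h / η) ^ α ≤ 1 / 3 := by
    have h1 : h ≤ η / 2 * (1 / 3) ^ (1 / α) := (min_le_right _ _).trans (min_le_right _ _)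
    have h2 : 2 * h / η ≤ (1 / 3) ^ (1 / α) := by
      rw [div_le_iff₀ hη0]; linarith
    have h3 := Real.rpow_le_rpow (by positivity) h2 hα.le
    rwa [← Real.rpow_mul (by norm_num), one_div_mul_cancel hα.ne', Real.rpow_one] at h3
  set c := δ / (4 * S.Λ ^ n) with hc
  have hc0 : 0 < c := by positivity
  have hc1 : c ≤ 1 := by
    rw [hc, div_le_one (by positivity)]
    have : 1 ≤ S.Λ ^ n := one_le_pow₀ hΛ
    linarith
  set b₂ := 8 * Cχ * h ^ (-β) with hb₂
  have hb₂0 : 0 < b₂ := by positivity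
  -- In a long cycle a proportion c becomes good and cutting costs γ b₂, here c / 2.
  set γ := c / (2 * b₂) with hγ
  have hγ0 : 0 < γ := by positivity
  have hγb : γ * b₂ = c / 2 := by rw [hγ]; field_simp
  set s₀ := γ * η ^ (-β) with hs₀
  have hs₀0 : 0 < s₀ := by positivity
  -- The contraction factor of both kinds of cycle. For short intervals x = γ L ^ (-β) is at least
  -- s₀ and 1 + 5x/8 ≤ (1 - 3 s₀ / (8 (1 + s₀))) (1 + x).
  set θ := max (1 - c / 2) (1 - 3 * s₀ / (8 * (1 + s₀))) with hθ
  have hθ1 : θ < 1 := max_lt (by linarith) (by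
    have : 0 < 3 * s₀ / (8 * (1 + s₀)) := by positivity
    linarith)
  have hθ0 : 0 < θ := lt_max_of_lt_left (by linarith)
  -- A cycle may leave only the fraction r of the time, which worsens the bound by r ^ (-q); with
  -- this r, θ r ^ (-q) = (1 + θ) / 2 < 1.
  set r := (2 * θ / (1 + θ)) ^ (1 / q) with hr
  have hr0 : 0 < r := by positivity
  have hr1 : r < 1 := Real.rpow_lt_one (by positivity) (by rw [div_lt_one (by linarith)]; linarith)
    (by positivity)
  have hθr : θ * r ^ (-q) = (1 + θ) / 2 := by
    rw [hr, ← Real.rpow_mul (by positivity), show 1 / q * -q = -1 by field_simp,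
      Real.rpow_neg_one]
    field_simp
  set ρ := 1 - r with hρ
  have hρ0 : 0 < ρ := by linarith
  set C₅ := max Cs 1 / γ with hC₅
  have hC₅0 : 0 < C₅ := by positivity
  set n₀ := ⌈((k + n + 2 : ℕ) : ℝ) / ρ⌉₊ + 1 with hn₀
  -- The first term makes the claim trivial for N < n₀; the second lets the slack (1 - θ) / 2 absorb
  -- the loss of a cycle.
  set C₄ := max ((n₀ : ℝ) ^ q) (2 / (1 - θ) * (C₅ * (ρ / 2) ^ (-q))) with hC₄
  have hC₄0 : 0 < C₄ := lt_max_of_lt_left (by positivity)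
  -- Strong induction on N. A cycle started at time T hands over pieces at times T' ≤ T + N', with
  -- N' about ρN; at least rN steps remain, and the induction hypothesis applies to every piece with
  -- the same end T + N.
  have claim : ∀ t : ℕ → ℝ, (∀ i, |t i| ≤ ε₀) → ∀ N : ℕ, 1 ≤ N → ∀ T, m₁ ≤ T → ∀ a b,
      S.Pair t a b T → (volume (Icc a b ∩ S.Bad t δ (η / 7) n m₁ (T + N))).toReal ≤
        C₄ * (N : ℝ) ^ (-q) * ((b - a) * (1 + γ * S.len t T a b ^ (-β))) := by
    intro t ht N
    induction N using Nat.strong_induction_on with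
    | _ N ih =>
    intro hN T hT a b hω
    have hNpos : (0 : ℝ) < N := by exact_mod_cast hN
    have hba : 0 < b - a := by linarith [hω.lt]
    have hL := S.len_pos t (j := T) hω.lt
    have htriv := toReal_volume_inter_le (S.Bad t δ (η / 7) n m₁ (T + N)) a b hω.lt.le
    set μ : ℝ → ℝ → ℝ := fun x y => (volume (Icc x y ∩ S.Bad t δ (η / 7) n m₁ (T + N))).toReal
      with hμ
    change μ a b ≤ b - a at htriv
    change μ a b ≤ _
    set L := S.len t T a b with hLdef
    have hLβ : 0 < L ^ (-β) := by positivity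
    set v := 1 + γ * L ^ (-β) with hv
    have hγL : 0 < γ * L ^ (-β) := by positivity
    have hv1 : 1 ≤ v := by linarith
    by_cases hNn : N < n₀
    · have h1 : 1 ≤ C₄ * (N : ℝ) ^ (-q) := by
        rw [Real.rpow_neg hNpos.le, ← div_eq_mul_inv, one_le_div (by positivity)]
        refine le_trans ?_ (le_max_left _ _)
        exact Real.rpow_le_rpow hNpos.le (by exact_mod_cast hNn.le) hq.le
      have h2 : 1 * ((b - a) * 1) ≤ C₄ * (N : ℝ) ^ (-q) * ((b - a) * v) := by gcongr
      linarith
    push Not at hNn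
    have hρN : ((k + n + 2 : ℕ) : ℝ) ≤ ρ * N := by
      have h1 : ((k + n + 2 : ℕ) : ℝ) / ρ ≤ N := by
        refine (Nat.le_ceil _).trans ?_
        exact_mod_cast (by omega : ⌈((k + n + 2 : ℕ) : ℝ) / ρ⌉₊ ≤ N)
      rw [div_le_iff₀ hρ0] at h1
      linarith
    set N' := ⌊ρ * N⌋₊ with hN'
    have hN'1 : (N' : ℝ) ≤ ρ * N := Nat.floor_le (by positivity)
    have hN'2 : k + n + 2 ≤ N' := Nat.le_floor hρN
    have hN'3 : ρ / 2 * N ≤ N' := by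
      have := Nat.lt_floor_add_one (ρ * N)
      push_cast at hρN
      have h3 : (0 : ℝ) ≤ k := by positivity
      have h4 : (0 : ℝ) ≤ n := by positivity
      linarith
    have hN'N : N' < N := by
      have : (N' : ℝ) < N := by nlinarith
      exact_mod_cast this
    have hrN : r * N ≤ ((N - N' : ℕ) : ℝ) := by
      rw [Nat.cast_sub hN'N.le]; linarith
    set M := C₄ * ((N - N' : ℕ) : ℝ) ^ (-q) with hM
    have hM0 : 0 ≤ M := by positivity
    have hMle : M ≤ C₄ * (r ^ (-q) * (N : ℝ) ^ (-q)) := by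
      rw [← Real.mul_rpow hr0.le hNpos.le]
      refine mul_le_mul_of_nonneg_left ?_ hC₄0.le
      exact Real.rpow_le_rpow_of_nonpos (by positivity) hrN (by linarith)
    have hIH : ∀ T', T < T' → T' ≤ T + N' → ∀ x y, S.Pair t x y T' →
        μ x y ≤ M * ((y - x) * (1 + γ * S.len t T' x y ^ (-β))) := by
      intro T' h1 h2 x y hxy
      have h3 := ih (N - (T' - T)) (by omega) (by omega) T' (by omega) x y hxy
      rw [show T' + (N - (T' - T)) = T + N by omega] at h3
      refine h3.trans (mul_le_mul_of_nonneg_right (mul_le_mul_of_nonneg_left ?_ hC₄0.le) ?_)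
      · refine Real.rpow_le_rpow_of_nonpos ?_ ?_ (by linarith)
        · exact_mod_cast (by omega)
        · exact_mod_cast (by omega)
      · have h4 := S.len_nonneg t (j := T') hxy.lt.le
        have h5 : 0 ≤ y - x := by linarith [hxy.lt]
        positivity
    have main : μ a b ≤ θ * v * (M * (b - a)) + (b - a) * v * (C₅ * (N' : ℝ) ^ (-q)) := by
      have hN'pos : (0 : ℝ) < N' := by exact_mod_cast (by omega)
      have herr : 0 ≤ (b - a) * v * (C₅ * (N' : ℝ) ^ (-q)) := by positivity
      rcases le_total η L with hηL | hηL
      · have key := S.macro_cycle (t := t) (δ := δ) (η := η) (h := h) (γ := γ) (β := β) (M := M)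
          (n := n) (m₁ := m₁) hδ hδ1.le hη0 hω hηL hT
          (by omega) (fun a b hab hle => by
            have h1 := hn₁ t T a b hab hle
            exact h1.trans_le (S.len_le_of_le t (by omega) hab.le))
          hh0 hh1 hhη hhn hhη' hM0 hγ0.le hβ (μ := μ)
          (toReal_volume_inter_subadd _)
          (fun x y _ hgood => by
            have : Icc x y ∩ S.Bad t δ (η / 7) n m₁ (T + N) = ∅ := by
              rw [eq_empty_iff_forall_notMem]
              exact fun u hu => hu.2 (T + n) (by omega) (hgood u hu.1)
            simp only [hμ]
            rw [this]; simp) (hIH _ (by omega) (by omega))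
        rw [← hc, ← hCχ, ← hb₂, hγb] at key
        have h1 : 1 - c / 2 ≤ θ := le_max_left _ _
        have h2 : (1 - c + c / 2) ≤ θ * v := by
          have := mul_le_mul_of_nonneg_left hv1 hθ0.le
          linarith
        have h3 := mul_le_mul_of_nonneg_left h2 (mul_nonneg hM0 hba.le)
        linarith
      -- With Y = L N' ^ (1/α), the loss L⁻¹ N' ^ (-1/α) is Y⁻¹ and the allowed error L ^ (-β) N' ^
      -- (-q) is Y ^ (-β). For Y ≥ 1 the former is smaller as β < 1; for Y < 1 the latter exceeds 1
      -- and the trivial bound b - a suffices.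
      · by_cases hLN : 1 ≤ L * (N' : ℝ) ^ (1 / α)
        · have key := hcycle t ht μ (toReal_volume_inter_subadd _) (toReal_volume_inter_le _) M γ
            hM0 hγ0.le T N' (by omega) hIH a b hω (hηL.trans (min_le_left _ _))
          refine key.trans (add_le_add ?_ ?_)
          · have h1 : η ^ (-β) ≤ L ^ (-β) :=
              Real.rpow_le_rpow_of_nonpos hL hηL (by linarith)
            have h2 : 1 - 3 * s₀ / (8 * (1 + s₀)) ≤ θ := le_max_right _ _
            have h3 : 1 + γ * (b₁ + 1 / 2 * L ^ (-β)) ≤ θ * v := by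
              have h4 := mul_le_mul_of_nonneg_right h2 (by linarith : 0 ≤ v)
              refine le_trans ?_ h4
              have h5 : s₀ ≤ γ * L ^ (-β) := mul_le_mul_of_nonneg_left h1 hγ0.le
              have h6 : γ * b₁ ≤ γ * (L ^ (-β) / 8) :=
                mul_le_mul_of_nonneg_left (by linarith) hγ0.le
              have h7 : 3 * s₀ / (8 * (1 + s₀)) * v ≤ 3 / 8 * (γ * L ^ (-β)) := by
                rw [div_mul_eq_mul_div, div_le_iff₀ (by positivity), hv]
                linarith
              linarith
            have h8 := mul_le_mul_of_nonneg_left h3 (mul_nonneg hM0 hba.le)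
            linarith
          · have h1 : L⁻¹ * (N' : ℝ) ^ (-1 / α) ≤ L ^ (-β) * (N' : ℝ) ^ (-q) := by
              have e1 : L⁻¹ * (N' : ℝ) ^ (-1 / α) = (L * (N' : ℝ) ^ (1 / α)) ^ (-1 : ℝ) := by
                rw [Real.mul_rpow hL.le (by positivity), Real.rpow_neg_one, ← Real.rpow_mul hN'pos.le]
                congr 2; ring
              have e2 : L ^ (-β) * (N' : ℝ) ^ (-q) = (L * (N' : ℝ) ^ (1 / α)) ^ (-β) := by
                rw [Real.mul_rpow hL.le (by positivity), ← Real.rpow_mul hN'pos.le]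
                congr 2; rw [hβdef]; field_simp
              rw [e1, e2]
              exact Real.rpow_le_rpow_of_exponent_le hLN (by linarith)
            have h2 : Cs ≤ C₅ * γ := by
              rw [hC₅, div_mul_cancel₀ _ hγ0.ne']; exact le_max_left _ _
            have h3 : γ * L ^ (-β) ≤ v := by linarith
            calc (b - a) * Cs * L⁻¹ * (N' : ℝ) ^ (-1 / α)
                = (b - a) * Cs * (L⁻¹ * (N' : ℝ) ^ (-1 / α)) := by ring
              _ ≤ (b - a) * (C₅ * γ) * (L ^ (-β) * (N' : ℝ) ^ (-q)) := by gcongr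
              _ = (b - a) * (γ * L ^ (-β)) * (C₅ * (N' : ℝ) ^ (-q)) := by ring
              _ ≤ _ := by gcongr
        · push Not at hLN
          have h1 : 1 ≤ L ^ (-β) * (N' : ℝ) ^ (-q) := by
            have e2 : L ^ (-β) * (N' : ℝ) ^ (-q) = (L * (N' : ℝ) ^ (1 / α)) ^ (-β) := by
              rw [Real.mul_rpow hL.le (by positivity), ← Real.rpow_mul hN'pos.le]
              congr 2; rw [hβdef]; field_simp
            rw [e2]
            exact Real.one_le_rpow_of_pos_of_le_one_of_nonpos (by positivity) hLN.le (by linarith)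
          have h2 : 1 ≤ C₅ * γ := by
            rw [hC₅, div_mul_cancel₀ _ hγ0.ne']; exact le_max_right _ _
          have h3 : γ * L ^ (-β) ≤ v := by linarith
          have h4 : (b - a) * 1 * 1 ≤ (b - a) * v * (C₅ * (N' : ℝ) ^ (-q)) := by
            calc (b - a) * 1 * 1 ≤ (b - a) * (C₅ * γ) * (L ^ (-β) * (N' : ℝ) ^ (-q)) := by gcongr
              _ = (b - a) * (γ * L ^ (-β)) * (C₅ * (N' : ℝ) ^ (-q)) := by ring
              _ ≤ _ := by gcongr
          have h5 : 0 ≤ θ * v * (M * (b - a)) := by positivity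
          linarith
    have hN'q : (N' : ℝ) ^ (-q) ≤ (ρ / 2) ^ (-q) * (N : ℝ) ^ (-q) := by
      rw [← Real.mul_rpow (by positivity) hNpos.le]
      exact Real.rpow_le_rpow_of_nonpos (by positivity) hN'3 (by linarith)
    have hC₄2 : C₅ * (ρ / 2) ^ (-q) ≤ C₄ * ((1 - θ) / 2) := by
      have h1 : 2 / (1 - θ) * (C₅ * (ρ / 2) ^ (-q)) ≤ C₄ := le_max_right _ _
      have h2 : 0 < 1 - θ := by linarith
      calc C₅ * (ρ / 2) ^ (-q) = (2 / (1 - θ) * (C₅ * (ρ / 2) ^ (-q))) * ((1 - θ) / 2) := by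
            field_simp
        _ ≤ _ := mul_le_mul_of_nonneg_right h1 (by linarith)
    have hNq : 0 < (N : ℝ) ^ (-q) := by positivity
    calc μ a b ≤ θ * v * (M * (b - a)) + (b - a) * v * (C₅ * (N' : ℝ) ^ (-q)) := main
      _ ≤ θ * v * (C₄ * (r ^ (-q) * (N : ℝ) ^ (-q)) * (b - a)) +
          (b - a) * v * (C₅ * ((ρ / 2) ^ (-q) * (N : ℝ) ^ (-q))) := by gcongr
      _ = (b - a) * v * (N : ℝ) ^ (-q) * (C₄ * (θ * r ^ (-q)) + C₅ * (ρ / 2) ^ (-q)) := by ring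
      _ ≤ (b - a) * v * (N : ℝ) ^ (-q) * (C₄ * ((1 + θ) / 2) + C₄ * ((1 - θ) / 2)) := by
          rw [hθr]; gcongr
      _ = _ := by ring
  refine ⟨ε₀, hε₀, η / 7, by positivity, n, m₁, hm₁1,
    (2 * m₁ : ℝ) ^ q + C₄ * 2 ^ q * (1 + γ * Cχ * h ^ (-β) * 2), by positivity, ?_, ?_, ?_⟩
  · intro t T a b hab hle
    have := hn₂ n (le_max_right _ _) t T a b hab hle
    rwa [mul_one] at this
  · intro t T a b hT hab hle
    have h1 := hm₁ T hT t 0 a b hab (by rwa [zero_add])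
    refine le_trans ?_ h1.le
    exact mul_le_mul_of_nonneg_left (le_abs_self _) (S.len_nonneg t hab.le)
  · intro t ht N hN
    have hNpos : (0 : ℝ) < N := by exact_mod_cast hN
    have hfin : volume (Icc 0 1 ∩ S.Bad t δ (η / 7) n m₁ N) ≠ ∞ :=
      measure_ne_top_of_subset inter_subset_left (by simp)
    rw [← ENNReal.ofReal_toReal hfin]
    refine ENNReal.ofReal_le_ofReal ?_
    have hm₁pos : (0 : ℝ) < m₁ := by exact_mod_cast hm₁1
    have hNq : 0 < (N : ℝ) ^ (-q) := by positivity
    by_cases hNm : N < 2 * m₁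
    · have h1 : 1 ≤ (2 * m₁ : ℝ) ^ q * (N : ℝ) ^ (-q) := by
        rw [Real.rpow_neg hNpos.le, ← div_eq_mul_inv, one_le_div (by positivity)]
        exact Real.rpow_le_rpow hNpos.le (by exact_mod_cast hNm.le) hq.le
      have h2 := toReal_volume_inter_le (S.Bad t δ (η / 7) n m₁ N) 0 1 zero_le_one
      have h3 : 0 ≤ C₄ * 2 ^ q * (1 + γ * Cχ * h ^ (-β) * 2) * (N : ℝ) ^ (-q) := by positivity
      rw [add_mul]; linarith
    · push Not at hNm
      have hpos2 : (0 : ℝ) < (N - m₁ : ℕ) := by exact_mod_cast (by omega)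
      -- The claim only concerns times T ≥ m₁, so the unit interval is run for m₁ steps and cut into
      -- windows before it is used.
      have key := S.windows_fixed (t := t) (μ := fun x y =>
        (volume (Icc x y ∩ S.Bad t δ (η / 7) n m₁ N)).toReal) (M := C₄ * ((N - m₁ : ℕ) : ℝ) ^ (-q))
        (γ := γ) (β := β) (κ := 1) (h := h) (T := 0) (n := m₁) (a := 0) (b := 1) (by positivity)
        hγ0.le hβ zero_le_one hh0 hh1 one_pos hhm (toReal_volume_inter_subadd _)
        (fun x y hxy => by
          have h1 := claim t ht (N - m₁) (by omega) m₁ le_rfl x y (by simpa using hxy)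
          rw [show m₁ + (N - m₁) = N by omega] at h1
          rw [zero_add]
          exact h1)
        (fun x y _ _ _ _ => by simp; positivity) (by simp) (fun x y _ _ _ => by simp)
      refine key.trans ?_
      have h1 : ((N - m₁ : ℕ) : ℝ) ^ (-q) ≤ 2 ^ q * (N : ℝ) ^ (-q) := by
        have h2 : (2 : ℝ) ^ q = (1 / 2) ^ (-q) := by
          rw [one_div, Real.inv_rpow (by norm_num), Real.rpow_neg (by norm_num), inv_inv]
        rw [h2, ← Real.mul_rpow (by norm_num) hNpos.le]
        refine Real.rpow_le_rpow_of_nonpos (by positivity) ?_ (by linarith)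
        rw [Nat.cast_sub (by omega)]
        have : (2 * m₁ : ℝ) ≤ N := by exact_mod_cast hNm
        linarith
      have h3 : 0 ≤ (2 * m₁ : ℝ) ^ q * (N : ℝ) ^ (-q) := by positivity
      rw [← hCχ]
      simp only [len_zero, sub_zero, mul_one]
      have h4 : 0 < h ^ (-β) := by positivity
      calc _ ≤ C₄ * (2 ^ q * (N : ℝ) ^ (-q)) * (1 + γ * Cχ * h ^ (-β) * 2) := by
            gcongr; linarith
        _ ≤ _ := by rw [add_mul]; linarith

end LiftSystem

/-! ### One-sided derivatives on the line -/

lemma coe_eq_coe_iff {u v : ℝ} : ((u : ℝ) : Circ) = (v : Circ) ↔ ∃ n : ℤ, v = u + n := by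
  rw [eq_comm, ← sub_eq_zero, ← AddCircle.coe_sub, AddCircle.coe_eq_zero_iff]
  refine exists_congr fun n => ?_
  rw [zsmul_eq_mul, mul_one, eq_sub_iff_add_eq', eq_comm]

lemma disp_eq {g : Circ → Circ} {G : ℝ → ℝ} (hG : ∀ u : ℝ, ((G u : ℝ) : Circ) = g (u : Circ))
    {u h : ℝ} (hh : |G (u + h) - G u| < 1 / 2) : disp g (u : Circ) h = G (u + h) - G u := by
  rw [disp, ← AddCircle.coe_add, ← hG, ← hG, ← AddCircle.coe_sub]
  have := abs_lt.1 hh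
  exact AddCircle.equivIoc_coe_of_mem ⟨by linarith, by linarith⟩

section lift
variable {g : Circ → Circ} {G : ℝ → ℝ} (hc : Continuous G)
  (hG : ∀ u : ℝ, ((G u : ℝ) : Circ) = g (u : Circ)) (u : ℝ)
include hc hG

lemma disp_eventuallyEq : disp g (u : Circ) =ᶠ[𝓝 0] fun h => G (u + h) - G u := by
  have h1 : Tendsto (fun h => G (u + h) - G u) (𝓝 0) (𝓝 0) := by
    have : Continuous fun h => G (u + h) - G u := by fun_prop
    simpa using this.tendsto 0
  filter_upwards [h1.eventually (Metric.ball_mem_nhds 0 (show (0 : ℝ) < 1 / 2 by norm_num))] with h hh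
  exact disp_eq hG (by simpa using hh)

lemma derivWithin_disp (s : Set ℝ) :
    derivWithin (disp g (u : Circ)) s 0 = derivWithin G ((fun h => u + h) '' s) u := by
  have e := disp_eventuallyEq hc hG u
  rw [(e.filter_mono nhdsWithin_le_nhds).derivWithin_eq e.eq_of_nhds,
    derivWithin_sub_const, derivWithin_comp_const_add, add_zero]
  rfl

lemma rightDeriv_coe : rightDeriv g (u : Circ) = derivWithin G (Ioi u) u := by
  rw [rightDeriv, derivWithin_disp hc hG]; simp

lemma leftDeriv_coe : leftDeriv g (u : Circ) = derivWithin G (Iio u) u := by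
  rw [leftDeriv, derivWithin_disp hc hG]; simp

lemma differentiableAt_of_disp (h : DifferentiableAt ℝ (disp g (u : Circ)) 0) :
    DifferentiableAt ℝ G u := by
  rw [(disp_eventuallyEq hc hG u).differentiableAt_iff] at h
  have h1 : DifferentiableAt ℝ (fun x => (fun h => G (u + h) - G u) (x - u) + G u) u := by
    refine DifferentiableAt.add_const _ ?_
    refine DifferentiableAt.comp (g := fun h => G (u + h) - G u) (f := fun x => x - u) u ?_ (by fun_prop)
    simpa using h
  refine h1.congr_of_eventuallyEq (Eventually.of_forall fun x => ?_)
  simp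

end lift

/-- `derivWithin` is 0 where there is no derivative, so the bounds Df ≥ 1 contain the existence of
the one-sided derivatives. -/
lemma hasDerivWithinAt_of_ne_zero {F : ℝ → ℝ} {s : Set ℝ} {u : ℝ} (h : derivWithin F s u ≠ 0) :
    HasDerivWithinAt F (derivWithin F s u) s u := by
  by_contra hcon
  exact h (derivWithin_zero_of_not_differentiableWithinAt fun hd => hcon hd.hasDerivWithinAt)

/-- A function with one-sided derivatives `D` and `L` that is differentiable outside `Z`, with
Hölder derivative on the intervals that do not meet `Z`. -/
structure PiecewiseHolder (F D L : ℝ → ℝ) (Z : Set ℝ) (H α : ℝ) : Prop where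
  cont : Continuous F
  α_pos : 0 < α
  H_nonneg : 0 ≤ H
  right : ∀ u, HasDerivWithinAt F (D u) (Ioi u) u
  left : ∀ u, HasDerivWithinAt F (L u) (Iio u) u
  deriv : ∀ u ∉ Z, HasDerivAt F (D u) u
  holder : ∀ u v, (∀ w ∈ uIcc u v, w ∉ Z) → |D u - D v| ≤ H * |u - v| ^ α

section discrete
variable {Z : Set ℝ} {g : ℝ} (hg : ∀ z ∈ Z, ∀ z' ∈ Z, |z - z'| ≤ g → z = z') (hg0 : 0 < g) (u : ℝ)
include hg hg0

lemma eventually_notMem_right : ∀ᶠ z in 𝓝[>] u, ∀ w ∈ Ioc u z, w ∉ Z := by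
  by_cases hex : ∃ p ∈ Z, p ∈ Ioc u (u + g)
  · obtain ⟨p, hp, hpI⟩ := hex
    filter_upwards [Ioo_mem_nhdsGT hpI.1] with z hz w hw hwZ
    have := hg w hwZ p hp (by rw [abs_le]; constructor <;> linarith [hw.1, hw.2, hz.2, hpI.2])
    linarith [hw.2, hz.2]
  · push Not at hex
    filter_upwards [Ioo_mem_nhdsGT (show u < u + g by linarith)] with z hz w hw hwZ
    exact hex w hwZ ⟨hw.1, hw.2.trans hz.2.le⟩

lemma eventually_notMem_left : ∀ᶠ z in 𝓝[<] u, ∀ w ∈ Ico z u, w ∉ Z := by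
  by_cases hex : ∃ p ∈ Z, p ∈ Ico (u - g) u
  · obtain ⟨p, hp, hpI⟩ := hex
    filter_upwards [Ioo_mem_nhdsLT hpI.2] with z hz w hw hwZ
    have := hg w hwZ p hp (by rw [abs_le]; constructor <;> linarith [hw.1, hw.2, hz.1, hpI.1])
    linarith [hw.1, hz.1]
  · push Not at hex
    filter_upwards [Ioo_mem_nhdsLT (show u - g < u by linarith)] with z hz w hw hwZ
    exact hex w hwZ ⟨hz.1.le.trans hw.1, hw.2⟩

end discrete

namespace PiecewiseHolder
variable {F D L : ℝ → ℝ} {Z : Set ℝ} {H α : ℝ} (h : PiecewiseHolder F D L Z H α)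
include h

lemma slope_mem {a b m M : ℝ} (hab : a < b) (hZ : ∀ x ∈ Ioo a b, x ∉ Z)
    (hD : ∀ x ∈ Ioo a b, m ≤ D x ∧ D x ≤ M) : m ≤ slope F a b ∧ slope F a b ≤ M := by
  have hdiff : DifferentiableOn ℝ F (interior (Icc a b)) := by
    rw [interior_Icc]
    exact fun x hx => (h.deriv x (hZ x hx)).differentiableAt.differentiableWithinAt
  have hba : 0 < b - a := by linarith
  rw [slope_def_field, le_div_iff₀ hba, div_le_iff₀ hba]
  constructor
  · refine (convex_Icc a b).mul_sub_le_image_sub_of_le_deriv h.cont.continuousOn hdiff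
      (fun x hx => ?_) a (left_mem_Icc.2 hab.le) b (right_mem_Icc.2 hab.le) hab.le
    rw [interior_Icc] at hx
    rw [(h.deriv x (hZ x hx)).deriv]
    exact (hD x hx).1
  · refine (convex_Icc a b).image_sub_le_mul_sub_of_deriv_le h.cont.continuousOn hdiff
      (fun x hx => ?_) a (left_mem_Icc.2 hab.le) b (right_mem_Icc.2 hab.le) hab.le
    rw [interior_Icc] at hx
    rw [(h.deriv x (hZ x hx)).deriv]
    exact (hD x hx).2

/-- The left end a may belong to Z. Slopes over [a, y] are controlled by the Hölder bound in the
interior, and D a is their limit as y decreases to a. -/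
lemma abs_right_sub_le {a x : ℝ} (hax : a < x) (hZ : ∀ w ∈ Ioc a x, w ∉ Z) :
    |D a - D x| ≤ H * (x - a) ^ α := by
  have hsl : ∀ y ∈ Ioo a x, D x - H * (x - a) ^ α ≤ slope F a y ∧
      slope F a y ≤ D x + H * (x - a) ^ α := fun y hy =>
    h.slope_mem hy.1 (fun w hw => hZ w ⟨hw.1, (hw.2.trans hy.2).le⟩) fun w hw => by
      have hwx := hw.2.trans hy.2
      have h1 := h.holder w x fun z hz => by
        rw [uIcc_of_le hwx.le] at hz
        exact hZ z ⟨hw.1.trans_le hz.1, hz.2⟩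
      have h2 : H * |w - x| ^ α ≤ H * (x - a) ^ α :=
        mul_le_mul_of_nonneg_left (Real.rpow_le_rpow (abs_nonneg _)
          (by rw [abs_of_nonpos (by linarith)]; linarith [hw.1]) h.α_pos.le) h.H_nonneg
      have h3 := abs_le.1 (h1.trans h2)
      constructor <;> linarith
  have ht := (hasDerivWithinAt_iff_tendsto_slope' self_notMem_Ioi).1 (h.right a)
  have hev : ∀ᶠ y in 𝓝[>] a, y ∈ Ioo a x := Ioo_mem_nhdsGT hax
  have e1 := ge_of_tendsto ht (hev.mono fun y hy => (hsl y hy).1)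
  have e2 := le_of_tendsto ht (hev.mono fun y hy => (hsl y hy).2)
  rw [abs_le]; constructor <;> linarith

lemma abs_left_sub_le {x b : ℝ} (hxb : x < b) (hZ : ∀ w ∈ Ico x b, w ∉ Z) :
    |L b - D x| ≤ H * (b - x) ^ α := by
  have hsl : ∀ y ∈ Ioo x b, D x - H * (b - x) ^ α ≤ slope F b y ∧
      slope F b y ≤ D x + H * (b - x) ^ α := fun y hy => by
    rw [slope_comm]
    exact h.slope_mem hy.2 (fun w hw => hZ w ⟨(hy.1.trans hw.1).le, hw.2⟩) fun w hw => by
      have hwx := hy.1.trans hw.1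
      have h1 := h.holder x w fun z hz => by
        rw [uIcc_of_le hwx.le] at hz
        exact hZ z ⟨hz.1, hz.2.trans_lt hw.2⟩
      have h2 : H * |x - w| ^ α ≤ H * (b - x) ^ α :=
        mul_le_mul_of_nonneg_left (Real.rpow_le_rpow (abs_nonneg _)
          (by rw [abs_of_nonpos (by linarith)]; linarith [hw.2]) h.α_pos.le) h.H_nonneg
      have h3 := abs_le.1 (h1.trans h2)
      constructor <;> linarith
  have ht := (hasDerivWithinAt_iff_tendsto_slope' self_notMem_Iio).1 (h.left b)
  have hev : ∀ᶠ y in 𝓝[<] b, y ∈ Ioo x b := Ioo_mem_nhdsLT hxb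
  have e1 := ge_of_tendsto ht (hev.mono fun y hy => (hsl y hy).1)
  have e2 := le_of_tendsto ht (hev.mono fun y hy => (hsl y hy).2)
  rw [abs_le]; constructor <;> linarith

lemma abs_right_sub_left_le {a b : ℝ} (hab : a < b) (hZ : ∀ w ∈ Ioo a b, w ∉ Z) :
    |D a - L b| ≤ 2 * H * (b - a) ^ α := by
  have e1 := h.abs_right_sub_le (x := (a + b) / 2) (by linarith) fun w hw =>
    hZ w ⟨hw.1, by linarith [hw.2]⟩
  have e2 := h.abs_left_sub_le (x := (a + b) / 2) (b := b) (by linarith) fun w hw =>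
    hZ w ⟨by linarith [hw.1], hw.2⟩
  have hle : ∀ z, 0 ≤ z → z ≤ b - a → H * z ^ α ≤ H * (b - a) ^ α := fun z hz hz' =>
    mul_le_mul_of_nonneg_left (Real.rpow_le_rpow hz hz' h.α_pos.le) h.H_nonneg
  have e3 := hle ((a + b) / 2 - a) (by linarith) (by linarith)
  have e4 := hle (b - (a + b) / 2) (by linarith) (by linarith)
  have := abs_le.1 e1
  have := abs_le.1 e2
  rw [abs_le]; constructor <;> linarith

variable {g : ℝ} (hg : ∀ z ∈ Z, ∀ z' ∈ Z, |z - z'| ≤ g → z = z') (hLD : ∀ u, D u ≤ L u)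
include hg

/-- Two points at a small distance between which there is a point of `Z`. -/
lemma abs_sub_le_of_mem {u v p : ℝ} (hp : p ∈ Z) (hup : u < p) (hpv : p ≤ v) (hvg : v - u ≤ g) :
    |D u - L p| ≤ 2 * H * (v - u) ^ α ∧ |D p - D v| ≤ H * (v - u) ^ α := by
  have hsep : ∀ w ∈ Z, w ∈ Icc u v → w = p := fun w hw hwI => hg w hw p hp (by
    rw [abs_le]; constructor <;> linarith [hwI.1, hwI.2])
  have hle : ∀ z, 0 ≤ z → z ≤ v - u → H * z ^ α ≤ H * (v - u) ^ α := fun z hz hz' =>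
    mul_le_mul_of_nonneg_left (Real.rpow_le_rpow hz hz' h.α_pos.le) h.H_nonneg
  constructor
  · have e1 := h.abs_right_sub_left_le hup fun w hw hwZ =>
      hw.2.ne (hsep w hwZ ⟨hw.1.le, hw.2.le.trans hpv⟩)
    have e2 := hle (p - u) (by linarith) (by linarith)
    linarith
  · rcases hpv.eq_or_lt with rfl | hpv
    · simpa using hle 0 le_rfl (by linarith) |>.trans' (by
        rw [Real.zero_rpow h.α_pos.ne', mul_zero])
    · have e1 := h.abs_right_sub_le hpv fun w hw hwZ =>
        hw.1.ne' (hsep w hwZ ⟨by linarith [hw.1], hw.2⟩)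
      exact e1.trans (hle _ (by linarith) (by linarith))

/-- At a point p of Z with equal one-sided derivatives, the estimates up to p, with 2H, and from p
on, with H, are joined. There is at most one such point at scale g. -/
lemma holder_of_notMem {u v : ℝ} (huv : u ≤ v) (hvg : v - u ≤ g)
    (hB : ∀ x ∈ Ioc u v, x ∈ Z → L x = D x) : |D u - D v| ≤ 3 * H * (v - u) ^ α := by
  have hp0 : 0 ≤ H * (v - u) ^ α := mul_nonneg h.H_nonneg (Real.rpow_nonneg (by linarith) _)
  rcases huv.eq_or_lt with rfl | huv
  · rw [sub_self (D u), abs_zero]; linarith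
  by_cases hex : ∃ p ∈ Z, p ∈ Ioc u v
  · obtain ⟨p, hp, hpI⟩ := hex
    obtain ⟨e1, e2⟩ := h.abs_sub_le_of_mem hg hp hpI.1 hpI.2 hvg
    rw [hB p hpI hp] at e1
    have := abs_le.1 e1
    have := abs_le.1 e2
    rw [abs_le]; constructor <;> linarith
  · push Not at hex
    have := h.abs_right_sub_le huv fun w hw hwZ => hex w hwZ hw
    linarith

include hLD

lemma upper {u v : ℝ} (huv : u ≤ v) (hvg : v - u ≤ g) : D v ≤ D u + 3 * H * (v - u) ^ α := by
  have hp0 : 0 ≤ H * (v - u) ^ α := mul_nonneg h.H_nonneg (Real.rpow_nonneg (by linarith) _)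
  rcases huv.eq_or_lt with rfl | huv
  · linarith
  by_cases hex : ∃ p ∈ Z, p ∈ Ioc u v
  · obtain ⟨p, hp, hpI⟩ := hex
    obtain ⟨e1, e2⟩ := h.abs_sub_le_of_mem hg hp hpI.1 hpI.2 hvg
    have := abs_le.1 e1
    have := abs_le.1 e2
    linarith [hLD p]
  · push Not at hex
    have := abs_le.1 (h.abs_right_sub_le huv fun w hw hwZ => hex w hwZ hw)
    linarith

omit hLD in
lemma jump {χ : ℝ} (hχ : 0 ≤ χ) {u v p : ℝ} (hp : p ∈ Z) (hup : u < p) (hpv : p ≤ v)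
    (hvg : v - u ≤ g) (hpχ : χ * D p ≤ L p) : χ * D v ≤ D u + (2 + χ) * H * (v - u) ^ α := by
  obtain ⟨e1, e2⟩ := h.abs_sub_le_of_mem hg hp hup hpv hvg
  have := abs_le.1 e1
  have e3 := mul_le_mul_of_nonneg_left (show D v ≤ D p + H * (v - u) ^ α by
    linarith [(abs_le.1 e2).1]) hχ
  linarith

/-- The right derivative is bounded on bounded intervals. -/
lemma le_add_mul (hg0 : 0 < g) (n : ℕ) {u v : ℝ} (huv : u ≤ v) (hv : v ≤ u + n * g) :
    D v ≤ D u + n * (3 * H * g ^ α) := by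
  induction n generalizing v with
  | zero =>
    have : v = u := le_antisymm (by simpa using hv) huv
    simp [this]
  | succ n ih =>
    push_cast at hv ⊢
    have hp0 : 0 ≤ H * g ^ α := mul_nonneg h.H_nonneg (Real.rpow_nonneg hg0.le _)
    set w := max u (v - g) with hw
    have hwv : w ≤ v := max_le huv (by linarith)
    have e1 := ih (v := w) (le_max_left _ _) (max_le (by nlinarith [n.cast_nonneg (α := ℝ)]) (by linarith))
    have hwg : v - w ≤ g := by linarith [le_max_right u (v - g)]
    have e2 := h.upper hg hLD hwv hwg
    have e3 : 3 * H * (v - w) ^ α ≤ 3 * H * g ^ α :=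
      mul_le_mul_of_nonneg_left (Real.rpow_le_rpow (by linarith) hwg h.α_pos.le)
        (by linarith [h.H_nonneg])
    linarith

/-- The right derivative is bounded below near a point by numbers below its value there. -/
lemma lowerSemicontinuousAt (hg0 : 0 < g) (u : ℝ) : LowerSemicontinuousAt D u := by
  intro y hy
  have hα := h.α_pos
  have ht : Tendsto (fun z : ℝ => 3 * H * |z - u| ^ α) (𝓝 u) (𝓝 0) := by
    have : Continuous fun z : ℝ => 3 * H * |z - u| ^ α :=
      continuous_const.mul (Continuous.rpow_const (by fun_prop) fun _ => Or.inr hα.le)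
    have h1 := this.tendsto u
    simpa [Real.zero_rpow hα.ne'] using h1
  have hnear : ∀ᶠ z in 𝓝 u, |z - u| < g := by
    have := Metric.ball_mem_nhds u hg0
    filter_upwards [this] with z hz using by simpa [Real.dist_eq] using hz
  have hr := eventually_nhdsWithin_iff.1 (eventually_notMem_right hg hg0 u)
  filter_upwards [ht.eventually_lt_const (sub_pos.2 hy), hnear, hr] with z hz hzg hzr
  -- To the left of u, derivatives can only be larger up to the Hölder error; to the right, D is
  -- continuous.
  rcases le_or_gt z u with hzu | hzu
  · rw [abs_of_nonpos (by linarith)] at hz hzg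
    have := h.upper hg hLD hzu (by linarith)
    rw [show u - z = -(z - u) by ring] at this
    linarith
  · have h1 := (abs_le.1 (h.abs_right_sub_le hzu (hzr hzu))).2
    rw [abs_of_pos (by linarith)] at hz
    have hp0 : 0 ≤ H * (z - u) ^ α := mul_nonneg h.H_nonneg (Real.rpow_nonneg (by linarith) _)
    linarith

end PiecewiseHolder

/-! ### Local behaviour at the fixed points -/

namespace PiecewiseHolder
variable {F D L : ℝ → ℝ} {Z : Set ℝ} {H α : ℝ} (h : PiecewiseHolder F D L Z H α)
  {g : ℝ} (hg : ∀ z ∈ Z, ∀ z' ∈ Z, |z - z'| ≤ g → z = z') (hg0 : 0 < g)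
include h hg hg0

/-- The number s is at once the radius, the lower constant and the inverse of the upper constant. As
all small s are admissible, one s serves for both sides of all fixed points. -/
lemma eventually_right {c β A A' : ℝ} (hβ : 0 ≤ β) (hA : 0 < A) (hA' : 0 < A')
    (hev : ∀ᶠ z in 𝓝[>] (0 : ℝ), 1 + A * z ^ β ≤ D (c + z) ∧ D (c + z) ≤ 1 + A' * z ^ β) :
    ∀ᶠ s in 𝓝[>] (0 : ℝ), (∀ z, 0 < z → z < s → 1 + s * z ^ β ≤ D (c + z)) ∧
      ∀ z, 0 < z → z < s → F (c + z) - F c ≤ z * (1 + s⁻¹ * z ^ β) := by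
  have hZ : ∀ᶠ z in 𝓝[>] (0 : ℝ), ∀ w ∈ Ioc c (c + z), w ∉ Z := by
    have h1 := eventually_notMem_right hg hg0 c
    have h2 : Tendsto (fun z => c + z) (𝓝[>] (0 : ℝ)) (𝓝[>] c) := by
      refine tendsto_nhdsWithin_iff.2 ⟨?_, ?_⟩
      · have : Continuous fun z : ℝ => c + z := by fun_prop
        simpa using (this.tendsto 0).mono_left nhdsWithin_le_nhds
      · filter_upwards [self_mem_nhdsWithin] with z hz
        simpa using hz
    exact h2.eventually h1
  obtain ⟨ρ, hρ, hρ'⟩ := mem_nhdsGT_iff_exists_Ioo_subset.1 (hev.and hZ)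
  filter_upwards [Ioo_mem_nhdsGT (show (0 : ℝ) < min ρ (min A (1 / A')) by
    have : 0 < ρ := hρ
    positivity)] with s hs
  obtain ⟨hs0, hs'⟩ := hs
  simp only [lt_min_iff] at hs'
  obtain ⟨hsρ, hsA, hsA'⟩ := hs'
  refine ⟨fun z hz hzs => ?_, fun z hz hzs => ?_⟩
  · have h1 := (hρ' ⟨hz, hzs.trans hsρ⟩).1.1
    have h2 : 0 ≤ z ^ β := Real.rpow_nonneg hz.le _
    nlinarith
  · have h1 := (h.slope_mem (a := c) (b := c + z) (m := D c ⊓ 1) (M := 1 + A' * z ^ β) (by linarith)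
      (fun w hw => (hρ' ⟨hz, hzs.trans hsρ⟩).2 w ⟨hw.1, hw.2.le⟩) (fun w hw => ?_)).2
    · rw [slope_def_field, div_le_iff₀ (by linarith)] at h1
      rw [add_sub_cancel_left] at h1
      have h2 : A' ≤ s⁻¹ := by
        rw [le_inv_comm₀ hA' hs0, ← one_div]; exact hsA'.le
      have h3 : 0 ≤ z ^ β := Real.rpow_nonneg hz.le _
      have h4 := mul_le_mul_of_nonneg_right h2 h3
      nlinarith
    · have h2 := (hρ' (show w - c ∈ Ioo 0 ρ from ⟨by linarith [hw.1], by linarith [hw.2]⟩)).1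
      rw [add_sub_cancel] at h2
      have h3 : (w - c) ^ β ≤ z ^ β := Real.rpow_le_rpow (by linarith [hw.1]) (by linarith [hw.2]) hβ
      have h4 : 0 ≤ (w - c) ^ β := Real.rpow_nonneg (by linarith [hw.1]) _
      refine ⟨inf_le_right.trans ?_, ?_⟩ <;> nlinarith [h2.1, h2.2]

lemma eventually_left {c β A A' : ℝ} (hβ : 0 ≤ β) (hA : 0 < A) (hA' : 0 < A')
    (hev : ∀ᶠ z in 𝓝[>] (0 : ℝ), 1 + A * z ^ β ≤ D (c - z) ∧ D (c - z) ≤ 1 + A' * z ^ β) :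
    ∀ᶠ s in 𝓝[>] (0 : ℝ), (∀ z, 0 < z → z < s → 1 + s * z ^ β ≤ D (c - z)) ∧
      ∀ z, 0 < z → z < s → F c - F (c - z) ≤ z * (1 + s⁻¹ * z ^ β) := by
  have hZ : ∀ᶠ z in 𝓝[>] (0 : ℝ), ∀ w ∈ Ico (c - z) c, w ∉ Z := by
    have h1 := eventually_notMem_left hg hg0 c
    have h2 : Tendsto (fun z => c - z) (𝓝[>] (0 : ℝ)) (𝓝[<] c) := by
      refine tendsto_nhdsWithin_iff.2 ⟨?_, ?_⟩
      · have : Continuous fun z : ℝ => c - z := by fun_prop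
        simpa using (this.tendsto 0).mono_left nhdsWithin_le_nhds
      · filter_upwards [self_mem_nhdsWithin] with z hz
        simpa using hz
    exact h2.eventually h1
  obtain ⟨ρ, hρ, hρ'⟩ := mem_nhdsGT_iff_exists_Ioo_subset.1 (hev.and hZ)
  filter_upwards [Ioo_mem_nhdsGT (show (0 : ℝ) < min ρ (min A (1 / A')) by
    have : 0 < ρ := hρ
    positivity)] with s hs
  obtain ⟨hs0, hs'⟩ := hs
  simp only [lt_min_iff] at hs'
  obtain ⟨hsρ, hsA, hsA'⟩ := hs'
  refine ⟨fun z hz hzs => ?_, fun z hz hzs => ?_⟩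
  · have h1 := (hρ' ⟨hz, hzs.trans hsρ⟩).1.1
    have h2 : 0 ≤ z ^ β := Real.rpow_nonneg hz.le _
    nlinarith
  · have h1 := (h.slope_mem (a := c - z) (b := c) (m := 1) (M := 1 + A' * z ^ β) (by linarith)
      (fun w hw => (hρ' ⟨hz, hzs.trans hsρ⟩).2 w ⟨hw.1.le, hw.2⟩) (fun w hw => ?_)).2
    · rw [slope_def_field, div_le_iff₀ (by linarith)] at h1
      rw [sub_sub_cancel] at h1
      have h2 : A' ≤ s⁻¹ := by
        rw [le_inv_comm₀ hA' hs0, ← one_div]; exact hsA'.le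
      have h3 : 0 ≤ z ^ β := Real.rpow_nonneg hz.le _
      have h4 := mul_le_mul_of_nonneg_right h2 h3
      nlinarith
    · have h2 := (hρ' (show c - w ∈ Ioo 0 ρ from ⟨by linarith [hw.2], by linarith [hw.1]⟩)).1
      rw [sub_sub_cancel] at h2
      have h3 : (c - w) ^ β ≤ z ^ β := Real.rpow_le_rpow (by linarith [hw.2]) (by linarith [hw.1]) hβ
      have h4 : 0 ≤ (c - w) ^ β := Real.rpow_nonneg (by linarith [hw.2]) _
      constructor <;> nlinarith [h2.1, h2.2]

lemma eventually_lt_left {y b : ℝ} (hy : y < L b) : ∀ᶠ x in 𝓝[<] b, y < D x := by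
  have hα := h.α_pos
  have ht : Tendsto (fun x : ℝ => H * |b - x| ^ α) (𝓝[<] b) (𝓝 0) := by
    have : Continuous fun z : ℝ => H * |b - z| ^ α :=
      continuous_const.mul (Continuous.rpow_const (by fun_prop) fun _ => Or.inr hα.le)
    have h1 := this.tendsto b
    simp only [sub_self, abs_zero, Real.zero_rpow hα.ne', mul_zero] at h1
    exact h1.mono_left nhdsWithin_le_nhds
  filter_upwards [ht.eventually_lt_const (sub_pos.2 hy), eventually_notMem_left hg hg0 b,
    self_mem_nhdsWithin] with x hx hxZ hxb
  have hxb : x < b := hxb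
  have h1 := (abs_le.1 (h.abs_left_sub_le hxb hxZ)).2
  rw [abs_of_pos (by linarith)] at hx
  linarith

end PiecewiseHolder

/-! ### From a map of class 𝓔_α to a lifted system -/

lemma dist_coe_le (u v : ℝ) : dist (u : Circ) (v : Circ) ≤ |u - v| := by
  rw [dist_eq_norm, ← AddCircle.coe_sub, UnitAddCircle.norm_eq]
  simpa using round_le (u - v) 0

lemma dist_coe_eq {u v : ℝ} (h : |u - v| ≤ 1 / 2) : dist (u : Circ) (v : Circ) = |u - v| := by
  rw [dist_eq_norm, ← AddCircle.coe_sub]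
  exact (AddCircle.norm_coe_eq_abs_iff 1 one_ne_zero).2 (by simpa using h)

/-- The lifts of the points of a finite set are separated. -/
lemma exists_separation {A : Set Circ} (hA : A.Finite) :
    ∃ r > 0, ∀ u v : ℝ, (u : Circ) ∈ A → (v : Circ) ∈ A → u ≠ v → r ≤ |u - v| := by
  obtain ⟨r, hr, h⟩ := hA.relatively_discrete
  have hr1 : min r 1 ≠ ∞ := ne_top_of_le_ne_top ENNReal.one_ne_top (min_le_right _ _)
  refine ⟨(min r 1).toReal, ENNReal.toReal_pos (by simp [hr.ne']) hr1, fun u v hu hv huv => ?_⟩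
  by_cases huv' : (u : Circ) = v
  · obtain ⟨n, rfl⟩ := coe_eq_coe_iff.1 huv'
    refine (ENNReal.toReal_mono ENNReal.one_ne_top (min_le_right _ _)).trans ?_
    rw [ENNReal.toReal_one, sub_add_cancel_left, abs_neg, ← Int.cast_abs]
    have : n ≠ 0 := by rintro rfl; simp at huv
    exact_mod_cast Int.one_le_abs this
  · refine le_trans ?_ (dist_coe_le u v)
    rw [dist_edist]
    exact ENNReal.toReal_mono (edist_ne_top _ _) ((min_le_left _ _).trans (h _ hu _ hv huv'))

lemma lift_add_one {f : Circ → Circ} {F : ℝ → ℝ} (hc : Continuous F)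
    (hF : ∀ u : ℝ, ((F u : ℝ) : Circ) = f (u : Circ)) : ∃ d : ℤ, ∀ u, F (u + 1) = F u + d := by
  have hint : ∀ u, ∃ n : ℤ, F (u + 1) - F u = n := fun u => by
    obtain ⟨n, hn⟩ := coe_eq_coe_iff.1 (show ((F u : ℝ) : Circ) = (F (u + 1) : ℝ) by
      rw [hF, hF]; congr 1; exact coe_eq_coe_iff.2 ⟨1, by simp⟩)
    exact ⟨n, by linarith⟩
  choose n hn using hint
  have hcont : Continuous fun u => (n u : ℝ) := by
    have : (fun u => (n u : ℝ)) = fun u => F (u + 1) - F u := funext fun u => (hn u).symm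
    rw [this]; fun_prop
  have hcont' : Continuous n := Int.isClosedEmbedding_coe_real.isInducing.continuous_iff.2 hcont
  refine ⟨n 0, fun u => ?_⟩
  have : n u = n 0 := PreconnectedSpace.constant inferInstance hcont'
  linarith [hn u, this ▸ hn u]

section classE
variable {α : ℝ} {f : Circ → Circ} {P : Set Circ} {N : ℕ} (hf : IsClassE α f P N)
include hf

lemma IsClassE.one_le (x : Circ) : 1 ≤ rightDeriv f x := by
  by_cases hx : x ∈ fixedSet f P N
  · exact (hf.deriv_fixed x hx).2
  · exact (hf.deriv_other x hx).2.le

lemma IsClassE.right_le_left (x : Circ) : rightDeriv f x ≤ leftDeriv f x := by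
  by_cases hx : x ∈ fixedSet f P N
  · exact (hf.deriv_fixed x hx).1
  · exact (hf.deriv_other x hx).1

lemma IsClassE.hasDerivWithinAt_right {F : ℝ → ℝ} (hc : Continuous F)
    (hF : ∀ u : ℝ, ((F u : ℝ) : Circ) = f (u : Circ)) (u : ℝ) :
    HasDerivWithinAt F (rightDeriv f (u : Circ)) (Ioi u) u := by
  have h1 := hf.one_le (u : Circ)
  rw [rightDeriv_coe hc hF] at h1 ⊢
  exact hasDerivWithinAt_of_ne_zero (by linarith)

lemma IsClassE.hasDerivWithinAt_left {F : ℝ → ℝ} (hc : Continuous F)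
    (hF : ∀ u : ℝ, ((F u : ℝ) : Circ) = f (u : Circ)) (u : ℝ) :
    HasDerivWithinAt F (leftDeriv f (u : Circ)) (Iio u) u := by
  have h1 := (hf.one_le (u : Circ)).trans (hf.right_le_left _)
  rw [leftDeriv_coe hc hF] at h1 ⊢
  exact hasDerivWithinAt_of_ne_zero (by linarith)

lemma IsClassE.exists_piecewiseHolder (hα : 0 < α) {F : ℝ → ℝ} (hc : Continuous F)
    (hF : ∀ u : ℝ, ((F u : ℝ) : Circ) = f (u : Circ)) :
    ∃ H, PiecewiseHolder F (fun u => rightDeriv f (u : Circ)) (fun u => leftDeriv f (u : Circ))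
      {u | (u : Circ) ∈ P} H α := by
  obtain ⟨H, hH⟩ := hf.smooth.2
  refine ⟨max H 0, hc, hα, le_max_right _ _, hf.hasDerivWithinAt_right hc hF,
    hf.hasDerivWithinAt_left hc hF, fun u hu => ?_, fun u v huv => ?_⟩
  · have h1 := (differentiableAt_of_disp hc hF u (hf.smooth.1 _ hu)).hasDerivAt
    have h2 := h1.hasDerivWithinAt (s := Ioi u) |>.derivWithin (uniqueDiffWithinAt_Ioi u)
    rw [← rightDeriv_coe hc hF] at h2
    change HasDerivAt F (rightDeriv f (u : Circ)) u
    rwa [h2]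
  · exact (hH u v huv).trans (mul_le_mul_of_nonneg_right (le_max_left _ _)
      (Real.rpow_nonneg (abs_nonneg _) _))

end classE

/-- Behaviour near a point where the derivative is one. -/
lemma exists_bounds_of_neutral {D : ℝ → ℝ} {d : ℝ → ℝ} {α A : ℝ} {l : Filter ℝ} (hA : 0 < A)
    (hd : ∀ᶠ h in l, 0 < d h)
    (ht : Tendsto (fun h => (D h - 1) / d h ^ α) l (𝓝 A)) :
    ∀ᶠ h in l, 1 + A / 2 * d h ^ α ≤ D h ∧ D h ≤ 1 + 2 * A * d h ^ α := by
  filter_upwards [hd, ht.eventually_const_lt (show A / 2 < A by linarith),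
    ht.eventually_lt_const (show A < 2 * A by linarith)] with h h1 h2 h3
  have h4 : 0 < d h ^ α := Real.rpow_pos_of_pos h1 α
  rw [lt_div_iff₀ h4] at h2
  rw [div_lt_iff₀ h4] at h3
  constructor <;> linarith

/-- A map of class `𝓔_α` with nonempty exceptional set gives rise to a lifted system. -/
theorem IsClassE.exists_liftSystem {α : ℝ} (hα : 0 < α) {f : Circ → Circ} {P : Set Circ} {N : ℕ}
    (hf : IsClassE α f P N) (hP : P.Nonempty) :
    ∃ S : LiftSystem α, (∀ u : ℝ, ((S.F u : ℝ) : Circ) = f (u : Circ)) ∧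
      (∀ u : ℝ, S.D u = rightDeriv f (u : Circ)) ∧
      ∀ u : ℝ, u ∈ S.Q ↔ (u : Circ) ∈ fixedSet f P N := by
  obtain ⟨F, hc, hm, hF⟩ := hf.covering.2
  obtain ⟨d, hd⟩ := lift_add_one hc hF
  have hdn : ∀ (n : ℤ) u, F (u + n) = F u + d * n := fun n u => by
    induction n using Int.induction_on with
    | zero => simp
    | succ k ih =>
      have := hd (u + k)
      push_cast at *
      rw [← add_assoc, this, ih]; ring
    | pred k ih =>
      have := hd (u + (-(k : ℝ) - 1))
      push_cast at *
      rw [show u + (-(k : ℝ) - 1) + 1 = u + -k by ring, ih] at this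
      linarith
  obtain ⟨H, hH⟩ := hf.exists_piecewiseHolder hα hc hF
  have hDL : ∀ u : ℝ, rightDeriv f (u : Circ) ≤ leftDeriv f (u : Circ) := fun u =>
    hf.right_le_left _
  have hD1 : ∀ u : ℝ, 1 ≤ rightDeriv f (u : Circ) := fun u => hf.one_le _
  set D : ℝ → ℝ := fun u => rightDeriv f (u : Circ) with hD
  set L : ℝ → ℝ := fun u => leftDeriv f (u : Circ) with hL
  have hDn : ∀ (n : ℤ) u, D (u + n) = D u := fun n u => by
    simp only [hD]; congr 1; exact (coe_eq_coe_iff.2 ⟨n, rfl⟩).symm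
  obtain ⟨r₁, hr₁, hr₁'⟩ := exists_separation hf.finite
  have hfin : (fixedSet f P N).Finite := hf.finite.image _
  obtain ⟨r₂, hr₂, hr₂'⟩ := exists_separation hfin
  set g := r₁ / 2 with hg
  have hg0 : 0 < g := by positivity
  have hgsep : ∀ z ∈ {u : ℝ | (u : Circ) ∈ P}, ∀ z' ∈ {u : ℝ | (u : Circ) ∈ P},
      |z - z'| ≤ g → z = z' := fun z hz z' hz' hle => by
    by_contra hne
    linarith [hr₁' z z' hz hz' hne]
  have hper : ∀ u : ℝ, ∃ n : ℤ, u + n ∈ Icc (0 : ℝ) 1 := fun u =>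
    ⟨-⌊u⌋, by push_cast; linarith [Int.floor_le u], by push_cast; linarith [Int.lt_floor_add_one u]⟩
  -- bound of the derivative
  obtain ⟨Λ, hΛ⟩ : ∃ Λ, ∀ u, D u ≤ Λ := by
    obtain ⟨n, hn⟩ := exists_nat_ge (1 / g)
    refine ⟨D 0 + n * (3 * H * g ^ α), fun u => ?_⟩
    obtain ⟨k, hk⟩ := hper u
    rw [← hDn k u]
    refine hH.le_add_mul hgsep hDL hg0 n hk.1 ?_
    rw [div_le_iff₀ hg0] at hn
    linarith [hk.2]
  have hΛ1 : 1 ≤ Λ := (hD1 0).trans (hΛ 0)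
  -- uniform jump ratio
  obtain ⟨χ, hχ1, hχ⟩ : ∃ χ > 1, ∀ p ∈ P, leftDeriv f p ≠ rightDeriv f p →
      χ * rightDeriv f p ≤ leftDeriv f p := by
    have : ∀ᶠ s in 𝓝[>] (0 : ℝ), ∀ p ∈ P, leftDeriv f p ≠ rightDeriv f p →
        (1 + s) * rightDeriv f p ≤ leftDeriv f p := by
      rw [eventually_all_finite hf.finite]
      intro p _
      by_cases hne : leftDeriv f p = rightDeriv f p
      · simp [hne]
      · have h1 : rightDeriv f p < leftDeriv f p := lt_of_le_of_ne (hf.right_le_left p) (Ne.symm hne)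
        have h2 := hf.one_le p
        filter_upwards [Ioo_mem_nhdsGT (show (0 : ℝ) < (leftDeriv f p - rightDeriv f p) /
          rightDeriv f p from div_pos (by linarith) (by linarith))] with s hs _
        have h3 := hs.2
        rw [lt_div_iff₀ (by linarith)] at h3
        linarith
    obtain ⟨s, hs, hs0⟩ := (this.and self_mem_nhdsWithin).exists
    have hs0 : 0 < s := hs0
    exact ⟨1 + s, by linarith, hs⟩
  -- behaviour at the fixed points
  have hloc : ∀ᶠ s in 𝓝[>] (0 : ℝ), ∀ p ∈ fixedSet f P N, ∀ c : ℝ, (c : Circ) = p →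
      (∃ β, 0 ≤ β ∧ β ≤ α ∧ (∀ z, 0 < z → z < s → 1 + s * z ^ β ≤ D (c + z)) ∧
        ∀ z, 0 < z → z < s → F (c + z) - F c ≤ z * (1 + s⁻¹ * z ^ β)) ∧
      ∃ β, 0 ≤ β ∧ β ≤ α ∧ (∀ z, 0 < z → z < s → 1 + s * z ^ β ≤ D (c - z)) ∧
        ∀ z, 0 < z → z < s → F c - F (c - z) ≤ z * (1 + s⁻¹ * z ^ β) := by
    rw [eventually_all_finite hfin]
    intro p hp
    obtain ⟨c, rfl⟩ := QuotientAddGroup.mk_surjective p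
    change (c : Circ) ∈ fixedSet f P N at hp
    have hdist : ∀ h : ℝ, |h| ≤ 1 / 2 → dist ((c : Circ) + (h : Circ)) (c : Circ) = |h| := by
      intro h hh
      rw [← AddCircle.coe_add, dist_coe_eq (by simpa using hh), add_sub_cancel_left]
    -- On a neutral side β = α by the limit hypothesis; on an expanding side β = 0, with
    -- semicontinuity from below and the global bound Λ from above.
    have hR : ∃ β, 0 ≤ β ∧ β ≤ α ∧ ∃ A > 0, ∃ A' > 0, ∀ᶠ z in 𝓝[>] (0 : ℝ),
        1 + A * z ^ β ≤ D (c + z) ∧ D (c + z) ≤ 1 + A' * z ^ β := by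
      rcases (hD1 c).eq_or_lt with h1 | h1
      · obtain ⟨A, hA, hA'⟩ := hf.neutral_right _ hp h1.symm
        refine ⟨α, hα.le, le_rfl, A / 2, by positivity, 2 * A, by positivity, ?_⟩
        have hsmall : ∀ᶠ z in 𝓝[>] (0 : ℝ), z ∈ Ioo (0 : ℝ) (1 / 2) :=
          Ioo_mem_nhdsGT (by norm_num)
        have := exists_bounds_of_neutral (D := fun h : ℝ => rightDeriv f ((c : Circ) + (h : Circ)))
          (d := fun h => dist ((c : Circ) + (h : Circ)) (c : Circ)) hA (by
            filter_upwards [hsmall] with h hh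
            rw [hdist h (by rw [abs_of_pos hh.1]; exact hh.2.le), abs_of_pos hh.1]; exact hh.1) hA'
        filter_upwards [this, hsmall] with h hh hh'
        rw [hdist h (by rw [abs_of_pos hh'.1]; exact hh'.2.le), abs_of_pos hh'.1,
          ← AddCircle.coe_add] at hh
        exact hh
      · refine ⟨0, le_rfl, hα.le, (D c - 1) / 2, by simp only [hD]; linarith, Λ, by linarith, ?_⟩
        have h2 := hH.lowerSemicontinuousAt hgsep hDL hg0 c ((1 + D c) / 2) (by
          simp only [hD]; linarith)
        have h3 : Tendsto (fun z => c + z) (𝓝[>] (0 : ℝ)) (𝓝 c) := by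
          have : Continuous fun z : ℝ => c + z := by fun_prop
          simpa using (this.tendsto 0).mono_left nhdsWithin_le_nhds
        filter_upwards [h3.eventually h2] with z hz
        have h4 := hΛ (c + z)
        simp only [Real.rpow_zero, mul_one]
        change _ < D (c + z) at hz
        constructor <;> linarith
    have hLft : ∃ β, 0 ≤ β ∧ β ≤ α ∧ ∃ A > 0, ∃ A' > 0, ∀ᶠ z in 𝓝[>] (0 : ℝ),
        1 + A * z ^ β ≤ D (c - z) ∧ D (c - z) ≤ 1 + A' * z ^ β := by
      rcases ((hD1 c).trans (hDL c)).eq_or_lt with h1 | h1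
      · obtain ⟨A, hA, hA'⟩ := hf.neutral_left _ hp h1.symm
        have hA' := hA'.comp (by simpa using tendsto_neg_nhdsGT_neg (a := (0 : ℝ)) :
          Tendsto Neg.neg (𝓝[>] (0 : ℝ)) (𝓝[<] 0))
        refine ⟨α, hα.le, le_rfl, A / 2, by positivity, 2 * A, by positivity, ?_⟩
        have hsmall : ∀ᶠ z in 𝓝[>] (0 : ℝ), z ∈ Ioo (0 : ℝ) (1 / 2) :=
          Ioo_mem_nhdsGT (by norm_num)
        have := exists_bounds_of_neutral
          (D := fun h : ℝ => rightDeriv f ((c : Circ) + ((-h : ℝ) : Circ)))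
          (d := fun h => dist ((c : Circ) + ((-h : ℝ) : Circ)) (c : Circ)) hA (by
            filter_upwards [hsmall] with h hh
            rw [hdist _ (by rw [abs_neg, abs_of_pos hh.1]; exact hh.2.le), abs_neg, abs_of_pos hh.1]
            exact hh.1) hA'
        filter_upwards [this, hsmall] with h hh hh'
        rw [hdist _ (by rw [abs_neg, abs_of_pos hh'.1]; exact hh'.2.le), abs_neg, abs_of_pos hh'.1,
          ← AddCircle.coe_add, ← sub_eq_add_neg] at hh
        exact hh
      · refine ⟨0, le_rfl, hα.le, (L c - 1) / 2, by simp only [hL]; linarith, Λ, by linarith, ?_⟩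
        have h2 := hH.eventually_lt_left hgsep hg0 (y := (1 + L c) / 2) (b := c) (by
          simp only [hL]; linarith)
        have h3 : Tendsto (fun z => c - z) (𝓝[>] (0 : ℝ)) (𝓝[<] c) := by
          refine tendsto_nhdsWithin_iff.2 ⟨?_, ?_⟩
          · have : Continuous fun z : ℝ => c - z := by fun_prop
            simpa using (this.tendsto 0).mono_left nhdsWithin_le_nhds
          · filter_upwards [self_mem_nhdsWithin] with z hz
            simpa using hz
        filter_upwards [h3.eventually h2] with z hz
        have h4 := hΛ (c - z)
        simp only [Real.rpow_zero, mul_one]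
        change _ < D (c - z) at hz
        constructor <;> linarith
    obtain ⟨β, h0, h1, A, hA, A', hA', hev⟩ := hR
    obtain ⟨β', h0', h1', B, hB, B', hB', hev'⟩ := hLft
    filter_upwards [hH.eventually_right hgsep hg0 h0 hA hA' hev,
      hH.eventually_left hgsep hg0 h0' hB hB' hev'] with s hs hs' c' hc'
    obtain ⟨n, rfl⟩ := coe_eq_coe_iff.1 (show (c : Circ) = (c' : Circ) from hc'.symm)
    refine ⟨⟨β, h0, h1, fun z hz hzs => ?_, fun z hz hzs => ?_⟩,
      β', h0', h1', fun z hz hzs => ?_, fun z hz hzs => ?_⟩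
    · rw [add_right_comm, hDn]; exact hs.1 z hz hzs
    · rw [add_right_comm, hdn, hdn]
      have := hs.2 z hz hzs
      linarith
    · rw [add_sub_right_comm, hDn]; exact hs'.1 z hz hzs
    · rw [add_sub_right_comm, hdn, hdn]
      have := hs'.2 z hz hzs
      linarith
  obtain ⟨s, hs, hs0⟩ := (hloc.and self_mem_nhdsWithin).exists
  have hs0 : 0 < s := hs0
  set r := min s r₂ with hr
  -- Only points of P with different one-sided derivatives count as breaks. The Hölder constant
  -- covers both 3H and (2 + χ)H, and the summand 1 makes it positive.
  refine ⟨{ F := F, D := D, Q := {u | (u : Circ) ∈ fixedSet f P N}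
            B := {u | (u : Circ) ∈ P ∧ leftDeriv f (u : Circ) ≠ rightDeriv f (u : Circ)}
            d := d, r := r, H := (3 + χ) * H + 1, g := g, χ := χ, Λ := Λ, a := s, b := s⁻¹
            α_pos := hα, strictMono := hm, cont := hc, map_add_one := hd
            hasDeriv := fun u => (hH.right u).Ici_of_Ioi
            one_le := hD1, le_Λ := hΛ
            Q_nonempty := ?_, Q_fixed := ?_, Q_add := ?_, r_pos := by positivity, Q_sep := ?_
            a_pos := hs0, b_pos := by positivity, right := ?_, left := ?_, away := ?_
            H_pos := ?_, g_pos := hg0, one_lt_χ := hχ1, holder := ?_, upper := ?_, jump := ?_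
            B_sep := fun q hq q' hq' => hgsep q hq.1 q' hq'.1 },
    hF, fun _ => rfl, fun _ => Iff.rfl⟩
  · obtain ⟨p, hp⟩ := hP
    obtain ⟨c, hc'⟩ := QuotientAddGroup.mk_surjective (f^[N] p)
    exact ⟨c, ⟨p, hp, hc'.symm⟩⟩
  · intro c hcQ
    have h1 := hf.fixed _ hcQ
    rw [← hF] at h1
    exact coe_eq_coe_iff.1 h1.symm
  · intro c hcQ n
    have : ((c : ℝ) : Circ) = ((c + n : ℝ) : Circ) := coe_eq_coe_iff.2 ⟨n, rfl⟩
    change ((c + n : ℝ) : Circ) ∈ fixedSet f P N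
    rw [← this]; exact hcQ
  · exact fun c hc' c' hc'' hne => (min_le_right _ _).trans (hr₂' c c' hc' hc'' hne)
  · intro c hcQ
    obtain ⟨β, h0, h1, h2, h3⟩ := (hs _ hcQ c rfl).1
    exact ⟨β, h0, h1, fun z hz hz' => h2 z hz (hz'.trans_le (min_le_left _ _)),
      fun z hz hz' => h3 z hz (hz'.trans_le (min_le_left _ _))⟩
  · intro c hcQ
    obtain ⟨β, h0, h1, h2, h3⟩ := (hs _ hcQ c rfl).2
    exact ⟨β, h0, h1, fun z hz hz' => h2 z hz (hz'.trans_le (min_le_left _ _)),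
      fun z hz hz' => h3 z hz (hz'.trans_le (min_le_left _ _))⟩
  · intro ρ hρ
    set K : Set ℝ := Icc 0 1 ∩ {u | ∀ c ∈ {u : ℝ | (u : Circ) ∈ fixedSet f P N}, ρ ≤ |u - c|}
      with hK
    have hKc : IsCompact K := by
      refine isCompact_Icc.inter_right ?_
      simp only [ofPred_forall]
      exact isClosed_iInter fun c => isClosed_iInter fun _ =>
        isClosed_le continuous_const (by fun_prop)
    have hred : ∀ u : ℝ, (∀ c ∈ {u : ℝ | (u : Circ) ∈ fixedSet f P N}, ρ ≤ |u - c|) →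
        ∃ n : ℤ, u + n ∈ K := by
      intro u hu
      obtain ⟨n, hn⟩ := hper u
      refine ⟨n, hn, fun c hcQ => ?_⟩
      have := hu (c - n) (by
        have : ((c - n : ℝ) : Circ) = (c : Circ) := coe_eq_coe_iff.2 ⟨n, by ring⟩
        change ((c - n : ℝ) : Circ) ∈ fixedSet f P N
        rw [this]; exact hcQ)
      rwa [sub_sub_eq_add_sub] at this
    rcases K.eq_empty_or_nonempty with hemp | hne
    · refine ⟨2, by norm_num, fun u hu => ?_⟩
      obtain ⟨n, hn⟩ := hred u hu
      rw [hemp] at hn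
      exact hn.elim
    -- By periodicity a compact set of representatives suffices. The lower semicontinuous D attains
    -- its minimum there, at a point off the fixed set, so the minimum exceeds 1.
    · obtain ⟨x, hx, hmin⟩ := LowerSemicontinuousOn.exists_isMinOn hne hKc (f := D)
        fun u _ => (hH.lowerSemicontinuousAt hgsep hDL hg0 u).lowerSemicontinuousWithinAt K
      refine ⟨D x, ?_, fun u hu => ?_⟩
      · refine (hf.deriv_other _ fun hxQ => ?_).2
        have := hx.2 x hxQ
        rw [sub_self, abs_zero] at this
        linarith
      · obtain ⟨n, hn⟩ := hred u hu
        rw [← hDn n u]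
        exact hmin hn
  · have := hH.H_nonneg
    have : 0 ≤ (3 + χ) * H := mul_nonneg (by linarith) this
    linarith
  · intro u v huv hvg hB
    have h1 := hH.holder_of_notMem hgsep huv hvg fun x hx hxP => by
      by_contra hne
      exact hB x hx ⟨hxP, hne⟩
    refine h1.trans (mul_le_mul_of_nonneg_right ?_ (Real.rpow_nonneg (by linarith) _))
    nlinarith [hH.H_nonneg]
  · intro u v huv hvg
    refine (hH.upper hgsep hDL huv hvg).trans ?_
    refine add_le_add_right (mul_le_mul_of_nonneg_right ?_ (Real.rpow_nonneg (by linarith) _)) _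
    nlinarith [hH.H_nonneg]
  · intro u v q hq huq hqv hvg
    have h1 := hH.jump hgsep (χ := χ) (by linarith) hq.1 huq hqv hvg (hχ _ hq.1 hq.2)
    refine h1.trans (add_le_add_right (mul_le_mul_of_nonneg_right ?_
      (Real.rpow_nonneg (by linarith) _)) _)
    nlinarith [hH.H_nonneg]

/-! ### Transfer between the line and the circle -/

lemma isOpenMap_coe : IsOpenMap ((↑) : ℝ → Circ) := QuotientAddGroup.isOpenMap_coe

lemma surjective_coe : Function.Surjective ((↑) : ℝ → Circ) := QuotientAddGroup.mk_surjective

lemma exists_coe_dist (x : Circ) (c : ℝ) : ∃ u : ℝ, (u : Circ) = x ∧ |u - c| = dist x (c : Circ) := by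
  obtain ⟨v, rfl⟩ := surjective_coe x
  refine ⟨v - round (v - c), coe_eq_coe_iff.2 ⟨round (v - c), by ring⟩, ?_⟩
  rw [dist_eq_norm, ← AddCircle.coe_sub, UnitAddCircle.norm_eq]
  congr 1; ring

lemma mem_uIcc_iff_exists {a b w : ℝ} : w ∈ uIcc a b ↔ ∃ s ∈ Icc (0 : ℝ) 1, a + s * (b - a) = w := by
  rw [← segment_eq_uIcc, segment_eq_image']; rfl

/-- Points at which the segment between two continuous functions stays in an open set form a
neighbourhood. -/
lemma eventually_uIcc_subset {Y : Type*} [TopologicalSpace Y] {O : Set (ℝ × Y)} (hO : IsOpen O)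
    {a b : Y → ℝ} (ha : Continuous a) (hb : Continuous b) {y₀ : Y}
    (h : ∀ w ∈ uIcc (a y₀) (b y₀), (w, y₀) ∈ O) :
    ∀ᶠ y in 𝓝 y₀, ∀ w ∈ uIcc (a y) (b y), (w, y) ∈ O := by
  have key : ∀ᶠ y in 𝓝 y₀, ∀ s ∈ Icc (0 : ℝ) 1, (a y + s * (b y - a y), y) ∈ O := by
    apply isCompact_Icc.eventually_forall_of_forall_eventually
    intro s hs
    have hcont : Continuous fun z : Y × ℝ => (a z.1 + z.2 * (b z.1 - a z.1), z.1) := by fun_prop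
    exact (hO.preimage hcont).mem_nhds (h _ (mem_uIcc_iff_exists.2 ⟨s, hs, rfl⟩))
  filter_upwards [key] with y hy w hw
  obtain ⟨s, hs, rfl⟩ := mem_uIcc_iff_exists.1 hw
  exact hy s hs

namespace LiftSystem
variable {α : ℝ} (S : LiftSystem α)

lemma X_add_int (t : ℕ → ℝ) (n : ℕ) (u : ℝ) (m : ℤ) :
    S.X t n (u + m) = S.X t n u + ((S.d ^ n * m : ℤ) : ℝ) := by
  induction n with
  | zero => simp
  | succ n ih =>
    rw [X_succ, X_succ, ih, map_add_int]
    push_cast; ring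

lemma continuous_X_prod (n : ℕ) : Continuous fun z : ℝ × (ℕ → ℝ) => S.X z.2 n z.1 := by
  induction n with
  | zero => exact continuous_fst
  | succ n ih =>
    exact (S.cont.comp ih).add ((continuous_apply n).comp continuous_snd)

lemma continuous_X_right (n : ℕ) (u : ℝ) : Continuous fun t : ℕ → ℝ => S.X t n u :=
  (S.continuous_X_prod n).comp (Continuous.prodMk continuous_const continuous_id)

lemma hasDeriv_X (t : ℕ → ℝ) (n : ℕ) (u : ℝ) :
    HasDerivWithinAt (S.X t n) (∏ i ∈ Finset.range n, S.D (S.X t i u)) (Ici u) u := by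
  induction n with
  | zero =>
    rw [Finset.range_zero, Finset.prod_empty]
    exact (hasDerivAt_id u).hasDerivWithinAt
  | succ n ih =>
    rw [Finset.prod_range_succ, mul_comm]
    exact ((S.hasDeriv (S.X t n u)).comp u ih fun v hv => (S.X_le t).2 hv).add_const _

/-! ### The random orbits on the circle -/

section circle
variable {f : Circ → Circ} (hF : ∀ u : ℝ, ((S.F u : ℝ) : Circ) = f (u : Circ))
include hF

lemma coe_X (t : ℕ → ℝ) (n : ℕ) (u : ℝ) : ((S.X t n u : ℝ) : Circ) = randIter f t n (u : Circ) := by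
  induction n with
  | zero => rfl
  | succ n ih => rw [X_succ, AddCircle.coe_add, hF, ih]; rfl

lemma rightDeriv_randIter (t : ℕ → ℝ) (n : ℕ) (u : ℝ) :
    rightDeriv (randIter f t n) (u : Circ) = ∏ i ∈ Finset.range n, S.D (S.X t i u) := by
  rw [rightDeriv_coe (S.X_continuous t n) (S.coe_X hF t n)]
  exact ((S.hasDeriv_X t n u).mono Ioi_subset_Ici_self).derivWithin (uniqueDiffWithinAt_Ioi u)

lemma rightDeriv_randIter_shift (t : ℕ → ℝ) {j n : ℕ} (u : ℝ) :
    rightDeriv (randIter f (shift j t) (n - j)) (randIter f t j (u : Circ)) =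
      ∏ i ∈ Finset.Ico j n, S.D (S.X t i u) := by
  rw [← S.coe_X hF, S.rightDeriv_randIter hF, Finset.prod_Ico_eq_prod_range]
  simp only [S.X_add]

/-- A lift v of a point of the preimage has image within τ of that of u plus an integer k. If k is a
multiple of d ^ n, an integer translation of v reduces k to 0; the remaining lifts form W'. As τ < 1
/ 2, W and W' have disjoint open images in the circle, and connectedness confines the pullback to
that of W. -/
lemma exists_lift_of_mem_pullback {τ : ℝ} (hτ : τ < 1 / 2) {n : ℕ} {t : ℕ → ℝ} {u : ℝ} {y : Circ}
    (hy : y ∈ pullback f τ n (u : Circ) t) :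
    ∃ v : ℝ, (v : Circ) = y ∧ |S.X t n v - S.X t n u| < τ := by
  set W : Set ℝ := {v | |S.X t n v - S.X t n u| < τ}
  set W' : Set ℝ := {v | ∃ k : ℤ, (∀ l, k ≠ S.d ^ n * l) ∧ |S.X t n v - S.X t n u - k| < τ}
  have hX := S.X_continuous t n
  have hW : IsOpen W := isOpen_lt (by fun_prop) continuous_const
  have hW' : IsOpen W' := by
    have : W' = ⋃ k : ℤ, ⋃ _ : ∀ l, k ≠ S.d ^ n * l, {v | |S.X t n v - S.X t n u - k| < τ} := by
      ext v; simp [W']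
    rw [this]
    exact isOpen_iUnion fun k => isOpen_iUnion fun _ => isOpen_lt (by fun_prop) continuous_const
  have hdisj : Disjoint (((↑) : ℝ → Circ) '' W) (((↑) : ℝ → Circ) '' W') := by
    rw [Set.disjoint_left]
    rintro _ ⟨v, hv, rfl⟩ ⟨w, ⟨k, hk, hw⟩, hvw⟩
    obtain ⟨l, rfl⟩ := coe_eq_coe_iff.1 hvw.symm
    rw [X_add_int] at hw
    refine hk l (sub_eq_zero.1 (Int.abs_lt_one_iff.1 ?_))
    have hv : |S.X t n v - S.X t n u| < τ := hv
    have : |((k - S.d ^ n * l : ℤ) : ℝ)| < 1 := by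
      push_cast at hw ⊢
      rw [abs_lt] at *
      constructor <;> linarith
    exact_mod_cast this
  have hsub : randIter f t n ⁻¹' Metric.ball (randIter f t n (u : Circ)) τ ⊆
      ((↑) : ℝ → Circ) '' W ∪ ((↑) : ℝ → Circ) '' W' := by
    intro z hz
    obtain ⟨v, rfl⟩ := surjective_coe z
    rw [mem_preimage, Metric.mem_ball, ← S.coe_X hF, ← S.coe_X hF, dist_eq_norm,
      ← AddCircle.coe_sub, UnitAddCircle.norm_eq] at hz
    by_cases hk : ∃ l, round (S.X t n v - S.X t n u) = S.d ^ n * l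
    · obtain ⟨l, hl⟩ := hk
      refine Or.inl ⟨v + (-l : ℤ), ?_, (coe_eq_coe_iff.2 ⟨-l, rfl⟩).symm⟩
      change |_| < τ
      rw [hl] at hz
      rw [X_add_int]
      push_cast at hz ⊢
      convert hz using 2; ring
    · push Not at hk
      exact Or.inr ⟨v, ⟨_, hk, hz⟩, rfl⟩
  rw [pullback] at hy
  have hu : (u : Circ) ∈ randIter f t n ⁻¹' Metric.ball (randIter f t n (u : Circ)) τ := by
    by_contra hcon
    rw [connectedComponentIn_eq_empty hcon] at hy
    exact hy
  have hτ0 : 0 < τ := Metric.pos_of_mem_ball (mem_preimage.1 hu)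
  generalize randIter f t n ⁻¹' Metric.ball (randIter f t n (u : Circ)) τ = A at hy hu hsub
  have huW : u ∈ W := by simpa [W] using hτ0
  have hyW := isPreconnected_connectedComponentIn.subset_left_of_subset_union
    (isOpenMap_coe _ hW) (isOpenMap_coe _ hW') hdisj
    ((connectedComponentIn_subset A _).trans hsub)
    ⟨(u : Circ), mem_connectedComponentIn hu, mem_image_of_mem _ huW⟩ hy
  obtain ⟨v, hv, rfl⟩ := hyW
  exact ⟨v, rfl, hv⟩

/-- The expansion and the distortion at a good time. -/
lemma Good.circle_bounds {δ κ c τ : ℝ} {n m₁ m : ℕ} {t : ℕ → ℝ} {u : ℝ} (hτ0 : 0 < τ)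
    (hτ : τ < 1 / 2)
    (h : S.Good t δ κ n m₁ m u) (hκ : 0 < κ)
    (hn : ∀ (T : ℕ) (a b : ℝ), a < b → S.len t (T + n) a b ≤ 1 → S.len t T a b < κ)
    (hm₁ : ∀ (T : ℕ) (a b : ℝ), m₁ ≤ T → a < b → S.len t T a b ≤ 1 → S.len t 0 a b * c ≤ κ) :
    distortion α f τ m (u : Circ) t ≤ n + S.κ₀ / κ ^ α ∧ c ≤ expansion f τ m (u : Circ) t := by
  have hu : (u : Circ) ∈ pullback f τ m (u : Circ) t := by
    refine mem_connectedComponentIn ?_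
    rw [mem_preimage]
    exact Metric.mem_ball_self hτ0
  have hne : Nonempty (pullback f τ m (u : Circ) t) := ⟨⟨_, hu⟩⟩
  have hb : ∀ y ∈ pullback f τ m (u : Circ) t, ∃ v : ℝ, (v : Circ) = y ∧
      |S.X t m v - S.X t m u| ≤ 1 / 2 := fun y hy => by
    obtain ⟨v, hv, hvu⟩ := S.exists_lift_of_mem_pullback hF hτ hy
    exact ⟨v, hv, by linarith⟩
  constructor
  · refine ciSup_le fun ⟨y, hy⟩ => ?_
    obtain ⟨v, rfl, hv⟩ := hb y hy
    simp only [S.rightDeriv_randIter_shift hF]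
    exact (h.bounds S hκ hn hm₁ hv).2
  · refine le_ciInf fun ⟨y, hy⟩ => ?_
    obtain ⟨v, rfl, hv⟩ := hb y hy
    simp only [S.rightDeriv_randIter hF, Finset.range_eq_Ico]
    exact (h.bounds S hκ hn hm₁ hv).1

end circle

/-! ### The nice set -/

/-- The points whose random orbit meets the `δ`-neighbourhood of the fixed points. -/
def Near (δ : ℝ) (t : ℕ → ℝ) : Set ℝ := {u | ∃ n, ∃ c ∈ S.Q, |S.X t n u - c| < δ}

/-- The points near `c` which are joined to `c` inside `Near δ t`. -/
def basin (δ : ℝ) (c : ℝ) (t : ℕ → ℝ) : Set ℝ :=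
  {u | |u - c| < 2 * δ ∧ ∀ w ∈ uIcc c u, w ∈ S.Near δ t}

/-- The union of the projections of the basins of all fixed points. -/
def niceSet (δ ε : ℝ) : Set (Circ × (ℕ → ℝ)) :=
  {z | z.2 ∈ noiseSpace ε ∧ ∃ c ∈ S.Q, ∃ u ∈ S.basin δ c z.2, (u : Circ) = z.1}

variable {δ ε c : ℝ} {t : ℕ → ℝ}

lemma near_add_int {u : ℝ} (hu : u ∈ S.Near δ t) (m : ℤ) : u + m ∈ S.Near δ t := by
  obtain ⟨n, c, hc, h⟩ := hu
  refine ⟨n, c + ((S.d ^ n * m : ℤ) : ℝ), S.Q_add c hc _, ?_⟩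
  rw [X_add_int, add_sub_add_right_eq_sub]; exact h

lemma near_of_near_shift {u : ℝ} {k : ℕ} (hu : S.X t k u ∈ S.Near δ (shift k t)) :
    u ∈ S.Near δ t := by
  obtain ⟨n, c, hc, h⟩ := hu
  exact ⟨k + n, c, hc, by rwa [X_add]⟩

lemma near_of_abs_lt {u : ℝ} (hc : c ∈ S.Q) (hu : |u - c| < δ) : u ∈ S.Near δ t := ⟨0, c, hc, hu⟩

lemma isOpen_near : IsOpen {z : ℝ × (ℕ → ℝ) | z.1 ∈ S.Near δ z.2} := by
  have : {z : ℝ × (ℕ → ℝ) | z.1 ∈ S.Near δ z.2} =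
      ⋃ n, ⋃ c ∈ S.Q, {z : ℝ × (ℕ → ℝ) | |S.X z.2 n z.1 - c| < δ} := by
    ext z; simp [Near]
  rw [this]
  refine isOpen_iUnion fun n => isOpen_biUnion fun c _ => ?_
  have := S.continuous_X_prod n
  exact isOpen_lt (by fun_prop) continuous_const

lemma isOpen_basin : IsOpen {z : ℝ × (ℕ → ℝ) | z.1 ∈ S.basin δ c z.2} := by
  rw [isOpen_iff_mem_nhds]
  rintro z ⟨h1, h2⟩
  have e1 : ∀ᶠ y : ℝ × (ℕ → ℝ) in 𝓝 z, |y.1 - c| < 2 * δ :=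
    (isOpen_lt (by fun_prop) continuous_const).mem_nhds h1
  have hO : IsOpen {q : ℝ × (ℝ × (ℕ → ℝ)) | q.1 ∈ S.Near δ q.2.2} :=
    (S.isOpen_near (δ := δ)).preimage
      (f := fun q : ℝ × (ℝ × (ℕ → ℝ)) => (q.1, q.2.2)) (by fun_prop)
  have e2 := eventually_uIcc_subset hO (a := fun _ => c) (b := Prod.fst) (y₀ := z)
    continuous_const continuous_fst h2
  filter_upwards [e1, e2] with y hy1 hy2 using ⟨hy1, hy2⟩

lemma isOpen_basin_fiber : IsOpen (S.basin δ c t) :=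
  (S.isOpen_basin (δ := δ) (c := c)).preimage
    (f := fun u : ℝ => (u, t)) (Continuous.prodMk continuous_id continuous_const)

lemma basin_add_int {u : ℝ} (hu : u ∈ S.basin δ c t) (m : ℤ) : u + m ∈ S.basin δ (c + m) t := by
  refine ⟨by rw [add_sub_add_right_eq_sub]; exact hu.1, fun w hw => ?_⟩
  obtain ⟨s, hs, rfl⟩ := mem_uIcc_iff_exists.1 hw
  have := S.near_add_int (hu.2 _ (mem_uIcc_iff_exists.2 ⟨s, hs, rfl⟩)) m
  convert this using 1; ring

lemma center_mem_basin (hδ : 0 < δ) (hc : c ∈ S.Q) : c ∈ S.basin δ c t := by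
  refine ⟨by simpa using hδ, fun w hw => ?_⟩
  rw [uIcc_self, mem_singleton_iff] at hw
  exact S.near_of_abs_lt hc (by simpa [hw] using hδ)

lemma isPreconnected_basin : IsPreconnected (S.basin δ c t) := by
  refine isPreconnected_of_forall c fun u hu => ⟨uIcc c u, fun w hw => ⟨?_, fun v hv => ?_⟩,
    left_mem_uIcc, right_mem_uIcc, isPreconnected_uIcc⟩
  · exact lt_of_le_of_lt (abs_sub_left_of_mem_uIcc hw) hu.1
  · exact hu.2 v (uIcc_subset_uIcc_left hw hv)

/-- Basins have radius at most 2δ and lifted fixed points are r ≥ 4δ apart, so basins of different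
fixed points do not meet. -/
lemma coe_eq_of_coe_basin (hδr : 4 * δ ≤ S.r) {c' u v : ℝ} (hc : c ∈ S.Q) (hc' : c' ∈ S.Q)
    (hu : u ∈ S.basin δ c t) (hv : v ∈ S.basin δ c' t) (huv : (u : Circ) = v) :
    (c : Circ) = c' := by
  obtain ⟨m, rfl⟩ := coe_eq_coe_iff.1 huv
  refine coe_eq_coe_iff.2 ⟨m, ?_⟩
  by_contra hne
  have h1 := S.Q_sep _ hc' _ (S.Q_add c hc m) hne
  have h2 := hu.1
  have h3 := hv.1
  have h4 : |c' - (c + m)| < 4 * δ := by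
    rw [abs_lt] at *
    constructor <;> linarith
  linarith

lemma fiber_niceSet (ht : t ∈ noiseSpace ε) :
    fiber (S.niceSet δ ε) t = ⋃ c ∈ S.Q, ((↑) : ℝ → Circ) '' S.basin δ c t := by
  ext x
  simp [fiber, niceSet, ht]

/-- The projected basins are connected and open, and those of different points of the circle are
disjoint. -/
lemma connectedComponentIn_niceSet (hδ : 0 < δ) (hδr : 4 * δ ≤ S.r) (ht : t ∈ noiseSpace ε)
    (hc : c ∈ S.Q) : connectedComponentIn (fiber (S.niceSet δ ε) t) (c : Circ) =
      ((↑) : ℝ → Circ) '' S.basin δ c t := by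
  have hcm : (c : Circ) ∈ ((↑) : ℝ → Circ) '' S.basin δ c t :=
    mem_image_of_mem _ (S.center_mem_basin hδ hc)
  have hsub : ((↑) : ℝ → Circ) '' S.basin δ c t ⊆ fiber (S.niceSet δ ε) t := by
    rw [S.fiber_niceSet ht]
    exact subset_biUnion_of_mem (u := fun c => ((↑) : ℝ → Circ) '' S.basin δ c t) hc
  refine Subset.antisymm ?_ ((S.isPreconnected_basin.image _
    (AddCircle.continuous_mk' 1).continuousOn).subset_connectedComponentIn hcm hsub)
  refine isPreconnected_connectedComponentIn.subset_left_of_subset_union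
    (v := ⋃ c' ∈ {c' ∈ S.Q | (c' : Circ) ≠ c}, ((↑) : ℝ → Circ) '' S.basin δ c' t)
    (isOpenMap_coe _ S.isOpen_basin_fiber)
    (isOpen_biUnion fun c' _ => isOpenMap_coe _ S.isOpen_basin_fiber) ?_ ?_
    ⟨_, mem_connectedComponentIn (hsub hcm), hcm⟩
  · rw [Set.disjoint_left]
    rintro _ ⟨u, hu, rfl⟩ hx
    obtain ⟨c', ⟨hc', hne⟩, v, hv, hvu⟩ := mem_iUnion₂.1 hx
    exact hne (S.coe_eq_of_coe_basin hδr hc' hc hv hu hvu)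
  · refine (connectedComponentIn_subset _ _).trans ?_
    rw [S.fiber_niceSet ht]
    refine iUnion₂_subset fun c' hc' => ?_
    rintro _ ⟨u, hu, rfl⟩
    by_cases hne : (c' : Circ) = c
    · obtain ⟨m, rfl⟩ := coe_eq_coe_iff.1 hne
      exact Or.inl ⟨u + m, S.basin_add_int hu m, (coe_eq_coe_iff.2 ⟨m, rfl⟩).symm⟩
    · exact Or.inr (mem_iUnion₂.2 ⟨c', ⟨hc', hne⟩, u, hu, rfl⟩)

lemma ball_subset_basin (hc : c ∈ S.Q) :
    Metric.ball (c : Circ) δ ⊆ ((↑) : ℝ → Circ) '' S.basin δ c t := by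
  intro x hx
  obtain ⟨u, rfl, hu⟩ := exists_coe_dist x c
  have hu' : |u - c| < δ := by rw [hu]; exact hx
  refine ⟨u, ⟨by linarith [abs_nonneg (u - c)], fun w hw => ?_⟩, rfl⟩
  exact S.near_of_abs_lt hc (lt_of_le_of_lt (abs_sub_left_of_mem_uIcc hw) hu')

lemma basin_subset_ball : ((↑) : ℝ → Circ) '' S.basin δ c t ⊆ Metric.ball (c : Circ) (2 * δ) := by
  rintro _ ⟨u, hu, rfl⟩
  exact lt_of_le_of_lt (dist_coe_le u c) hu.1

/-- The avoiding points at distance at most 3δ/2 on either side block every segment inside `Near`,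
so the bound 2δ in `basin` is never what cuts it off: a basin is a full component of `Near`. -/
lemma mem_basin_of_forall_near (hδ : 0 < δ)
    (hav : ∀ p q, S.IsSide δ p q → ∃ u ∈ Icc p q, ∀ n, ∀ c ∈ S.Q, δ ≤ |S.X t n u - c|)
    (hc : c ∈ S.Q) {u : ℝ} (hu : ∀ w ∈ uIcc c u, w ∈ S.Near δ t) : u ∈ S.basin δ c t := by
  refine ⟨?_, hu⟩
  obtain ⟨v, hv, hv'⟩ := hav (c + δ) (c + 3 / 2 * δ) ⟨c, hc, Or.inl ⟨rfl, rfl⟩⟩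
  obtain ⟨w, hw, hw'⟩ := hav (c - 3 / 2 * δ) (c - δ) ⟨c, hc, Or.inr ⟨rfl, rfl⟩⟩
  by_contra! hcon
  rcases le_abs.1 hcon with h | h
  · obtain ⟨n, c', hc', h'⟩ := hu v (mem_uIcc.2 (Or.inl ⟨by linarith [hv.1], by linarith [hv.2]⟩))
    exact (hv' n c' hc').not_gt h'
  · obtain ⟨n, c', hc', h'⟩ := hu w (mem_uIcc.2 (Or.inr ⟨by linarith [hw.1], by linarith [hw.2]⟩))
    exact (hw' n c' hc').not_gt h'

lemma measurableSet_noiseSpace : MeasurableSet (noiseSpace ε) := by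
  have : noiseSpace ε = ⋂ i, (fun t : ℕ → ℝ => t i) ⁻¹' Icc (-ε) ε := by
    ext t; simp [noiseSpace]
  rw [this]
  exact MeasurableSet.iInter fun i => measurableSet_Icc.preimage (measurable_pi_apply i)

lemma shift_mem_noiseSpace (ht : t ∈ noiseSpace ε) (k : ℕ) : shift k t ∈ noiseSpace ε :=
  fun i => ht (i + k)

lemma isOpenMap_coe_prod :
    IsOpenMap (Prod.map ((↑) : ℝ → Circ) (id : (ℕ → ℝ) → (ℕ → ℝ))) :=
  isOpenMap_coe.prodMap IsOpenMap.id

lemma measurableSet_niceSet : MeasurableSet (S.niceSet δ ε) := by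
  have : S.niceSet δ ε = (Prod.snd ⁻¹' noiseSpace ε) ∩ ⋃ c ∈ S.Q,
      Prod.map ((↑) : ℝ → Circ) (id : (ℕ → ℝ) → (ℕ → ℝ)) ''
        {z : ℝ × (ℕ → ℝ) | z.1 ∈ S.basin δ c z.2} := by
    ext ⟨x, t⟩
    simp [niceSet]
  rw [this]
  exact (measurableSet_noiseSpace.preimage measurable_snd).inter
    (isOpen_biUnion fun c _ => isOpenMap_coe_prod _ S.isOpen_basin).measurableSet

lemma isNiceSet_niceSet {f : Circ → Circ} (hF : ∀ u : ℝ, ((S.F u : ℝ) : Circ) = f (u : Circ))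
    {P₀ : Set Circ} (hQ : ∀ u : ℝ, u ∈ S.Q ↔ (u : Circ) ∈ P₀) (hδ : 0 < δ) (hδr : 4 * δ ≤ S.r)
    (hav : ∀ t ∈ noiseSpace ε, ∀ p q, S.IsSide δ p q →
      ∃ u ∈ Icc p q, ∀ n, ∀ c ∈ S.Q, δ ≤ |S.X t n u - c|) :
    IsNiceSet f P₀ ε (S.niceSet δ ε) where
  measurable := S.measurableSet_niceSet
  subset := fun z hz => ⟨mem_univ _, hz.1⟩
  isOpen_fiber t ht := by
    rw [S.fiber_niceSet ht]
    exact isOpen_biUnion fun c' _ => isOpenMap_coe _ S.isOpen_basin_fiber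
  fixed_mem t ht p hp := by
    obtain ⟨c, rfl⟩ := surjective_coe p
    rw [S.fiber_niceSet ht]
    have hc := (hQ c).2 hp
    exact mem_iUnion₂.2 ⟨c, hc, mem_image_of_mem _ (S.center_mem_basin hδ hc)⟩
  component t ht x hx := by
    have hx' := hx
    rw [S.fiber_niceSet ht] at hx'
    obtain ⟨c, hc, hxc⟩ := mem_iUnion₂.1 hx'
    have hcomp := S.connectedComponentIn_niceSet hδ hδr ht hc
    rw [← hcomp] at hxc
    rw [← connectedComponentIn_eq hxc, hcomp]
    refine ⟨c, ⟨(hQ c).1 hc, mem_image_of_mem _ (S.center_mem_basin hδ hc)⟩, ?_⟩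
    rintro p ⟨hp, u, hu, rfl⟩
    have huQ := (hQ u).2 hp
    exact (S.coe_eq_of_coe_basin hδr hc huQ hu (S.center_mem_basin hδ huQ) rfl).symm
  -- If the orbit of a boundary point enters the nice set, the point lies in the open set `Near`. A
  -- small interval around it is in `Near` too and meets a basin; joining the two puts the point
  -- into that basin, whereas an open set contains none of its boundary points.
  boundary t ht x hx n _ hn := by
    obtain ⟨u, rfl⟩ := surjective_coe x
    have hnear : u ∈ S.Near δ t := by
      rw [← S.coe_X hF, S.fiber_niceSet (shift_mem_noiseSpace ht n)] at hn
      obtain ⟨c, hc, w, hw, hwu⟩ := mem_iUnion₂.1 hn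
      obtain ⟨m, hm⟩ := coe_eq_coe_iff.1 hwu
      refine S.near_of_near_shift (k := n) ?_
      rw [hm]
      exact S.near_add_int (hw.2 w right_mem_uIcc) m
    have hopen : IsOpen (S.Near δ t) := (S.isOpen_near (δ := δ)).preimage
      (f := fun u : ℝ => (u, t)) (Continuous.prodMk continuous_id continuous_const)
    obtain ⟨η, hη, hball⟩ := Metric.isOpen_iff.1 hopen u hnear
    have hfo : IsOpen (fiber (S.niceSet δ ε) t) := by
      rw [S.fiber_niceSet ht]
      exact isOpen_biUnion fun c' _ => isOpenMap_coe _ S.isOpen_basin_fiber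
    obtain ⟨hcl, hnot⟩ := hx
    rw [hfo.interior_eq] at hnot
    obtain ⟨y, ⟨v, hv, rfl⟩, hyf⟩ := mem_closure_iff.1 hcl _ (isOpenMap_coe _ Metric.isOpen_ball)
      (mem_image_of_mem _ (Metric.mem_ball_self hη) : (u : Circ) ∈ _ '' Metric.ball u η)
    rw [S.fiber_niceSet ht] at hyf hnot
    obtain ⟨c, hc, w, hw, hwv⟩ := mem_iUnion₂.1 hyf
    obtain ⟨m, rfl⟩ := coe_eq_coe_iff.1 hwv
    have hv' := S.basin_add_int hw m
    have hcm := S.Q_add c hc m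
    refine hnot (mem_iUnion₂.2 ⟨c + m, hcm, u,
      S.mem_basin_of_forall_near hδ (hav t ht) hcm fun z hz => ?_, rfl⟩)
    rcases uIcc_subset_uIcc_union_uIcc (b := w + m) hz with h | h
    · exact hv'.2 z h
    · apply hball
      rw [Metric.mem_ball, Real.dist_eq] at hv ⊢
      rw [uIcc_comm] at h
      exact lt_of_le_of_lt (abs_sub_left_of_mem_uIcc h) hv

end LiftSystem

/-! ### Measurability and the first good time -/

namespace LiftSystem
variable {α : ℝ} (S : LiftSystem α) {δ κ ε : ℝ} {n m₁ : ℕ}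

lemma isClosed_B : IsClosed S.B :=
  Metric.isClosed_of_pairwise_le_dist S.g_pos fun q hq q' hq' hne => by
    by_contra! hlt
    exact hne (S.B_sep q hq q' hq' (by rw [← Real.dist_eq]; exact hlt.le))

/-- With T, c, a, b fixed, the conditions are strict inequalities between continuous functions, and
finitely many compact intervals avoiding the closed set of breaks; the latter is why `Good` excludes
breaks from closed intervals. Openness makes the set of good points measurable in spite of the
quantifier over a and b. -/
lemma isOpen_good (m : ℕ) : IsOpen {z : ℝ × (ℕ → ℝ) | S.Good z.2 δ κ n m₁ m z.1} := by
  rw [isOpen_iff_mem_nhds]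
  rintro z ⟨T, rfl, hT, ⟨c, hc, h1⟩, a, b, hau, hub, h2, h3, h4, h5, h6⟩
  have hX := fun n => S.continuous_X_prod n
  have hXa : ∀ n u, Continuous fun z : ℝ × (ℕ → ℝ) => S.X z.2 n u := fun n u =>
    (S.continuous_X_right n u).comp continuous_snd
  have hα := S.α_pos
  have e1 : ∀ᶠ y : ℝ × (ℕ → ℝ) in 𝓝 z, |S.X y.2 (T + n) y.1 - c| < δ :=
    (isOpen_lt ((hX _).sub continuous_const).abs continuous_const).mem_nhds h1
  have ea : ∀ᶠ y : ℝ × (ℕ → ℝ) in 𝓝 z, a < y.1 :=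
    (isOpen_lt continuous_const continuous_fst).mem_nhds hau
  have eb : ∀ᶠ y : ℝ × (ℕ → ℝ) in 𝓝 z, y.1 < b :=
    (isOpen_lt continuous_fst continuous_const).mem_nhds hub
  have e2 : ∀ᶠ y : ℝ × (ℕ → ℝ) in 𝓝 z, κ < S.len y.2 T a y.1 :=
    (isOpen_lt continuous_const ((hX T).sub (hXa T a))).mem_nhds h2
  have e3 : ∀ᶠ y : ℝ × (ℕ → ℝ) in 𝓝 z, κ < S.len y.2 T y.1 b :=
    (isOpen_lt continuous_const ((hXa T b).sub (hX T))).mem_nhds h3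
  have e4 : ∀ᶠ y : ℝ × (ℕ → ℝ) in 𝓝 z, S.len y.2 T a b < 1 :=
    (isOpen_lt ((hXa T b).sub (hXa T a)) continuous_const).mem_nhds h4
  have e5 : ∀ᶠ y : ℝ × (ℕ → ℝ) in 𝓝 z, ∑ j ∈ Finset.range T, S.len y.2 j a b ^ α < S.κ₀ :=
    (isOpen_lt (continuous_finsetSum _ fun j _ =>
      ((hXa j b).sub (hXa j a)).rpow_const fun _ => Or.inr hα.le) continuous_const).mem_nhds h5
  have e6 : ∀ᶠ y : ℝ × (ℕ → ℝ) in 𝓝 z, ∀ j ∈ Finset.range T,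
      ∀ w ∈ uIcc (S.X y.2 j a) (S.X y.2 j b), w ∈ S.Bᶜ := by
    refine (Filter.eventually_all_finset _).2 fun j hj => ?_
    refine eventually_uIcc_subset (O := {q : ℝ × (ℝ × (ℕ → ℝ)) | q.1 ∈ S.Bᶜ})
      (S.isClosed_B.isOpen_compl.preimage continuous_fst) (hXa j a) (hXa j b) fun w hw hwB => ?_
    rw [uIcc_of_le ((S.X_le _).2 (hau.trans hub).le)] at hw
    exact h6 j (Finset.mem_range.1 hj) w hwB hw
  filter_upwards [e1, ea, eb, e2, e3, e4, e5, e6] with y y1 ya yb y2 y3 y4 y5 y6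
  refine ⟨T, rfl, hT, ⟨c, hc, y1⟩, a, b, ya, yb, y2, y3, y4, y5, fun j hj q hq hqI => ?_⟩
  exact y6 j (Finset.mem_range.2 hj) q (by
    rwa [uIcc_of_le ((S.X_le _).2 (ya.trans yb).le)]) hq

/-- The points of the circle for which `m` is a good time. -/
def goodSet (δ κ : ℝ) (n m₁ m : ℕ) : Set (Circ × (ℕ → ℝ)) :=
  Prod.map ((↑) : ℝ → Circ) (id : (ℕ → ℝ) → (ℕ → ℝ)) ''
    {z : ℝ × (ℕ → ℝ) | S.Good z.2 δ κ n m₁ m z.1}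

lemma measurableSet_goodSet (m : ℕ) : MeasurableSet (S.goodSet δ κ n m₁ m) :=
  (isOpenMap_coe_prod _ (S.isOpen_good m)).measurableSet

lemma volume_notMem_goodSet_le (t : ℕ → ℝ) (m : ℕ) :
    volume {x : Circ | ∀ k ≤ m, (x, t) ∉ S.goodSet δ κ n m₁ k} ≤
      volume (Icc 0 1 ∩ S.Bad t δ κ n m₁ m) := by
  have hmeas : MeasurableSet {x : Circ | ∀ k ≤ m, (x, t) ∉ S.goodSet δ κ n m₁ k} := by
    have : {x : Circ | ∀ k ≤ m, (x, t) ∉ S.goodSet δ κ n m₁ k} =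
        ⋂ k, ⋂ _ : k ≤ m, (fun x : Circ => (x, t)) ⁻¹' (S.goodSet δ κ n m₁ k)ᶜ := by
      ext x; simp
    rw [this]
    exact MeasurableSet.iInter fun k => MeasurableSet.iInter fun _ =>
      (S.measurableSet_goodSet k).compl.preimage measurable_prodMk_right
  rw [← (AddCircle.measurePreserving_mk 1 0).measure_preimage hmeas.nullMeasurableSet,
    Measure.restrict_apply (hmeas.preimage AddCircle.measurable_mk'), zero_add, inter_comm]
  refine measure_mono (inter_subset_inter Ioc_subset_Icc_self fun u hu k hk hgood => ?_)
  exact hu k hk ⟨(u, t), hgood, rfl⟩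

end LiftSystem

/-- The first index at which a sequence of sets is entered. -/
noncomputable def firstIndex {Z : Type*} (G : ℕ → Set Z) (z : Z) : ℕ∞ :=
  open Classical in if h : ∃ m, z ∈ G m then (Nat.find h : ℕ∞) else ⊤

lemma lt_firstIndex_iff {Z : Type*} {G : ℕ → Set Z} {z : Z} {m : ℕ} :
    (m : ℕ∞) < firstIndex G z ↔ ∀ k ≤ m, z ∉ G k := by
  classical
  rw [firstIndex]
  split_ifs with h
  · rw [Nat.cast_lt, Nat.lt_find_iff]
  · push Not at h
    simp [h]

lemma exists_firstIndex_eq {Z : Type*} {G : ℕ → Set Z} {z : Z} (h : firstIndex G z ≠ ⊤) :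
    ∃ m : ℕ, firstIndex G z = m ∧ z ∈ G m := by
  classical
  rw [firstIndex] at h ⊢
  split_ifs at h ⊢ with h'
  · exact ⟨_, rfl, Nat.find_spec h'⟩
  · exact absurd rfl h

lemma measurableSet_lt_firstIndex {Z : Type*} [MeasurableSpace Z] {G : ℕ → Set Z}
    (hG : ∀ m, MeasurableSet (G m)) (m : ℕ) : MeasurableSet {z | (m : ℕ∞) < firstIndex G z} := by
  simp only [lt_firstIndex_iff]
  have : {z | ∀ k ≤ m, z ∉ G k} = ⋂ k, ⋂ _ : k ≤ m, (G k)ᶜ := by ext z; simp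
  rw [this]
  exact MeasurableSet.iInter fun k => MeasurableSet.iInter fun _ => (hG k).compl

lemma measurable_firstIndex {Z : Type*} [MeasurableSpace Z] {G : ℕ → Set Z}
    (hG : ∀ m, MeasurableSet (G m)) : Measurable (firstIndex G) := by
  have key := measurableSet_lt_firstIndex hG
  have hle : ∀ m : ℕ, MeasurableSet {z | (m : ℕ∞) ≤ firstIndex G z} := fun m => by
    cases m with
    | zero => simp
    | succ m =>
      convert key m using 3 with z
      push_cast
      exact ENat.add_one_le_iff (ENat.natCast_ne_top m)
  refine measurable_to_countable' fun y => ?_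
  induction y using ENat.recTopCoe with
  | top =>
    have : firstIndex G ⁻¹' {⊤} = ⋂ m : ℕ, {z | (m : ℕ∞) < firstIndex G z} := by
      ext z
      simp only [mem_preimage, mem_singleton_iff, mem_iInter]
      exact ENat.eq_top_iff_forall_gt
    rw [this]
    exact MeasurableSet.iInter key
  | coe m =>
    have : firstIndex G ⁻¹' {(m : ℕ∞)} =
        {z | (m : ℕ∞) ≤ firstIndex G z} \ {z | (m : ℕ∞) < firstIndex G z} := by
      ext z
      change firstIndex G z = m ↔ (m : ℕ∞) ≤ firstIndex G z ∧ ¬ (m : ℕ∞) < firstIndex G z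
      rw [not_lt, le_antisymm_iff, and_comm]
    rw [this]
    exact (hle m).diff (key m)

lemma isProbabilityMeasure_noiseLaw {ε : ℝ} (hε : 0 < ε) : IsProbabilityMeasure (noiseLaw ε) :=
  cond_isProbabilityMeasure_of_finite (by simp [Real.volume_Icc, hε]) (by simp [Real.volume_Icc])

/-- A set all of whose sections over the noise space are small is small. -/
lemma jointLaw_le {ε : ℝ} (hε : 0 < ε) {A : Set (Circ × (ℕ → ℝ))} (hA : MeasurableSet A)
    {M : ℝ≥0∞} (h : ∀ t, volume {x | (x, t) ∈ A} ≤ M) : jointLaw ε A ≤ M := by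
  have := isProbabilityMeasure_noiseLaw hε
  rw [jointLaw, Measure.prod_apply_symm hA]
  refine (lintegral_mono h).trans ?_
  rw [lintegral_const, measure_univ, mul_one]

/-! ### Assembling the theorem -/

namespace LiftSystem
variable {α : ℝ} (S : LiftSystem α)

lemma jointLaw_lt_firstIndex_le {δ κ ε : ℝ} {n m₁ m : ℕ} (hε : 0 < ε) {M : ℝ≥0∞}
    (h : ∀ t ∈ noiseSpace ε, volume (Icc 0 1 ∩ S.Bad t δ κ n m₁ m) ≤ M) :
    jointLaw ε {z | z ∈ S.niceSet δ ε ∧ (m : ℕ∞) < firstIndex (S.goodSet δ κ n m₁) z} ≤ M := by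
  have hmeas : MeasurableSet
      {z | z ∈ S.niceSet δ ε ∧ (m : ℕ∞) < firstIndex (S.goodSet δ κ n m₁) z} :=
    S.measurableSet_niceSet.inter (measurableSet_lt_firstIndex S.measurableSet_goodSet m)
  refine jointLaw_le hε hmeas fun t => ?_
  -- The product measure lives on all sequences; for t outside the noise space the section of the
  -- nice set is empty.
  by_cases ht : t ∈ noiseSpace ε
  · refine le_trans (measure_mono ?_) ((S.volume_notMem_goodSet_le t m).trans (h t ht))
    exact fun x hx => lt_firstIndex_iff.1 hx.2
  · have : {x : Circ | (x, t) ∈ {z | z ∈ S.niceSet δ ε ∧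
        (m : ℕ∞) < firstIndex (S.goodSet δ κ n m₁) z}} = ∅ :=
      eq_empty_of_forall_notMem fun x hx => ht hx.1.1
    rw [this, measure_empty]
    exact bot_le

end LiftSystem

/-- The function mV is the first good time. At a good time the orbit is within δ of a fixed point,
hence in the nice set, and the bounds for distortion and expansion hold by construction, with an
arbitrary lower bound `lam` for the expansion. -/
lemma LiftSystem.exists_niceSet {α : ℝ} (S : LiftSystem α) {f : Circ → Circ}
    (hF : ∀ u : ℝ, ((S.F u : ℝ) : Circ) = f (u : Circ)) {P₀ : Set Circ}
    (hQ : ∀ u : ℝ, u ∈ S.Q ↔ (u : Circ) ∈ P₀) {τ : ℝ} (hτ0 : 0 < τ) (hτ : τ < 1 / 2)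
    {q : ℝ} (hq : 0 < q) (hαq : α * q < 1) (lam : ℝ) :
    ∃ δ₀ : ℝ, 0 < δ₀ ∧ ∀ δ : ℝ, 0 < δ → δ < δ₀ →
      ∃ K C ε₀ : ℝ, 0 < K ∧ 0 < C ∧ 0 < ε₀ ∧ ∀ ε : ℝ, 0 < ε → ε < ε₀ →
        ∃ V : Set (Circ × (ℕ → ℝ)), IsNiceSet f P₀ ε V ∧
          (∀ t ∈ noiseSpace ε, ∀ p ∈ P₀,
            Metric.ball p δ ⊆ connectedComponentIn (fiber V t) p ∧
              connectedComponentIn (fiber V t) p ⊆ Metric.ball p (2 * δ)) ∧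
          ∃ mV : Circ × (ℕ → ℝ) → ℕ∞, Measurable mV ∧
            (∀ᵐ z ∂(jointLaw ε), z ∈ V → ∃ m : ℕ, 1 ≤ m ∧ mV z = (m : ℕ∞) ∧
              randIter f z.2 m z.1 ∈ fiber V (shift m z.2) ∧
              distortion α f τ m z.1 z.2 ≤ K ∧ lam ≤ expansion f τ m z.1 z.2) ∧
            ∀ m : ℕ, 1 ≤ m →
              jointLaw ε {z | z ∈ V ∧ (m : ℕ∞) < mV z} ≤ ENNReal.ofReal (C * (m : ℝ) ^ (-q)) := by
  obtain ⟨δ₁, hδ₁, hav⟩ := S.exists_avoiding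
  obtain ⟨δ₂, hδ₂, htail⟩ := S.exists_tail hq hαq lam
  have hr := S.r_pos
  refine ⟨min (min δ₁ δ₂) (S.r / 4), by positivity, fun δ hδ hδ' => ?_⟩
  obtain ⟨⟨hδ1, hδ2⟩, hδr⟩ : (δ < δ₁ ∧ δ < δ₂) ∧ δ < S.r / 4 := by simpa [lt_min_iff] using hδ'
  obtain ⟨ε₁, hε₁, hav⟩ := hav δ hδ hδ1
  obtain ⟨ε₂, hε₂, κ, hκ, n, m₁, hm₁1, C, hC, hn, hm₁, htail⟩ := htail δ hδ hδ2
  have hκ₀ := S.κ₀_pos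
  refine ⟨n + S.κ₀ / κ ^ α, C, min ε₁ ε₂, by positivity, hC, lt_min hε₁ hε₂, fun ε hε hε' => ?_⟩
  obtain ⟨hε1, hε2⟩ : ε < ε₁ ∧ ε < ε₂ := by simpa [lt_min_iff] using hε'
  have hnoise : ∀ t ∈ noiseSpace ε, ∀ i, |t i| ≤ ε := fun t ht i => abs_le.2 (ht i)
  have hδr' : 4 * δ ≤ S.r := by linarith
  have hbound : ∀ m : ℕ, 1 ≤ m →
      jointLaw ε {z | z ∈ S.niceSet δ ε ∧ (m : ℕ∞) < firstIndex (S.goodSet δ κ n m₁) z} ≤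
        ENNReal.ofReal (C * (m : ℝ) ^ (-q)) := fun m hm =>
    S.jointLaw_lt_firstIndex_le hε fun t ht =>
      htail t (fun i => (hnoise t ht i).trans hε2.le) m hm
  -- The polynomial tail tends to 0, so almost every point of the nice set has a good time.
  have hnull : jointLaw ε {z | z ∈ S.niceSet δ ε ∧ firstIndex (S.goodSet δ κ n m₁) z = ⊤} = 0 := by
    have hlim : Tendsto (fun m : ℕ => ENNReal.ofReal (C * (m : ℝ) ^ (-q))) atTop (𝓝 0) := by
      have h1 := ((tendsto_rpow_neg_atTop hq).comp tendsto_natCast_atTop_atTop).const_mul C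
      rw [mul_zero] at h1
      simpa using ENNReal.tendsto_ofReal h1
    refine le_antisymm (ge_of_tendsto hlim ?_) bot_le
    filter_upwards [eventually_ge_atTop 1] with m hm
    refine (measure_mono fun z hz => ?_).trans (hbound m hm)
    refine ⟨hz.1, ?_⟩
    rw [hz.2]
    exact ENat.natCast_lt_top m
  refine ⟨S.niceSet δ ε, S.isNiceSet_niceSet hF hQ hδ hδr' fun t ht =>
    hav t fun i => (hnoise t ht i).trans hε1.le, fun t ht p hp => ?_,
    firstIndex (S.goodSet δ κ n m₁), measurable_firstIndex S.measurableSet_goodSet, ?_, hbound⟩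
  · obtain ⟨c, rfl⟩ := surjective_coe p
    have hc := (hQ c).2 hp
    rw [S.connectedComponentIn_niceSet hδ hδr' ht hc]
    exact ⟨S.ball_subset_basin hc, S.basin_subset_ball⟩
  · rw [ae_iff]
    refine measure_mono_null (fun z hz => ?_) hnull
    rw [mem_ofPred_eq, Classical.not_imp] at hz
    refine ⟨hz.1, by_contra fun htop => hz.2 ?_⟩
    obtain ⟨m, hm, ⟨u, t⟩, hgood, rfl⟩ := exists_firstIndex_eq htop
    have ht : t ∈ noiseSpace ε := hz.1.1
    have hgood : S.Good t δ κ n m₁ m u := hgood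
    obtain ⟨hdist, hexp⟩ := hgood.circle_bounds S hF hτ0 hτ hκ (hn t) (hm₁ t)
    obtain ⟨T, hmT, hT, ⟨c, hc, huc⟩, -⟩ := hgood
    refine ⟨m, by omega, hm, ?_, hdist, hexp⟩
    change randIter f t m (u : Circ) ∈ fiber (S.niceSet δ ε) (shift m t)
    rw [S.fiber_niceSet (LiftSystem.shift_mem_noiseSpace ht m), ← S.coe_X hF]
    refine mem_iUnion₂.2 ⟨c, hc, S.ball_subset_basin hc ?_⟩
    exact lt_of_le_of_lt (dist_coe_le _ _) huc

/-- Without fixed points in P₀ there is no lifted system, but the empty set is then a nice set. -/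
lemma exists_niceSet_of_isEmpty (α : ℝ) (f : Circ → Circ) (τ lam q : ℝ) :
    ∃ δ₀ : ℝ, 0 < δ₀ ∧ ∀ δ : ℝ, 0 < δ → δ < δ₀ →
      ∃ K C ε₀ : ℝ, 0 < K ∧ 0 < C ∧ 0 < ε₀ ∧ ∀ ε : ℝ, 0 < ε → ε < ε₀ →
        ∃ V : Set (Circ × (ℕ → ℝ)), IsNiceSet f ∅ ε V ∧
          (∀ t ∈ noiseSpace ε, ∀ p ∈ (∅ : Set Circ),
            Metric.ball p δ ⊆ connectedComponentIn (fiber V t) p ∧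
              connectedComponentIn (fiber V t) p ⊆ Metric.ball p (2 * δ)) ∧
          ∃ mV : Circ × (ℕ → ℝ) → ℕ∞, Measurable mV ∧
            (∀ᵐ z ∂(jointLaw ε), z ∈ V → ∃ m : ℕ, 1 ≤ m ∧ mV z = (m : ℕ∞) ∧
              randIter f z.2 m z.1 ∈ fiber V (shift m z.2) ∧
              distortion α f τ m z.1 z.2 ≤ K ∧ lam ≤ expansion f τ m z.1 z.2) ∧
            ∀ m : ℕ, 1 ≤ m →
              jointLaw ε {z | z ∈ V ∧ (m : ℕ∞) < mV z} ≤ ENNReal.ofReal (C * (m : ℝ) ^ (-q)) := by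
  have hfib : ∀ t, fiber ∅ t = ∅ := fun t => rfl
  exact ⟨1, one_pos, fun δ _ _ => ⟨1, 1, 1, one_pos, one_pos, one_pos, fun ε _ _ => ⟨∅,
    ⟨MeasurableSet.empty, empty_subset _, fun t _ => isOpen_empty, fun t _ => empty_subset _,
      fun t _ x hx => hx.elim, fun t _ x hx => by simp [hfib] at hx⟩,
    fun t _ p hp => hp.elim, fun _ => 0, measurable_const,
    Filter.Eventually.of_forall fun z hz => hz.elim, fun m _ => by simp⟩⟩⟩

end Intermittent

open Intermittent in
theorem theorem6p1 (α : ℝ) (hα₀ : 0 < α) (hα₁ : α < 1)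
    (f : Circ → Circ) (P : Set Circ) (N : ℕ) (hf : IsClassE α f P N)
    (I : Set Circ) (hI : IsAdmissibleNhd f (fixedSet f P N) I)
    (τ : ℝ) (hτ : IsAdmissibleScale f I τ)
    (α' : ℝ) (hα' : α < α') (hα'₁ : α' < 1) :
    ∃ δ₀ : ℝ, 0 < δ₀ ∧ ∀ δ : ℝ, 0 < δ → δ < δ₀ →
      ∃ K C ε₀ : ℝ, 0 < K ∧ 0 < C ∧ 0 < ε₀ ∧ ∀ ε : ℝ, 0 < ε → ε < ε₀ →
        ∃ V : Set (Circ × (ℕ → ℝ)), IsNiceSet f (fixedSet f P N) ε V ∧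
          (∀ t ∈ noiseSpace ε, ∀ p ∈ fixedSet f P N,
            Metric.ball p δ ⊆ connectedComponentIn (fiber V t) p ∧
              connectedComponentIn (fiber V t) p ⊆ Metric.ball p (2 * δ)) ∧
          ∃ mV : Circ × (ℕ → ℝ) → ℕ∞, Measurable mV ∧
            (∀ᵐ z ∂(jointLaw ε), z ∈ V → ∃ m : ℕ, 1 ≤ m ∧ mV z = (m : ℕ∞) ∧
              randIter f z.2 m z.1 ∈ fiber V (shift m z.2) ∧
              distortion α f τ m z.1 z.2 ≤ K ∧
              lambdaStar f I ≤ expansion f τ m z.1 z.2) ∧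
            ∀ m : ℕ, 1 ≤ m →
              jointLaw ε {z | z ∈ V ∧ (m : ℕ∞) < mV z} ≤
                ENNReal.ofReal (C * (m : ℝ) ^ (-1 / α')) := by
  rw [neg_div]
  rcases P.eq_empty_or_nonempty with rfl | hP
  · rw [show fixedSet f ∅ N = ∅ from image_empty _]
    exact exists_niceSet_of_isEmpty α f τ (lambdaStar f I) (1 / α')
  · have hα'0 : 0 < α' := hα₀.trans hα'
    obtain ⟨S, hF, -, hQ⟩ := hf.exists_liftSystem hα₀ hP
    -- With q = 1 / α', the requirement α q < 1 is exactly α < α'.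
    exact S.exists_niceSet hF hQ hτ.1 hτ.2.1 (one_div_pos.2 hα'0)
      (by rwa [mul_one_div, div_lt_one hα'0]) (lambdaStar f I)
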